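/- **Setting.** Let $\mathbb X$ be a compact metric space with metric $\rho$ and a Borel probability measure $\mu^*$, let $0=\lambda_0\le\lambda_1\le\cdots$ with $\lambda_k\to\infty$, and let $\{\phi_k\}_{k\ge0}$ be continuous real functions orthonormal in $L^2(\mu^*)$. Assume that $(\mathbb X,\rho,\mu^*,\{\lambda_k\},\{\phi_k\})$ is a compact data space with exponent $q\ge1$: there are $\kappa,\kappa_1,\kappa_2>0$ such that $\mu^*(\{y:\rho(x,y)\le r\})=\mu^*(\{y:\rho(x,y)<r\})\le\kappa r^q$ for all $x\in\mathbb X$, $r>0$, and, for all $x,y\in\mathbb X$, $0<t\le1$, the following series converges and $$\Big|\sum_{k\ge0}e^{-\lambda_k^2t}\phi_k(x)\phi_k(y)\Big|\le\kappa_1t^{-q/2}\exp\!\big(-\kappa_2\rho(x,y)^2/t\big).$$ Let $\Pi_n=\mathrm{span}\{\phi_k:\lambda_k<n\}$, $\Pi_\infty=\bigcup_n\Pi_n$, $\mathbf S_0=\{k:\lambda_k<1\}$, $\mathbf S_j=\{k:2^{j-2}\le\lambda_k<2^j\}$ for $j\ge1$, and $\mathbf V_j=\mathrm{span}\{\phi_k:k\in\mathbf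 S_j\}$. With $L^p=L^p(\mu^*)$ put $E_{p;n}(f)=\min_{P\in\Pi_n}\|f-P\|_p$, $X^p=\{f\in L^p:E_{p;n}(f)\to0\}$, and, for $\gamma>0$, let $W_{p;\gamma}$ be the set of $f\in X^p$ with $\|f\|_{p;\gamma}=\|f\|_p+\sup_{j\ge0}2^{j\gamma}E_{p;2^j}(f)<\infty$. Assume that the constant function $1$ belongs to $X^\infty$ (for instance $\phi_0\equiv1$). For $0<\alpha\le 1$ put $\|f\|_{\mathrm{Lip}(\alpha)}=\|f\|_\infty+\sup_{x\ne x'}|f(x)-f(x')|/\rho(x,x')^\alpha$. Let $\mathbb Y$ be a measurable space with a probability measure $\mu_{\mathbb Y}^*$, let $0<\alpha\le1$, $\beta>0$, and let $G:\mathbb Z_+\times\mathbb X\times\mathbb Y\to\mathbb R$ be an asymmetric eignet kernel with exponents $(\alpha,\beta)$: $G$ is measurable in $y$, $\sup_y\|G(\ell;\cdot,y)\|_{\mathrm{Lip}(\alpha)}<\infty$ for every $\ell$, and there are measurable $\mathcal D_G\phi_\ell:\mathbb Y\to\mathbb R$ with $\phi_\ell(x)=\int_{\mathbb Y}G(\ell;x,y)\,\mathcal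 D_G\phi_\ell(y)\,d\mu_{\mathbb Y}^*(y)$ for all $\ell,x$, and $\int_{\mathbb Y}|\mathcal D_G\phi_\ell|^2d\mu_{\mathbb Y}^*\lesssim2^{2j\beta}$ for $\ell\in\mathbf S_j$, $j\ge0$. Let $1\le p\le\infty$, $J\ge1$, and let $\mathcal U_1,\dots,\mathcal U_J$ be linear operators which are * derivative-like with exponents $a_1,\dots,a_J\in\mathbb R$: each $\mathcal U_k$ is a closed operator, with values in $L^p$, whose domain is a subspace of $X^p$ containing $\Pi_\infty$, and $\|\mathcal U_kP\|_p\lesssim2^{ja_k}\|P\|_p$ for $P\in\mathbf V_j$, $j\ge0$; * compatible with $G$: each $G(\ell;\cdot,y)$ lies in the domain of $\mathcal U_k$, the function $\mathcal U_k(G)(\ell;x,y)=\mathcal U_k(G(\ell;\cdot,y))(x)$ is measurable in $y$, and $\mathcal U_k\phi_\ell(x)=\int_{\mathbb Y}\mathcal U_k(G)(\ell;x,y)\,\mathcal D_G\phi_\ell(y)\,d\mu_{\mathbb Y}^*(y)$. Let $a_*=\min_ka_k$ and $a^*=\max_ka_k$, and let $\gamma>\max(0,a^*)$. Put $$T_n=\begin{cases}2^{n(q/2+\beta-\gamma)},&\gamma<q/2+\beta,\\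 n,&\gamma=q/2+\beta,\\ 1,&\gamma>q/2+\beta,\end{cases}$$ $$\mathbf G_n=\sup_{\lambda_\ell<2^n,\,y,\,k}\|\mathcal U_k(G)(\ell;\cdot,y)\|_\infty,\qquad \mathbf L_n=\sup_{\lambda_\ell<2^n,\,y,\,k}\|\mathcal U_k(G)(\ell;\cdot,y)\|_{\mathrm{Lip}(\alpha)},$$ and assume that for some $A,B\in\mathbb R$, $\mathbf G_n\lesssim2^{nA}$ and $\mathbf L_n\lesssim2^{nB}$ for all integers $n\ge0$. **Theorem.** There are constants $c,C>0$, depending only on the data above and not on $f$ or $M$, such that for every integer $M\ge2$ there is an integer $n=n(M)\ge0$ with the following property. For every $f\in W_{\max(p,2);\gamma}$ there are $(\ell_j,y_j)\in\mathbb Z_+\times\mathbb Y$ and $w_j\in\{-1,1\}$, $j=1,\dots,M$, such that for every $k=1,\dots,J$, $f$ lies in the domain of $\mathcal U_k$ and $$\Big\|\mathcal U_k(f)-\frac{c\,\|f\|_{\max(p,2);\gamma}\,T_n}{M}\sum_{j=1}^Mw_j\,\mathcal U_k(G)(\ell_j;\cdot,y_j)\Big\|_p\le C\,\|f\|_{\max(p,2);\gamma}\,R_k(M),$$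 $$R_k(M)=\begin{cases}\Big(\dfrac{\log M}{M}\Big)^{(\gamma-a_k)/(q+2\beta+2A-2a_*)},&\gamma<q/2+\beta,\\[2ex]\Big(\dfrac{(\log M)^3}{M}\Big)^{(\gamma-a_k)/(2A+2\gamma-2a_*)},&\gamma=q/2+\beta,\\[2ex]\Big(\dfrac{\log M}{M}\Big)^{(\gamma-a_k)/(2A+2\gamma-2a_*)},&\gamma>q/2+\beta,\end{cases}$$ where an exponent with denominator $0$ is read as $0$ (this can occur only for $A<0$, and then every $\mathcal U_k(G)$ vanishes). -/

import Mathlib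

open MeasureTheory Filter Topology
open scoped ENNReal

/-- A compact data space: a compact metric space `X` with a Borel probability measure `μ`, a
non-decreasing sequence `eig` (the numbers `λ_k`) with `λ_0 = 0` and `λ_k → ∞`, a sequence of
continuous functions `φ k` orthonormal in `L²(μ)`, and an exponent `q ≥ 1`, subject to the ball
measure condition and the Gaussian upper bound (whose series is required to converge). -/
structure DataSpace (X : Type*) [MetricSpace X] [CompactSpace X] [MeasurableSpace X]
    [BorelSpace X] where
  μ : Measure X
  prob : IsProbabilityMeasure μ
  eig : ℕ → ℝ
  eig_mono : Monotone eig
  eig_zero : eig 0 = 0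
  eig_tendsto : Tendsto eig atTop atTop
  φ : ℕ → X → ℝ
  φ_continuous : ∀ k, Continuous (φ k)
  φ_orthonormal : ∀ i j, ∫ x, φ i x * φ j x ∂μ = if i = j then 1 else 0
  q : ℝ
  one_le_q : 1 ≤ q
  ball_measure : ∃ κ : ℝ, 0 < κ ∧ ∀ (x : X) (r : ℝ), 0 < r →
    μ (Metric.closedBall x r) = μ (Metric.ball x r) ∧
    μ (Metric.closedBall x r) ≤ ENNReal.ofReal (κ * r ^ q)
  gaussian_bound : ∃ κ₁ κ₂ : ℝ, 0 < κ₁ ∧ 0 < κ₂ ∧ ∀ (x y : X) (t : ℝ), 0 < t → t ≤ 1 →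
    Summable (fun k => Real.exp (-(eig k) ^ 2 * t) * φ k x * φ k y) ∧
    |∑' k, Real.exp (-(eig k) ^ 2 * t) * φ k x * φ k y|
      ≤ κ₁ * t ^ (-q / 2) * Real.exp (-κ₂ * (dist x y ^ 2 / t))

namespace DataSpace

section

variable {X : Type*} [MetricSpace X] [CompactSpace X] [MeasurableSpace X] [BorelSpace X]

/-- Diffusion polynomials of order `< n`: the span of the `φ k` with `λ_k < n`. -/
def poly (Ξ : DataSpace X) (n : ℝ) : Submodule ℝ (X → ℝ) :=
  Submodule.span ℝ (Ξ.φ '' {k | Ξ.eig k < n})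

/-- The dyadic frequency bands: `λ_k < 1` for `j = 0`, and `2^(j-2) ≤ λ_k < 2^j` for `j ≥ 1`. -/
def band (Ξ : DataSpace X) (j : ℕ) : Set ℕ :=
  {k | (j = 0 ∨ (2 : ℝ) ^ ((j : ℝ) - 2) ≤ Ξ.eig k) ∧ Ξ.eig k < 2 ^ j}

/-- The span of the `φ k` with frequency in the `j`-th band. -/
def bandPoly (Ξ : DataSpace X) (j : ℕ) : Submodule ℝ (X → ℝ) :=
  Submodule.span ℝ (Ξ.φ '' Ξ.band j)

/-- The degree of approximation `E_{p;n}(f)`. -/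
noncomputable def degApprox (Ξ : DataSpace X) (p : ℝ≥0∞) (n : ℝ) (f : X → ℝ) : ℝ≥0∞ :=
  ⨅ P ∈ Ξ.poly n, eLpNorm (fun x => f x - P x) p Ξ.μ

/-- Membership in `X^p`: `f ∈ L^p` and `E_{p;n}(f) → 0`. -/
def MemX (Ξ : DataSpace X) (p : ℝ≥0∞) (f : X → ℝ) : Prop :=
  MemLp f p Ξ.μ ∧ Tendsto (fun n : ℕ => Ξ.degApprox p n f) atTop (𝓝 0)

/-- The Sobolev norm `‖f‖_p + sup_{j ≥ 0} 2^{jγ} E_{p;2^j}(f)`, possibly infinite. -/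
noncomputable def sobolevNorm (Ξ : DataSpace X) (p : ℝ≥0∞) (γ : ℝ) (f : X → ℝ) : ℝ≥0∞ :=
  eLpNorm f p Ξ.μ +
    ⨆ j : ℕ, ENNReal.ofReal ((2 : ℝ) ^ ((j : ℝ) * γ)) * Ξ.degApprox p (2 ^ j) f

/-- Membership in the class `W_{p;γ}`. -/
def MemSobolev (Ξ : DataSpace X) (p : ℝ≥0∞) (γ : ℝ) (f : X → ℝ) : Prop :=
  Ξ.MemX p f ∧ Ξ.sobolevNorm p γ f < ∞

/-- The `Lip(α)` norm `‖f‖_∞ + sup_{x ≠ x'} |f x - f x'| / ρ(x,x')^α`, possibly infinite. -/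
noncomputable def lipNorm (Ξ : DataSpace X) (α : ℝ) (f : X → ℝ) : ℝ≥0∞ :=
  eLpNorm f ∞ Ξ.μ +
    ⨆ (x : X) (x' : X) (_ : x ≠ x'), ENNReal.ofReal (|f x - f x'| / dist x x' ^ α)

/-- `U` is a derivative-like operator in `X^p` with exponent `a`: a closed linear operator, defined
on a subspace of `X^p` that contains all diffusion polynomials, with `‖U P‖_p ≲ 2^{ja} ‖P‖_p` for
`P` in the `j`-th band. Its values are only required to lie in `L^p`. -/
structure IsDerivativeLike (Ξ : DataSpace X) (p : ℝ≥0∞) [Fact (1 ≤ p)]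
    (U : Lp ℝ p Ξ.μ →ₗ.[ℝ] Lp ℝ p Ξ.μ) (a : ℝ) : Prop where
  closed : U.IsClosed
  domain_subset : ∀ F : U.domain, Ξ.MemX p (F : Lp ℝ p Ξ.μ)
  poly_mem : ∀ (n : ℕ), ∀ P ∈ Ξ.poly n, ∃ F : U.domain, ((F : Lp ℝ p Ξ.μ) : X → ℝ) =ᵐ[Ξ.μ] P
  bernstein : ∃ C : ℝ, ∀ (j : ℕ), ∀ P ∈ Ξ.bandPoly j, ∀ F : U.domain,
    ((F : Lp ℝ p Ξ.μ) : X → ℝ) =ᵐ[Ξ.μ] P →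
      eLpNorm (U F) p Ξ.μ ≤ ENNReal.ofReal (C * (2 : ℝ) ^ ((j : ℝ) * a)) * eLpNorm P p Ξ.μ

variable {Y : Type*} [MeasurableSpace Y]

/-- `G` is an asymmetric eignet kernel with exponents `(α, β)`; `D ℓ` is the function
`𝒟_G φ_ℓ` of the connection condition. -/
structure IsEignetKernel (Ξ : DataSpace X) (ν : Measure Y) (α β : ℝ)
    (G : ℕ → X → Y → ℝ) (D : ℕ → Y → ℝ) : Prop where
  alpha_pos : 0 < α
  alpha_le_one : α ≤ 1
  aesm_G : ∀ ℓ x, AEStronglyMeasurable (G ℓ x) ν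
  aesm_D : ∀ ℓ, AEStronglyMeasurable (D ℓ) ν
  connection : ∀ ℓ x, Ξ.φ ℓ x = ∫ y, G ℓ x y * D ℓ y ∂ν
  connection_bound : ∃ C : ℝ, ∀ (j : ℕ), ∀ ℓ ∈ Ξ.band j,
    ∫⁻ y, ENNReal.ofReal (|D ℓ y| ^ 2) ∂ν ≤ ENNReal.ofReal (C * (2 : ℝ) ^ (2 * (j : ℝ) * β))
  smooth : ∀ ℓ, ⨆ y, Ξ.lipNorm α (fun x => G ℓ x y) < ∞

/-- `U` is compatible with `G`, the function `UG` being `(ℓ, x, y) ↦ U(G(ℓ; ·, y))(x)`: each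
`G(ℓ; ·, y)` lies in the domain of `U`, `UG ℓ · y` is a representative of its image, `UG` is
measurable in `y`, and `U φ_ℓ (x) = ∫ UG(ℓ; x, y) 𝒟_G φ_ℓ(y) dν(y)`. -/
structure IsCompatible (Ξ : DataSpace X) (ν : Measure Y) (p : ℝ≥0∞) [Fact (1 ≤ p)]
    (G : ℕ → X → Y → ℝ) (D : ℕ → Y → ℝ)
    (U : Lp ℝ p Ξ.μ →ₗ.[ℝ] Lp ℝ p Ξ.μ) (UG : ℕ → X → Y → ℝ) : Prop where
  apply_G : ∀ ℓ y, ∃ F : U.domain,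
    ((F : Lp ℝ p Ξ.μ) : X → ℝ) =ᵐ[Ξ.μ] (fun x => G ℓ x y) ∧
    (U F : X → ℝ) =ᵐ[Ξ.μ] (fun x => UG ℓ x y)
  aesm : ∀ ℓ x, AEStronglyMeasurable (UG ℓ x) ν
  apply_φ : ∀ ℓ, ∃ F : U.domain,
    ((F : Lp ℝ p Ξ.μ) : X → ℝ) =ᵐ[Ξ.μ] Ξ.φ ℓ ∧
    (U F : X → ℝ) =ᵐ[Ξ.μ] (fun x => ∫ y, UG ℓ x y * D ℓ y ∂ν)

/-- The quantity `𝐆_n`: the supremum of `‖U_k(G)(ℓ; ·, y)‖_∞` over `λ_ℓ < 2^n`, `y` and `k`. -/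
noncomputable def supG (Ξ : DataSpace X) {J : ℕ} (UG : Fin J → ℕ → X → Y → ℝ) (n : ℕ) : ℝ≥0∞ :=
  ⨆ (ℓ : ℕ) (_ : Ξ.eig ℓ < 2 ^ n) (y : Y) (k : Fin J), eLpNorm (fun x => UG k ℓ x y) ∞ Ξ.μ

/-- The quantity `𝐋_n`: the supremum of the `Lip(α)` norms of `U_k(G)(ℓ; ·, y)` over
`λ_ℓ < 2^n`, `y` and `k`. -/
noncomputable def supL (Ξ : DataSpace X) (α : ℝ) {J : ℕ} (UG : Fin J → ℕ → X → Y → ℝ) (n : ℕ) :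
    ℝ≥0∞ :=
  ⨆ (ℓ : ℕ) (_ : Ξ.eig ℓ < 2 ^ n) (y : Y) (k : Fin J), Ξ.lipNorm α (fun x => UG k ℓ x y)

end

end DataSpace

/-- The scale `T_n(γ, β)`. -/
noncomputable def eignetScale (q β γ : ℝ) (n : ℕ) : ℝ :=
  if γ < q / 2 + β then (2 : ℝ) ^ ((n : ℝ) * (q / 2 + β - γ))
  else if γ = q / 2 + β then (n : ℝ)
  else 1

/-- The rate of approximation by `M` terms; `a` is the exponent of the operator at hand and `aMin`
the smallest exponent. -/
noncomputable def eignetRate (q β γ A aMin a : ℝ) (M : ℕ) : ℝ :=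
  if γ < q / 2 + β then
    (Real.log M / M) ^ ((γ - a) / (q + 2 * β + 2 * A - 2 * aMin))
  else if γ = q / 2 + β then
    ((Real.log M) ^ 3 / M) ^ ((γ - a) / (2 * A + 2 * γ - 2 * aMin))
  else
    (Real.log M / M) ^ ((γ - a) / (2 * A + 2 * γ - 2 * aMin))

/-! The argument discretises an integral representation of a smoothed `f` by random sampling, after
a low-pass filter that is stable in every L^p has been built.

The filter. With `t = 4^(-j)` and `u = exp(-λ²t)`, the multiplier is `u H(u)`, where `H` is smooth,
equals `1/u` for frequencies up to `2^(j-1)` and vanishes from `2^j` on. `H` is expanded in shifted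
Chebyshev polynomials with rapidly decaying coefficients. The term of degree `m` is a polynomial in
the heat operator: its kernel is at most `7^m` times a Gaussian of time `(m+1)t`, hence harmless
beyond distance of order `(m+1)√t`; within that distance `|T_m| ≤ 1` gives an L² bound. The L¹ norms
thus grow only polynomially in `m`, the expansion converges (`exists_filter`), and Schur's test
bounds the filter on L^p. So filtered partial sums are near-best approximants, and dyadic blocks of
`f` have size `2^(-jγ)`.

The operators. On the block of order `j` an operator costs `2^(ja)`, so the images of the partial
sums form a Cauchy sequence; closedness puts `f` in the domain, with truncation error `2^(n(a-γ))`
(`exists_approx`). By compatibility the image of the partial sum of level `n` is an integral of `UG`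
against a signed measure on finitely many copies of `Y`. Cauchy-Schwarz over the roughly `2^(jq)`
frequencies of each block bounds its mass by a multiple of `‖f‖ T_n` (`exists_mass_le`).

The sampling. Normalised, the signed measure becomes a probability with signs. Hoeffding's lemma and
a greedy choice of the samples control all operators at all points of a net at once, the cost being
the square root of the logarithm of the number of constraints divided by `M` (`exists_samples`). The
Hölder bounds pass from the net to a conull set (`exists_uniform_signed_samples`). Nets of
polynomial size exist because approximability of the constant `1` forces a polynomial lower bound
for ball volumes (`exists_measure_ball_ge`, `exists_nets`). A mesh that is a power of `1/M` then
suffices, and the logarithm is of order `log M`.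

Balancing truncation against sampling, of order `T_n 2^(nA) √(log M / M)`, fixes `n` in terms of `M`
alone (`exists_scale`). If `A < 0` all kernels vanish, the operators are zero on the class, and
nothing has to be approximated. -/

namespace DataSpace

/-! ### Heat kernel: Gaussian bounds, eigenvalue counting, Gaussian integrals. -/

section Heat

variable {X : Type*} [MetricSpace X] [CompactSpace X] [MeasurableSpace X] [BorelSpace X]
  (Ξ : DataSpace X)

instance : IsProbabilityMeasure Ξ.μ := Ξ.prob

lemma q_pos : 0 < Ξ.q := zero_lt_one.trans_le Ξ.one_le_q

lemma eig_nonneg (k : ℕ) : 0 ≤ Ξ.eig k := Ξ.eig_zero ▸ Ξ.eig_mono (Nat.zero_le k)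

lemma finite_eig_lt (r : ℝ) : {k | Ξ.eig k < r}.Finite := by
  obtain ⟨N, hN⟩ := (Ξ.eig_tendsto.eventually_ge_atTop r).exists_forall_of_atTop
  exact (Set.finite_lt_nat N).subset fun k hk => by
    by_contra h
    exact absurd (hN k (not_lt.1 h)) (not_le.2 hk)

lemma exists_abs_phi_le (k : ℕ) : ∃ C : ℝ, 0 ≤ C ∧ ∀ x, |Ξ.φ k x| ≤ C := by
  obtain ⟨C, hC⟩ := (isCompact_univ (X := X)).exists_bound_of_continuousOn
    (Ξ.φ_continuous k).continuousOn
  exact ⟨max C 0, le_max_right _ _, fun x => (hC x trivial).trans (le_max_left _ _)⟩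

lemma memLp_phi (k : ℕ) (p : ℝ≥0∞) : MemLp (Ξ.φ k) p Ξ.μ := by
  obtain ⟨C, -, hC⟩ := Ξ.exists_abs_phi_le k
  exact MemLp.of_bound (Ξ.φ_continuous k).aestronglyMeasurable C (ae_of_all _ hC)

/-- The Gaussian bound on the diagonal. -/
lemma exists_diag_bound : ∃ κ : ℝ, 0 < κ ∧ ∀ (x : X) (t : ℝ), 0 < t → t ≤ 1 →
    Summable (fun k => Real.exp (-(Ξ.eig k) ^ 2 * t) * Ξ.φ k x ^ 2) ∧
    ∑' k, Real.exp (-(Ξ.eig k) ^ 2 * t) * Ξ.φ k x ^ 2 ≤ κ * t ^ (-Ξ.q / 2) := by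
  obtain ⟨κ₁, κ₂, h1, h2, h⟩ := Ξ.gaussian_bound
  refine ⟨κ₁, h1, fun x t ht ht1 => ?_⟩
  obtain ⟨hs, hb⟩ := h x x t ht ht1
  have e : (fun k => Real.exp (-(Ξ.eig k) ^ 2 * t) * Ξ.φ k x * Ξ.φ k x) =
      fun k => Real.exp (-(Ξ.eig k) ^ 2 * t) * Ξ.φ k x ^ 2 := by ext k; ring
  rw [e] at hs hb
  refine ⟨hs, (le_abs_self _).trans (hb.trans_eq ?_)⟩
  simp

lemma summable_heat_abs (x y : X) {t : ℝ} (ht : 0 < t) :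
    Summable (fun k => Real.exp (-(Ξ.eig k) ^ 2 * t) * (|Ξ.φ k x| * |Ξ.φ k y|)) := by
  obtain ⟨κ, -, h⟩ := Ξ.exists_diag_bound
  have hx := (h x (min t 1) (lt_min ht one_pos) (min_le_right _ _)).1
  have hy := (h y (min t 1) (lt_min ht one_pos) (min_le_right _ _)).1
  refine Summable.of_nonneg_of_le (fun k => by positivity) (fun k => ?_) (hx.add hy)
  have h1 : Real.exp (-(Ξ.eig k) ^ 2 * t) ≤ Real.exp (-(Ξ.eig k) ^ 2 * min t 1) := by
    apply Real.exp_le_exp.2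
    nlinarith [min_le_left t 1, sq_nonneg (Ξ.eig k)]
  rw [← mul_add]
  refine mul_le_mul h1 ?_ (by positivity) (Real.exp_pos _).le
  nlinarith [sq_abs (Ξ.φ k x), sq_abs (Ξ.φ k y), sq_nonneg (|Ξ.φ k x| - |Ξ.φ k y|),
    sq_nonneg (Ξ.φ k x), sq_nonneg (Ξ.φ k y)]

/-- The heat kernel. -/
noncomputable def heat (t : ℝ) (x y : X) : ℝ :=
  ∑' k, Real.exp (-(Ξ.eig k) ^ 2 * t) * (Ξ.φ k x * Ξ.φ k y)

lemma summable_heat (x y : X) {t : ℝ} (ht : 0 < t) :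
    Summable (fun k => Real.exp (-(Ξ.eig k) ^ 2 * t) * (Ξ.φ k x * Ξ.φ k y)) := by
  refine Summable.of_norm ?_
  simpa [abs_mul] using Ξ.summable_heat_abs x y ht

/-- The Gaussian bound at all integer multiples of a time at most one. -/
lemma exists_heat_bound : ∃ κ₁ κ₂ : ℝ, 0 < κ₁ ∧ 0 < κ₂ ∧ ∀ (x y : X) (t : ℝ), 0 < t → t ≤ 1 →
    ∀ m : ℕ, 1 ≤ m → |Ξ.heat (m * t) x y|
      ≤ κ₁ * t ^ (-Ξ.q / 2) * Real.exp (-κ₂ * (dist x y ^ 2 / (m * t))) := by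
  obtain ⟨κ₁, κ₂, h1, h2, h⟩ := Ξ.gaussian_bound
  obtain ⟨κ, hκ, hd⟩ := Ξ.exists_diag_bound
  set R := Metric.diam (Set.univ : Set X) with hR
  -- The hypothesis stops at time one. Later the kernel is at most its diagonal bound at time one,
  -- and the Gaussian factor is at least `exp(-κ₂R²)`, so a larger constant covers all later times.
  refine ⟨max κ₁ (κ * Real.exp (κ₂ * R ^ 2)), κ₂, lt_max_of_lt_left h1, h2,
    fun x y t ht ht1 m hm => ?_⟩
  have hm1 : (1 : ℝ) ≤ m := by exact_mod_cast hm
  have htm : t ≤ m * t := le_mul_of_one_le_left ht.le hm1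
  have hq := Ξ.q_pos
  rcases le_total ((m : ℝ) * t) 1 with hs | hs
  · have hb := (h x y (m * t) (ht.trans_le htm) hs).2
    simp_rw [mul_assoc (Real.exp _)] at hb
    refine hb.trans ?_
    refine mul_le_mul_of_nonneg_right ?_ (Real.exp_pos _).le
    exact mul_le_mul (le_max_left _ _)
      (Real.rpow_le_rpow_of_nonpos ht htm (by linarith)) (by positivity)
      (h1.le.trans (le_max_left _ _))
  · have hdist : dist x y ≤ R := Metric.dist_le_diam_of_mem isCompact_univ.isBounded trivial trivial
    have hx := hd x 1 one_pos le_rfl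
    have hy := hd y 1 one_pos le_rfl
    have hle : |Ξ.heat (m * t) x y| ≤ κ := by
      have h3 : |Ξ.heat (m * t) x y| ≤
          ∑' k, Real.exp (-(Ξ.eig k) ^ 2 * (m * t)) * (|Ξ.φ k x| * |Ξ.φ k y|) := by
        have hsum := Ξ.summable_heat_abs x y (t := m * t) (by linarith)
        simpa [heat, abs_mul, -neg_mul] using norm_tsum_le_tsum_norm (f := fun k =>
          Real.exp (-(Ξ.eig k) ^ 2 * (m * t)) * (Ξ.φ k x * Ξ.φ k y))
          (by simpa [abs_mul, -neg_mul] using hsum)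
      have h4 : ∑' k, Real.exp (-(Ξ.eig k) ^ 2 * (m * t)) * (|Ξ.φ k x| * |Ξ.φ k y|) ≤
          ∑' k, (2⁻¹ * (Real.exp (-(Ξ.eig k) ^ 2 * 1) * Ξ.φ k x ^ 2) +
            2⁻¹ * (Real.exp (-(Ξ.eig k) ^ 2 * 1) * Ξ.φ k y ^ 2)) := by
        refine (Ξ.summable_heat_abs x y (by linarith)).tsum_le_tsum (fun k => ?_)
          ((hx.1.mul_left _).add (hy.1.mul_left _))
        have h5 : Real.exp (-(Ξ.eig k) ^ 2 * (m * t)) ≤ Real.exp (-(Ξ.eig k) ^ 2 * 1) := by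
          apply Real.exp_le_exp.2
          nlinarith [sq_nonneg (Ξ.eig k)]
        have h6 : |Ξ.φ k x| * |Ξ.φ k y| ≤ 2⁻¹ * Ξ.φ k x ^ 2 + 2⁻¹ * Ξ.φ k y ^ 2 := by
          nlinarith [sq_abs (Ξ.φ k x), sq_abs (Ξ.φ k y), sq_nonneg (|Ξ.φ k x| - |Ξ.φ k y|)]
        calc _ ≤ Real.exp (-(Ξ.eig k) ^ 2 * 1) * (2⁻¹ * Ξ.φ k x ^ 2 + 2⁻¹ * Ξ.φ k y ^ 2) :=
              mul_le_mul h5 h6 (by positivity) (Real.exp_pos _).le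
          _ = _ := by ring
      refine h3.trans (h4.trans ?_)
      rw [(hx.1.mul_left _).tsum_add (hy.1.mul_left _), tsum_mul_left, tsum_mul_left]
      have := hx.2
      have := hy.2
      simp only [Real.one_rpow, mul_one] at *
      linarith
    have h5 : Real.exp (-(κ₂ * R ^ 2)) ≤ Real.exp (-κ₂ * (dist x y ^ 2 / (m * t))) := by
      apply Real.exp_le_exp.2
      have : dist x y ^ 2 / (m * t) ≤ R ^ 2 :=
        (div_le_self (sq_nonneg _) hs).trans (pow_le_pow_left₀ dist_nonneg hdist 2)
      nlinarith
    have h6 : 1 ≤ t ^ (-Ξ.q / 2) :=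
      Real.one_le_rpow_of_pos_of_le_one_of_nonpos ht ht1 (by linarith)
    calc |Ξ.heat (m * t) x y| ≤ κ * Real.exp (κ₂ * R ^ 2) * 1 * Real.exp (-(κ₂ * R ^ 2)) := by
          rw [mul_one, mul_assoc, ← Real.exp_add]; simpa using hle
      _ ≤ _ := by
          gcongr
          exact le_max_right _ _

/-- The number of eigenvalues below `2 ^ j`. -/
lemma exists_card_le : ∃ C : ℝ, 0 < C ∧ ∀ (j : ℕ) (F : Finset ℕ), (∀ k ∈ F, Ξ.eig k < 2 ^ j) →
    (F.card : ℝ) ≤ C * (2 : ℝ) ^ ((j : ℝ) * Ξ.q) := by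
  obtain ⟨κ, hκ, hd⟩ := Ξ.exists_diag_bound
  refine ⟨Real.exp 1 * κ, by positivity, fun j F hF => ?_⟩
  -- At `t = 4^(-j)` the weights of frequencies below `2^j` are at least `1/e`, so integrating the
  -- diagonal bound counts them.
  set t : ℝ := ((2 : ℝ) ^ j)⁻¹ ^ 2 with ht
  have ht0 : 0 < t := by positivity
  have ht1 : t ≤ 1 := by
    have : ((2 : ℝ) ^ j)⁻¹ ≤ 1 := inv_le_one_of_one_le₀ (one_le_pow₀ (by norm_num))
    exact pow_le_one₀ (by positivity) this
  have hint : ∀ k, Integrable (fun x => Ξ.φ k x ^ 2) Ξ.μ := fun k =>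
    (Ξ.memLp_phi k 2).integrable_sq
  have h1 : ∀ x, ∑ k ∈ F, Ξ.φ k x ^ 2 ≤ Real.exp 1 * (κ * t ^ (-Ξ.q / 2)) := fun x => by
    obtain ⟨hs, hb⟩ := hd x t ht0 ht1
    calc ∑ k ∈ F, Ξ.φ k x ^ 2
        ≤ ∑ k ∈ F, Real.exp 1 * (Real.exp (-(Ξ.eig k) ^ 2 * t) * Ξ.φ k x ^ 2) := by
          refine Finset.sum_le_sum fun k hk => ?_
          rw [← mul_assoc, ← Real.exp_add]
          refine le_mul_of_one_le_left (sq_nonneg _) (Real.one_le_exp ?_)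
          have h2 : Ξ.eig k * ((2 : ℝ) ^ j)⁻¹ ≤ 1 := by
            rw [← div_eq_mul_inv, div_le_one (by positivity)]
            exact (hF k hk).le
          have h3 : 0 ≤ Ξ.eig k * ((2 : ℝ) ^ j)⁻¹ := mul_nonneg (Ξ.eig_nonneg k) (by positivity)
          rw [ht]
          nlinarith
      _ = Real.exp 1 * ∑ k ∈ F, (Real.exp (-(Ξ.eig k) ^ 2 * t) * Ξ.φ k x ^ 2) := by
          rw [Finset.mul_sum]
      _ ≤ _ := by
          gcongr
          exact (hs.sum_le_tsum F fun k _ => by positivity).trans hb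
  have h2 : ∫ x, ∑ k ∈ F, Ξ.φ k x ^ 2 ∂Ξ.μ = F.card := by
    rw [integral_finsetSum _ fun k _ => hint k]
    simp [pow_two, Ξ.φ_orthonormal]
  have h3 : ∫ x, ∑ k ∈ F, Ξ.φ k x ^ 2 ∂Ξ.μ ≤ Real.exp 1 * (κ * t ^ (-Ξ.q / 2)) := by
    calc _ ≤ ∫ _, Real.exp 1 * (κ * t ^ (-Ξ.q / 2)) ∂Ξ.μ :=
          integral_mono (integrable_finsetSum _ fun k _ => hint k) (integrable_const _) h1
      _ = _ := by simp
  rw [h2] at h3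
  refine h3.trans_eq ?_
  have : t ^ (-Ξ.q / 2) = (2 : ℝ) ^ ((j : ℝ) * Ξ.q) := by
    rw [ht, inv_pow, ← Real.rpow_natCast, ← Real.rpow_natCast, ← Real.rpow_mul (by norm_num),
      Real.inv_rpow (by positivity), ← Real.rpow_mul (by norm_num), ← Real.rpow_neg (by norm_num)]
    congr 1; push_cast; ring
  rw [this]; ring

/-- The integral of a Gaussian. -/
lemma exists_lintegral_gauss_le (c : ℝ) (hc : 0 < c) : ∃ C : ℝ, 0 < C ∧ ∀ (x : X) (s : ℝ), 0 < s →
    ∫⁻ y, ENNReal.ofReal (Real.exp (-c * (dist x y ^ 2 / s))) ∂Ξ.μ ≤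
      ENNReal.ofReal (C * s ^ (Ξ.q / 2)) := by
  obtain ⟨κ, hκ, hb⟩ := Ξ.ball_measure
  have hq := Ξ.q_pos
  have hsum : Summable fun i : ℕ => Real.exp (-c * (i : ℝ)) * ((i : ℝ) + 1) ^ Ξ.q := by
    obtain ⟨N, hN⟩ := exists_nat_ge Ξ.q
    have h0 : Summable fun i : ℕ => ((i : ℝ) + 1) ^ N * Real.exp (-c * ((i : ℝ) + 1)) := by
      have := (Real.summable_pow_mul_exp_neg_nat_mul N hc)
      simpa using (summable_nat_add_iff 1).2 this
    refine Summable.of_nonneg_of_le (fun i => by positivity) (fun i => ?_) (h0.mul_left (Real.exp c))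
    have : ((i : ℝ) + 1) ^ Ξ.q ≤ ((i : ℝ) + 1) ^ N := by
      rw [← Real.rpow_natCast]
      exact Real.rpow_le_rpow_of_exponent_le (by linarith [i.cast_nonneg (α := ℝ)]) hN
    have e : Real.exp c * (((i : ℝ) + 1) ^ N * Real.exp (-c * ((i : ℝ) + 1))) =
        Real.exp (-c * i) * ((i : ℝ) + 1) ^ N := by
      rw [mul_left_comm, ← Real.exp_add]; ring_nf
    rw [e]; gcongr
  set S := ∑' i : ℕ, Real.exp (-c * (i : ℝ)) * ((i : ℝ) + 1) ^ Ξ.q with hS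
  have hSpos : 0 < S := hsum.tsum_pos (fun i => by positivity) 0 (by simp)
  refine ⟨κ * S, by positivity, fun x s hs => ?_⟩
  set r : ℝ := Real.sqrt s with hr
  have hr0 : 0 < r := Real.sqrt_pos.2 hs
  have hr2 : r ^ 2 = s := Real.sq_sqrt hs.le
  -- Shells of width `√s` around `x`: on shell `i` the exponent is at least `i² ≥ i`, and geometric
  -- decay already beats the volume factor `(i+1)^q`.
  have hpt : ∀ y, ENNReal.ofReal (Real.exp (-c * (dist x y ^ 2 / s))) ≤
      ∑' i : ℕ, (Metric.closedBall x (((i : ℝ) + 1) * r)).indicator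
        (fun _ => ENNReal.ofReal (Real.exp (-c * (i : ℝ)))) y := fun y => by
    set i := ⌊dist x y / r⌋₊ with hi
    have h1 : (i : ℝ) ≤ dist x y / r := Nat.floor_le (by positivity)
    have h2 : dist x y / r < i + 1 := Nat.lt_floor_add_one _
    refine le_trans ?_ (ENNReal.le_tsum i)
    rw [Set.indicator_of_mem]
    · refine ENNReal.ofReal_le_ofReal (Real.exp_le_exp.2 ?_)
      have h3 : (i : ℝ) ≤ dist x y ^ 2 / s := by
        rw [← hr2, ← div_pow]
        have : (i : ℝ) ≤ (i : ℝ) ^ 2 := by exact_mod_cast Nat.le_self_pow two_ne_zero i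
        exact this.trans (pow_le_pow_left₀ (by positivity) h1 2)
      nlinarith
    · rw [Metric.mem_closedBall, dist_comm]
      rw [div_lt_iff₀ hr0] at h2
      exact h2.le
  calc _ ≤ ∫⁻ y, ∑' i : ℕ, (Metric.closedBall x (((i : ℝ) + 1) * r)).indicator
        (fun _ => ENNReal.ofReal (Real.exp (-c * (i : ℝ)))) y ∂Ξ.μ := lintegral_mono hpt
    _ = ∑' i : ℕ, ENNReal.ofReal (Real.exp (-c * (i : ℝ))) *
          Ξ.μ (Metric.closedBall x (((i : ℝ) + 1) * r)) := by
        rw [lintegral_tsum fun i =>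
          (measurable_const.indicator Metric.isClosed_closedBall.measurableSet).aemeasurable]
        congr 1; ext i
        rw [lintegral_indicator Metric.isClosed_closedBall.measurableSet, setLIntegral_const]
    _ ≤ ∑' i : ℕ, ENNReal.ofReal (κ * s ^ (Ξ.q / 2) *
          (Real.exp (-c * (i : ℝ)) * ((i : ℝ) + 1) ^ Ξ.q)) := by
        refine ENNReal.tsum_le_tsum fun i => ?_
        refine (mul_le_mul_right (hb x (((i : ℝ) + 1) * r) (by positivity)).2 _).trans_eq ?_
        rw [← ENNReal.ofReal_mul (by positivity)]
        congr 1
        rw [Real.mul_rpow (by positivity) hr0.le]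
        have : r ^ Ξ.q = s ^ (Ξ.q / 2) := by
          rw [hr, Real.sqrt_eq_rpow, ← Real.rpow_mul hs.le]; ring_nf
        rw [this]; ring
    _ = ENNReal.ofReal (κ * S * s ^ (Ξ.q / 2)) := by
        rw [← ENNReal.ofReal_tsum_of_nonneg (fun i => by positivity) (hsum.mul_left _),
          tsum_mul_left]
        congr 1; ring

end Heat

end DataSpace

/-! ### Chebyshev expansions of smooth functions. -/

/-- The coefficients of the shifted Chebyshev polynomials grow at most exponentially. -/
lemma exists_chebyshev_coeff (m : ℕ) : ∃ b : ℕ → ℝ,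
    (∀ u : ℝ, (Polynomial.Chebyshev.T ℝ (m : ℤ)).eval (2 * u - 1) =
      ∑ i ∈ Finset.range (m + 1), b i * u ^ i) ∧
    ∑ i ∈ Finset.range (m + 1), |b i| ≤ 7 ^ m := by
  induction m using Nat.twoStepInduction with
  | zero => exact ⟨fun _ => 1, by simp, by simp⟩
  | one =>
    refine ⟨fun i => if i = 0 then -1 else 2, fun u => ?_, ?_⟩
    · simp [Finset.sum_range_succ]; ring
    · norm_num [Finset.sum_range_succ]
  | more m ih0 ih1 =>
    obtain ⟨b, hb, hbs⟩ := ih0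
    obtain ⟨d, hd, hds⟩ := ih1
    let b' : ℕ → ℝ := fun i => if i < m + 1 then b i else 0
    let d' : ℕ → ℝ := fun i => if i < m + 1 + 1 then d i else 0
    let d'' : ℕ → ℝ := fun i => if i = 0 then 0 else d (i - 1)
    have ext_sum : ∀ (F : ℕ → ℝ) (k l : ℕ), k ≤ l →
        ∑ i ∈ Finset.range l, (if i < k then F i else 0) = ∑ i ∈ Finset.range k, F i := by
      intro F k l hkl
      rw [← Finset.sum_filter]
      congr 1
      ext i; simp; omega
    -- From `T_(m+2)(2u-1) = 4u T_(m+1) - 2 T_(m+1) - T_m`: `d''` is the shift by one power of `u`,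
    -- `d'` and `b'` are extensions by zero. The base 7 works since `6·7 + 1 ≤ 49`.
    refine ⟨fun i => 4 * d'' i - 2 * d' i - b' i, fun u => ?_, ?_⟩
    · have h := Polynomial.Chebyshev.T_add_two ℝ (m : ℤ)
      push_cast at hd ⊢
      rw [h]
      simp only [Polynomial.eval_sub, Polynomial.eval_mul, Polynomial.eval_X,
        Polynomial.eval_ofNat, hb, hd, sub_mul, Finset.sum_sub_distrib]
      have e1 : ∑ i ∈ Finset.range (m + 2 + 1), 4 * d'' i * u ^ i =
          4 * u * ∑ i ∈ Finset.range (m + 1 + 1), d i * u ^ i := by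
        rw [Finset.sum_range_succ', Finset.mul_sum]
        simp only [d'', pow_succ]
        simp
        exact Finset.sum_congr rfl fun i _ => by ring
      have e2 : ∑ i ∈ Finset.range (m + 2 + 1), 2 * d' i * u ^ i =
          2 * ∑ i ∈ Finset.range (m + 1 + 1), d i * u ^ i := by
        rw [← ext_sum _ (m + 1 + 1) (m + 2 + 1) (by omega), Finset.mul_sum]
        refine Finset.sum_congr rfl fun i _ => ?_
        simp only [d']; split_ifs <;> ring
      have e3 : ∑ i ∈ Finset.range (m + 2 + 1), b' i * u ^ i =
          ∑ i ∈ Finset.range (m + 1), b i * u ^ i := by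
        rw [← ext_sum _ (m + 1) (m + 2 + 1) (by omega)]
        refine Finset.sum_congr rfl fun i _ => ?_
        simp only [b']; split_ifs <;> ring
      rw [e1, e2, e3]; ring
    · have e1 : ∑ i ∈ Finset.range (m + 2 + 1), |d'' i| =
          ∑ i ∈ Finset.range (m + 1 + 1), |d i| := by
        rw [Finset.sum_range_succ']; simp [d'']
      have e2 : ∑ i ∈ Finset.range (m + 2 + 1), |d' i| =
          ∑ i ∈ Finset.range (m + 1 + 1), |d i| := by
        rw [← ext_sum _ (m + 1 + 1) (m + 2 + 1) (by omega)]
        refine Finset.sum_congr rfl fun i _ => ?_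
        simp only [d']; split_ifs <;> simp
      have e3 : ∑ i ∈ Finset.range (m + 2 + 1), |b' i| =
          ∑ i ∈ Finset.range (m + 1), |b i| := by
        rw [← ext_sum _ (m + 1) (m + 2 + 1) (by omega)]
        refine Finset.sum_congr rfl fun i _ => ?_
        simp only [b']; split_ifs <;> simp
      calc _ ≤ ∑ i ∈ Finset.range (m + 2 + 1), (4 * |d'' i| + 2 * |d' i| + |b' i|) := by
            refine Finset.sum_le_sum fun i _ => ?_
            have h1 := abs_sub (4 * d'' i - 2 * d' i) (b' i)
            have h2 := abs_sub (4 * d'' i) (2 * d' i)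
            rw [abs_mul, abs_mul] at h2
            norm_num at h2
            linarith
        _ ≤ 4 * 7 ^ (m + 1) + 2 * 7 ^ (m + 1) + 7 ^ m := by
            rw [Finset.sum_add_distrib, Finset.sum_add_distrib, ← Finset.mul_sum,
              ← Finset.mul_sum, e1, e2, e3]
            gcongr
        _ ≤ 7 ^ (m + 2) := by
            have : (0 : ℝ) < 7 ^ m := by positivity
            rw [pow_succ, pow_add]; linarith

/-- Rapid decay of the Fourier coefficients of a smooth periodic function. -/
lemma exists_fourier_integral_bound (s : ℕ) (f : ℝ → ℂ) (hf : ContDiff ℝ (⊤ : ℕ∞) f)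
    (hp : Function.Periodic f (2 * Real.pi)) : ∃ C : ℝ, 0 ≤ C ∧ ∀ n : ℤ,
      ‖∫ θ in (0 : ℝ)..2 * Real.pi, Complex.exp (-(n * θ * Complex.I)) * f θ‖ * |(n : ℝ)| ^ s
        ≤ C := by
  induction s generalizing f with
  | zero =>
    refine ⟨∫ θ in (0 : ℝ)..2 * Real.pi, ‖f θ‖, ?_, fun n => ?_⟩
    · exact intervalIntegral.integral_nonneg (by positivity) fun _ _ => norm_nonneg _
    · rw [pow_zero, mul_one]
      refine (intervalIntegral.norm_integral_le_integral_norm (by positivity)).trans_eq ?_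
      congr 1; ext θ
      rw [norm_mul, Complex.norm_exp]
      simp
  | succ s ih =>
    have hd : ContDiff ℝ (⊤ : ℕ∞) (deriv f) := hf.deriv'
    have hfd : Differentiable ℝ f := hf.differentiable (by simp)
    have hpd : Function.Periodic (deriv f) (2 * Real.pi) := fun x => by
      have : (fun y => f (y + 2 * Real.pi)) = f := funext hp
      rw [← deriv_comp_add_const, this]
    obtain ⟨C, hC, h⟩ := ih (deriv f) hd hpd
    refine ⟨C, hC, fun n => ?_⟩
    have hu : ∀ θ : ℝ, HasDerivAt (fun θ : ℝ => Complex.exp (-(n * θ * Complex.I)))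
        (-(n * Complex.I) * Complex.exp (-(n * θ * Complex.I))) θ := fun θ => by
      have h1 : HasDerivAt (fun θ : ℝ => -((n : ℂ) * (θ : ℂ) * Complex.I))
          (-(n * 1 * Complex.I)) θ :=
        (((Complex.ofRealCLM.hasDerivAt (x := θ)).const_mul (n : ℂ)).mul_const _).neg
      convert h1.cexp using 1
      ring
    -- Integration by parts gains one factor `n`; the boundary terms cancel by periodicity.
    have key := intervalIntegral.integral_mul_deriv_eq_deriv_mul (a := 0) (b := 2 * Real.pi)
      (u := fun θ : ℝ => Complex.exp (-(n * θ * Complex.I))) (v := f)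
      (fun θ _ => hu θ) (fun θ _ => (hfd θ).hasDerivAt)
      (Continuous.intervalIntegrable (by fun_prop) _ _)
      (hd.continuous.intervalIntegrable _ _)
    have hf0 : f (2 * Real.pi) = f 0 := by simpa using hp 0
    have he : Complex.exp (-((n : ℂ) * ((2 * Real.pi : ℝ) : ℂ) * Complex.I)) = 1 := by
      rw [Complex.exp_eq_one_iff]
      exact ⟨-n, by push_cast; ring⟩
    rw [he, hf0] at key
    simp only [Complex.ofReal_zero, mul_zero, zero_mul, neg_zero, Complex.exp_zero, sub_self,
      zero_sub, mul_assoc, intervalIntegral.integral_const_mul] at key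
    have := h n
    simp only [mul_assoc] at this ⊢
    rw [key] at this
    rw [norm_neg, norm_mul, norm_neg, norm_mul, Complex.norm_I, Complex.norm_intCast] at this
    refine le_trans (le_of_eq ?_) this
    rw [pow_succ]; ring

/-- Smoothness makes the Fourier coefficients decay faster than any power. By evenness the series at
`θ` and `-θ` may be averaged, which turns exponentials into cosines; real parts then give real
coefficients. -/
lemma hasSum_cos_of_smooth_even (g : ℝ → ℝ) (hg : ContDiff ℝ (⊤ : ℕ∞) g)
    (hp : Function.Periodic g (2 * Real.pi)) (he : ∀ θ, g (-θ) = g θ) (s : ℕ) :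
    ∃ a : ℤ → ℝ, Summable (fun n => |a n| * ((n.natAbs : ℝ) + 1) ^ s) ∧
      ∀ θ, HasSum (fun n : ℤ => a n * Real.cos (n.natAbs * θ)) (g θ) := by
  have hT : Fact (0 < 2 * Real.pi) := ⟨by positivity⟩
  have hfs : ContDiff ℝ (⊤ : ℕ∞) (fun θ => (g θ : ℂ)) := Complex.ofRealCLM.contDiff.comp hg
  have hfp : Function.Periodic (fun θ => (g θ : ℂ)) (2 * Real.pi) := fun θ => by simp [hp θ]
  let F : C(AddCircle (2 * Real.pi), ℂ) :=
    ⟨hfp.lift, continuous_coinduced_dom.2 hfs.continuous⟩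
  have hF : ∀ θ : ℝ, F (θ : AddCircle (2 * Real.pi)) = g θ := fun θ => hfp.lift_coe θ
  have hcoef : ∀ n : ℤ, fourierCoeff F n = (1 / (2 * Real.pi) : ℝ) •
      ∫ θ in (0 : ℝ)..2 * Real.pi, Complex.exp (-(n * θ * Complex.I)) * (g θ : ℂ) := fun n => by
    rw [fourierCoeff_eq_intervalIntegral F n 0, zero_add]
    congr 2; ext θ
    rw [hF, fourier_coe_apply, smul_eq_mul]
    congr 2
    push_cast
    have : (Real.pi : ℂ) ≠ 0 := by exact_mod_cast Real.pi_ne_zero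
    field_simp
  -- The two extra powers of decay make the weighted coefficients summable.
  obtain ⟨C, hC0, hC⟩ := exists_fourier_integral_bound (s + 2) _ hfs hfp
  have hpi : (1 : ℝ) ≤ 2 * Real.pi := by linarith [Real.pi_gt_three]
  have hbd : ∀ n : ℤ, ‖fourierCoeff F n‖ * |(n : ℝ)| ^ (s + 2) ≤ C := fun n => by
    rw [hcoef, norm_smul]
    refine le_trans ?_ (hC n)
    refine mul_le_mul_of_nonneg_right (mul_le_of_le_one_left (norm_nonneg _) ?_) (by positivity)
    rw [Real.norm_of_nonneg (by positivity)]
    exact (div_le_one (by positivity)).2 hpi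
  have hsum : Summable fun n : ℤ => ‖fourierCoeff F n‖ * ((n.natAbs : ℝ) + 1) ^ s := by
    have h2 : Summable fun n : ℤ => C * 2 ^ s * (1 / (n : ℝ) ^ 2) :=
      (Real.summable_one_div_int_pow.2 one_lt_two).mul_left _
    refine h2.of_norm_bounded_eventually ?_
    have : ∀ᶠ n : ℤ in cofinite, n ≠ 0 := by
      simpa using (Set.finite_singleton (0 : ℤ)).compl_mem_cofinite
    filter_upwards [this] with n hn
    rw [Real.norm_of_nonneg (by positivity)]
    have hn1 : (1 : ℝ) ≤ |(n : ℝ)| := by exact_mod_cast Int.one_le_abs hn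
    have hna : (n.natAbs : ℝ) = |(n : ℝ)| := by rw [Nat.cast_natAbs]; push_cast; rfl
    rw [hna, mul_one_div, le_div_iff₀ (by positivity), ← sq_abs (n : ℝ)]
    calc ‖fourierCoeff F n‖ * (|(n : ℝ)| + 1) ^ s * |(n : ℝ)| ^ 2
        ≤ ‖fourierCoeff F n‖ * (2 * |(n : ℝ)|) ^ s * |(n : ℝ)| ^ 2 := by
          gcongr; linarith
      _ = ‖fourierCoeff F n‖ * |(n : ℝ)| ^ (s + 2) * 2 ^ s := by rw [mul_pow, pow_add]; ring
      _ ≤ C * 2 ^ s := by gcongr; exact hbd n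
  have hsum0 : Summable (fourierCoeff F) := by
    refine Summable.of_norm (hsum.of_nonneg_of_le (fun _ => norm_nonneg _) fun n => ?_)
    exact le_mul_of_one_le_right (norm_nonneg _) (one_le_pow₀ (by
      linarith [(Nat.cast_nonneg (α := ℝ) n.natAbs)]))
  refine ⟨fun n => (fourierCoeff F n).re, ?_, fun θ => ?_⟩
  · refine hsum.of_nonneg_of_le (fun n => by positivity) fun n => ?_
    gcongr
    exact Complex.abs_re_le_norm _
  · have h1 := has_pointwise_sum_fourier_series_of_summable hsum0 (θ : AddCircle (2 * Real.pi))
    have h2 := has_pointwise_sum_fourier_series_of_summable hsum0 ((-θ : ℝ) : AddCircle (2 * Real.pi))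
    rw [hF] at h1 h2
    rw [he] at h2
    have h3 := Complex.hasSum_re ((h1.add h2).mul_left (1 / 2 : ℂ))
    have e : (1 / 2 * ((g θ : ℂ) + (g θ : ℂ))).re = g θ := by
      rw [show (1 / 2 * ((g θ : ℂ) + (g θ : ℂ))) = (g θ : ℂ) by ring, Complex.ofReal_re]
    rw [e] at h3
    refine h3.congr_fun fun n => ?_
    rw [fourier_coe_apply, fourier_coe_apply, smul_eq_mul, smul_eq_mul, ← mul_add]
    have hpi0 : (Real.pi : ℂ) ≠ 0 := by exact_mod_cast Real.pi_ne_zero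
    have e1 : 2 * (Real.pi : ℂ) * Complex.I * n * (θ : ℂ) / ((2 * Real.pi : ℝ) : ℂ) =
        ((n * θ : ℝ) : ℂ) * Complex.I := by push_cast; field_simp
    have e2 : 2 * (Real.pi : ℂ) * Complex.I * n * ((-θ : ℝ) : ℂ) / ((2 * Real.pi : ℝ) : ℂ) =
        -((n * θ : ℝ) : ℂ) * Complex.I := by push_cast; field_simp
    rw [e1, e2, ← Complex.two_cos, ← Complex.ofReal_cos]
    have e3 : (1 / 2 : ℂ) * (fourierCoeff F n * (2 * (Real.cos (n * θ) : ℂ))) =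
        fourierCoeff F n * (Real.cos (n * θ) : ℂ) := by ring
    rw [e3, Complex.re_mul_ofReal]
    congr 1
    rw [Nat.cast_natAbs, ← Real.cos_abs ((n : ℝ) * θ), ← Real.cos_abs (_ * θ), abs_mul, abs_mul]
    push_cast
    rw [abs_abs]

/-- A smooth cut-off of `u ↦ 1 / u` and its rapidly converging Chebyshev expansion. -/
lemma exists_chebyshev_expansion (s : ℕ) : ∃ (H : ℝ → ℝ) (a : ℤ → ℝ),
    (∀ u, Real.exp (-(1 / 4)) ≤ u → u * H u = 1) ∧ (∀ u, u ≤ Real.exp (-1) → H u = 0) ∧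
    Summable (fun n => |a n| * ((n.natAbs : ℝ) + 1) ^ s) ∧
    ∀ u, 0 ≤ u → u ≤ 1 → HasSum (fun n : ℤ =>
      a n * (Polynomial.Chebyshev.T ℝ (n.natAbs : ℤ)).eval (2 * u - 1)) (H u) := by
  -- With `u = exp(-(λ/2^j)²)`, the threshold `exp(-1)` is the frequency `2^j` and `exp(-1/4)` the
  -- frequency `2^(j-1)`. Vanishing below `p` removes the singularity of `1/u`.
  set p : ℝ := Real.exp (-1) with hp
  set r : ℝ := Real.exp (-(1 / 4)) with hr
  have hp0 : 0 < p := Real.exp_pos _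
  have hpr : p < r := Real.exp_lt_exp.2 (by norm_num)
  let H : ℝ → ℝ := fun u => Real.smoothTransition ((u - p) / (r - p)) * u⁻¹
  have hH0 : ∀ u, u ≤ p → H u = 0 := fun u hu => by
    simp only [H]
    rw [Real.smoothTransition.zero_of_nonpos (div_nonpos_of_nonpos_of_nonneg (by linarith)
      (by linarith)), zero_mul]
  have hH1 : ∀ u, r ≤ u → u * H u = 1 := fun u hu => by
    simp only [H]
    rw [Real.smoothTransition.one_of_one_le ((one_le_div (by linarith)).2 (by linarith)), one_mul,
      mul_inv_cancel₀ (by linarith)]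
  have hHs : ContDiff ℝ (⊤ : ℕ∞) H := by
    rw [contDiff_iff_contDiffAt]
    intro u
    rcases eq_or_ne u 0 with rfl | hu
    · refine (contDiffAt_const (c := (0 : ℝ))).congr_of_eventuallyEq ?_
      filter_upwards [eventually_le_nhds hp0] with v hv using hH0 v hv
    · refine ContDiffAt.mul ?_ (contDiffAt_inv ℝ hu)
      exact (Real.smoothTransition.contDiff.comp (by fun_prop)).contDiffAt
  -- The substitution `u = (1 + cos θ)/2` turns `T_n(2u-1)` into `cos nθ`.
  obtain ⟨a, ha, hsum⟩ := hasSum_cos_of_smooth_even (fun θ => H ((1 + Real.cos θ) / 2))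
    (hHs.comp (by fun_prop)) (fun θ => by simp) (fun θ => by simp) s
  refine ⟨H, a, hH1, hH0, ha, fun u hu0 hu1 => ?_⟩
  have h := hsum (Real.arccos (2 * u - 1))
  simp only [Real.cos_arccos (x := 2 * u - 1) (by linarith) (by linarith)] at h
  rw [show (1 + (2 * u - 1)) / 2 = u by ring] at h
  refine h.congr_fun fun n => ?_
  have := Polynomial.Chebyshev.T_real_cos (Real.arccos (2 * u - 1)) (n.natAbs : ℤ)
  rw [Real.cos_arccos (x := 2 * u - 1) (by linarith) (by linarith)] at this
  rw [this, Int.cast_natCast]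

namespace DataSpace

/-! ### Construction of the low-pass filter with uniformly L¹-bounded kernels. -/

section Filter

variable {X : Type*} [MetricSpace X] [CompactSpace X] [MeasurableSpace X] [BorelSpace X]
  (Ξ : DataSpace X)

/-- The kernel of `A T_m(2 A - 1)`, where `A` is the heat operator at time `t`. -/
noncomputable def chebKernel (m : ℕ) (t : ℝ) (x y : X) : ℝ :=
  ∑' k, Real.exp (-(Ξ.eig k) ^ 2 * t) *
    (Polynomial.Chebyshev.T ℝ (m : ℤ)).eval (2 * Real.exp (-(Ξ.eig k) ^ 2 * t) - 1) *
      (Ξ.φ k x * Ξ.φ k y)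

lemma exp_eig_le_one (k : ℕ) {t : ℝ} (ht : 0 < t) : Real.exp (-(Ξ.eig k) ^ 2 * t) ≤ 1 := by
  rw [Real.exp_le_one_iff]
  nlinarith [sq_nonneg (Ξ.eig k)]

lemma abs_chebyshev_le (m : ℕ) (k : ℕ) {t : ℝ} (ht : 0 < t) :
    |(Polynomial.Chebyshev.T ℝ (m : ℤ)).eval (2 * Real.exp (-(Ξ.eig k) ^ 2 * t) - 1)| ≤ 1 := by
  refine Polynomial.Chebyshev.abs_eval_T_real_le_one _ (abs_le.2 ⟨?_, ?_⟩)
  · linarith [Real.exp_pos (-(Ξ.eig k) ^ 2 * t)]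
  · linarith [Ξ.exp_eig_le_one k ht]

lemma summable_chebKernel (m : ℕ) {t : ℝ} (ht : 0 < t) (x y : X) :
    Summable fun k => Real.exp (-(Ξ.eig k) ^ 2 * t) *
      (Polynomial.Chebyshev.T ℝ (m : ℤ)).eval (2 * Real.exp (-(Ξ.eig k) ^ 2 * t) - 1) *
        (Ξ.φ k x * Ξ.φ k y) := by
  refine (Ξ.summable_heat_abs x y ht).of_norm_bounded fun k => ?_
  rw [norm_mul, norm_mul, norm_mul, Real.norm_of_nonneg (Real.exp_pos _).le]
  refine mul_le_mul_of_nonneg_right (mul_le_of_le_one_right (Real.exp_pos _).le ?_) (by positivity)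
  exact Ξ.abs_chebyshev_le m k ht

lemma measurable_chebKernel (m : ℕ) {t : ℝ} (ht : 0 < t) (x : X) :
    Measurable fun y => Ξ.chebKernel m t x y := by
  refine measurable_of_tendsto_metrizable (f := fun n y => ∑ k ∈ Finset.range n,
    Real.exp (-(Ξ.eig k) ^ 2 * t) *
    (Polynomial.Chebyshev.T ℝ (m : ℤ)).eval (2 * Real.exp (-(Ξ.eig k) ^ 2 * t) - 1) *
    (Ξ.φ k x * Ξ.φ k y)) (fun n => ?_) ?_
  · exact (Continuous.measurable (by
      have := Ξ.φ_continuous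
      fun_prop))
  · exact tendsto_pi_nhds.2 fun y => (Ξ.summable_chebKernel m ht x y).hasSum.tendsto_sum_nat

/-- On the spectrum `|T_n| ≤ 1`, so the double series over frequencies and degrees is dominated by a
product of two convergent series and may be summed in either order. -/
lemma hasSum_chebKernel {H : ℝ → ℝ} {a : ℤ → ℝ} (ha : Summable fun n => |a n|)
    (hH : ∀ u, 0 ≤ u → u ≤ 1 → HasSum (fun n : ℤ =>
      a n * (Polynomial.Chebyshev.T ℝ (n.natAbs : ℤ)).eval (2 * u - 1)) (H u))
    {t : ℝ} (ht : 0 < t) (x y : X) :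
    HasSum (fun n : ℤ => a n * Ξ.chebKernel n.natAbs t x y)
      (∑' k, Real.exp (-(Ξ.eig k) ^ 2 * t) * H (Real.exp (-(Ξ.eig k) ^ 2 * t)) *
        (Ξ.φ k x * Ξ.φ k y)) := by
  have hprod : Summable (Function.uncurry fun (k : ℕ) (n : ℤ) =>
      a n * (Real.exp (-(Ξ.eig k) ^ 2 * t) *
      (Polynomial.Chebyshev.T ℝ (n.natAbs : ℤ)).eval
        (2 * Real.exp (-(Ξ.eig k) ^ 2 * t) - 1) * (Ξ.φ k x * Ξ.φ k y))) := by
    have h3 := (Ξ.summable_heat_abs x y ht).mul_of_nonneg ha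
      (fun k => by positivity) (fun n => abs_nonneg _)
    refine h3.of_norm_bounded fun ⟨k, n⟩ => ?_
    simp only [Function.uncurry]
    rw [norm_mul, norm_mul, norm_mul, norm_mul, Real.norm_of_nonneg (Real.exp_pos _).le,
      mul_comm]
    refine mul_le_mul_of_nonneg_right ?_ (abs_nonneg _)
    refine mul_le_mul_of_nonneg_right (mul_le_of_le_one_right (Real.exp_pos _).le ?_)
      (by positivity)
    exact Ξ.abs_chebyshev_le n.natAbs k ht
  have hs : Summable fun n : ℤ => a n * Ξ.chebKernel n.natAbs t x y :=
    hprod.prod_symm.prod.congr fun n => by simp [chebKernel, tsum_mul_left]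
  convert hs.hasSum using 1
  simp only [chebKernel, ← tsum_mul_left]
  rw [hprod.tsum_comm]
  congr 1; ext k
  have h3 := hH _ (Real.exp_pos _).le (Ξ.exp_eig_le_one k ht)
  rw [← ((h3.mul_left (Real.exp (-(Ξ.eig k) ^ 2 * t))).mul_right (Ξ.φ k x * Ξ.φ k y)).tsum_eq]
  congr 1; ext n
  ring

/-- Writing `u T_m(2u-1) = ∑ b_i u^(i+1)`, each power `u^(i+1)` is the heat operator at time
`(i+1)t`, whose Gaussian is no wider than that of time `(m+1)t`. The coefficients cost `7^m`. -/
lemma exists_chebKernel_bound : ∃ κ₁ κ₂ : ℝ, 0 < κ₁ ∧ 0 < κ₂ ∧ ∀ (m : ℕ) (t : ℝ), 0 < t → t ≤ 1 →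
    ∀ x y, |Ξ.chebKernel m t x y| ≤ 7 ^ m *
      (κ₁ * t ^ (-Ξ.q / 2) * Real.exp (-κ₂ * (dist x y ^ 2 / ((m + 1 : ℕ) * t)))) := by
  obtain ⟨κ₁, κ₂, h1, h2, h⟩ := Ξ.exists_heat_bound
  refine ⟨κ₁, κ₂, h1, h2, fun m t ht ht1 x y => ?_⟩
  obtain ⟨b, hb, hbs⟩ := exists_chebyshev_coeff m
  have e : Ξ.chebKernel m t x y =
      ∑ i ∈ Finset.range (m + 1), b i * Ξ.heat ((i + 1 : ℕ) * t) x y := by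
    have hs : ∀ i ∈ Finset.range (m + 1), Summable fun k =>
        b i * (Real.exp (-(Ξ.eig k) ^ 2 * ((i + 1 : ℕ) * t)) * (Ξ.φ k x * Ξ.φ k y)) :=
      fun i _ => (Ξ.summable_heat x y (by positivity)).mul_left _
    simp only [heat, ← tsum_mul_left]
    rw [← Summable.tsum_finsetSum hs, chebKernel]
    congr 1; ext k
    rw [hb, Finset.mul_sum, Finset.sum_mul]
    refine Finset.sum_congr rfl fun i _ => ?_
    have : Real.exp (-(Ξ.eig k) ^ 2 * ((i + 1 : ℕ) * t)) =
        Real.exp (-(Ξ.eig k) ^ 2 * t) ^ (i + 1) := by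
      rw [← Real.exp_nat_mul]; ring_nf
    rw [this]; ring
  rw [e]
  calc _ ≤ ∑ i ∈ Finset.range (m + 1), |b i| * (κ₁ * t ^ (-Ξ.q / 2) *
        Real.exp (-κ₂ * (dist x y ^ 2 / ((m + 1 : ℕ) * t)))) := by
        refine (Finset.abs_sum_le_sum_abs _ _).trans (Finset.sum_le_sum fun i hi => ?_)
        rw [abs_mul]
        refine mul_le_mul_of_nonneg_left ((h x y t ht ht1 (i + 1) (by omega)).trans ?_)
          (abs_nonneg _)
        refine mul_le_mul_of_nonneg_left (Real.exp_le_exp.2 ?_) (by positivity)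
        have hi' : ((i + 1 : ℕ) : ℝ) ≤ (m + 1 : ℕ) := by
          exact_mod_cast Nat.succ_le_of_lt (Finset.mem_range.1 hi)
        have : dist x y ^ 2 / ((m + 1 : ℕ) * t) ≤ dist x y ^ 2 / ((i + 1 : ℕ) * t) := by
          gcongr
        nlinarith
    _ ≤ _ := by
        rw [← Finset.sum_mul]
        exact mul_le_mul_of_nonneg_right hbs (by positivity)

lemma lintegral_sq_sum_phi (c : ℕ → ℝ) (F : Finset ℕ) :
    ∫⁻ y, ENNReal.ofReal ((∑ k ∈ F, c k * Ξ.φ k y) ^ 2) ∂Ξ.μ =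
      ENNReal.ofReal (∑ k ∈ F, c k ^ 2) := by
  have hint : Integrable (fun y => (∑ k ∈ F, c k * Ξ.φ k y) ^ 2) Ξ.μ :=
    (memLp_finsetSum F fun k _ => (Ξ.memLp_phi k 2).const_mul (c k)).integrable_sq
  rw [← ofReal_integral_eq_lintegral_ofReal hint (ae_of_all _ fun _ => sq_nonneg _)]
  congr 1
  have hprod : ∀ i j, Integrable (fun y => c i * Ξ.φ i y * (c j * Ξ.φ j y)) Ξ.μ := fun i j =>
    ((Ξ.memLp_phi i 2).const_mul (c i)).integrable_mul ((Ξ.memLp_phi j 2).const_mul (c j))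
  simp only [pow_two, Finset.sum_mul_sum]
  rw [integral_finsetSum _ fun i _ => integrable_finsetSum _ fun j _ => hprod i j]
  refine Finset.sum_congr rfl fun i hi => ?_
  rw [integral_finsetSum _ fun j _ => hprod i j]
  have : ∀ j, ∫ y, c i * Ξ.φ i y * (c j * Ξ.φ j y) ∂Ξ.μ = if i = j then c i * c j else 0 := by
    intro j
    have := Ξ.φ_orthonormal i j
    rw [← mul_ite_zero] at *
    simp_rw [show ∀ y, c i * Ξ.φ i y * (c j * Ξ.φ j y) = c i * c j * (Ξ.φ i y * Ξ.φ j y) from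
      fun y => by ring]
    rw [integral_const_mul, this]; simp
  simp [this, hi]

/-- Bessel's inequality for a pointwise convergent series. -/
lemma lintegral_sq_tsum_le (c : ℕ → ℝ) (hc : Summable fun k => c k ^ 2)
    (hp : ∀ y, Summable fun k => c k * Ξ.φ k y) :
    ∫⁻ y, ENNReal.ofReal ((∑' k, c k * Ξ.φ k y) ^ 2) ∂Ξ.μ ≤ ENNReal.ofReal (∑' k, c k ^ 2) := by
  have hlim : ∀ y, ENNReal.ofReal ((∑' k, c k * Ξ.φ k y) ^ 2) =
      liminf (fun n => ENNReal.ofReal ((∑ k ∈ Finset.range n, c k * Ξ.φ k y) ^ 2)) atTop :=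
    fun y => ((ENNReal.continuous_ofReal.tendsto _).comp
      (((hp y).hasSum.tendsto_sum_nat).pow 2)).liminf_eq.symm
  simp_rw [hlim]
  refine (lintegral_liminf_le fun n => ?_).trans ?_
  · refine ENNReal.measurable_ofReal.comp ?_
    exact (Continuous.measurable (by
      have := Ξ.φ_continuous
      fun_prop))
  · refine liminf_le_of_le (by isBoundedDefault) fun b hb => ?_
    obtain ⟨n, hn⟩ := hb.exists
    refine hn.trans ?_
    rw [lintegral_sq_sum_phi]
    exact ENNReal.ofReal_le_ofReal (hc.sum_le_tsum _ fun k _ => sq_nonneg _)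

/-- Polynomial growth in `m` in spite of the factor `7^m`: within distance of order `(m+1)√t` the L²
bound from `|T_m| ≤ 1` and the volume of the ball suffice, and farther away the Gaussian absorbs
`7^m`. -/
lemma exists_lintegral_chebKernel_le (N : ℕ) (hN : Ξ.q ≤ N) : ∃ C : ℝ, 0 < C ∧
    ∀ (m : ℕ) (t : ℝ), 0 < t → t ≤ 1 → ∀ x,
      ∫⁻ y, ENNReal.ofReal |Ξ.chebKernel m t x y| ∂Ξ.μ ≤
        ENNReal.ofReal (C * ((m : ℝ) + 1) ^ N) := by
  obtain ⟨κ₁, κ₂, h1, h2, hker⟩ := Ξ.exists_chebKernel_bound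
  obtain ⟨κ, hκ, hdiag⟩ := Ξ.exists_diag_bound
  obtain ⟨κb, hκb, hball⟩ := Ξ.ball_measure
  obtain ⟨Cg, hCg, hgauss⟩ := Ξ.exists_lintegral_gauss_le (κ₂ / 2) (by positivity)
  have hq := Ξ.q_pos
  -- Chosen so that beyond the radius `K(m+1)√t` half of the Gaussian exponent is at least `m log
  -- 7`; the other half remains integrable.
  set K : ℝ := Real.sqrt (2 * Real.log 7 / κ₂) with hK
  have hl7 : 0 < Real.log 7 := Real.log_pos (by norm_num)
  have hK0 : 0 < K := Real.sqrt_pos.2 (by positivity)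
  have hK2 : κ₂ * K ^ 2 / 2 = Real.log 7 := by
    rw [hK, Real.sq_sqrt (by positivity)]; field_simp
  refine ⟨κ + κb * K ^ Ξ.q + κ₁ * Cg, by positivity, fun m t ht ht1 x => ?_⟩
  set d : ℝ := (m : ℝ) + 1 with hd
  have hd1 : 1 ≤ d := by rw [hd]; linarith [(Nat.cast_nonneg (α := ℝ) m)]
  have hd0 : 0 < d := by linarith
  set δ : ℝ := t ^ (Ξ.q / 2) with hδ
  have hδ0 : 0 < δ := by positivity
  have hδi : t ^ (-Ξ.q / 2) = δ⁻¹ := by rw [hδ, ← Real.rpow_neg ht.le]; ring_nf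
  set R : ℝ := K * d * Real.sqrt t with hR
  have hst : 0 < Real.sqrt t := Real.sqrt_pos.2 ht
  have hR0 : 0 < R := by positivity
  have hdN : d ^ Ξ.q ≤ d ^ N := by
    rw [← Real.rpow_natCast]; exact Real.rpow_le_rpow_of_exponent_le hd1 hN
  have hd2 : d ^ (Ξ.q / 2) ≤ d ^ N := by
    rw [← Real.rpow_natCast]; exact Real.rpow_le_rpow_of_exponent_le hd1 (by linarith)
  have hdN1 : 1 ≤ d ^ N := one_le_pow₀ hd1
  -- Inside the ball `|c| ≤ δc² + 1/δ` plays the role of Cauchy-Schwarz, with `δ = t^(q/2)` matched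
  -- to the squared L² norm of the kernel, which is at most of order `1/δ`.
  have hpt : ∀ y, ENNReal.ofReal |Ξ.chebKernel m t x y| ≤
      ENNReal.ofReal δ * ENNReal.ofReal (Ξ.chebKernel m t x y ^ 2) +
      (Metric.closedBall x R).indicator (fun _ => ENNReal.ofReal δ⁻¹) y +
      ENNReal.ofReal (κ₁ * δ⁻¹) *
        ENNReal.ofReal (Real.exp (-(κ₂ / 2) * (dist x y ^ 2 / (d * t)))) := fun y => by
    by_cases hy : y ∈ Metric.closedBall x R
    · rw [Set.indicator_of_mem hy, ← ENNReal.ofReal_mul hδ0.le,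
        ← ENNReal.ofReal_add (by positivity) (by positivity)]
      refine le_trans (ENNReal.ofReal_le_ofReal ?_) le_self_add
      set c := Ξ.chebKernel m t x y
      have h3 : |c| * 2 ≤ δ * c ^ 2 + δ⁻¹ := by
        have h4 : 0 ≤ δ⁻¹ * (δ * |c| - 1) ^ 2 := by positivity
        have h5 : δ⁻¹ * (δ * |c| - 1) ^ 2 = δ * |c| ^ 2 + δ⁻¹ - |c| * 2 := by
          field_simp; ring
        rw [h5, sq_abs] at h4; linarith
      linarith [abs_nonneg c]
    · refine le_trans ?_ le_add_self
      rw [← ENNReal.ofReal_mul (by positivity)]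
      refine ENNReal.ofReal_le_ofReal ((hker m t ht ht1 x y).trans ?_)
      have hdist : R < dist x y := by
        rw [Metric.mem_closedBall, not_le, dist_comm] at hy; exact hy
      have hdt : 0 < d * t := by positivity
      have h3 : K ^ 2 * d ≤ dist x y ^ 2 / (d * t) := by
        rw [le_div_iff₀ hdt]
        calc K ^ 2 * d * (d * t) = R ^ 2 := by rw [hR, mul_pow, mul_pow, Real.sq_sqrt ht.le]; ring
          _ ≤ _ := pow_le_pow_left₀ hR0.le hdist.le 2
      have h4 : (7 : ℝ) ^ m ≤ Real.exp (κ₂ / 2 * (dist x y ^ 2 / (d * t))) := by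
        rw [← Real.exp_log (show (0 : ℝ) < 7 by norm_num), ← Real.exp_nat_mul]
        refine Real.exp_le_exp.2 ?_
        rw [← hK2]
        have : κ₂ / 2 * (K ^ 2 * d) ≤ κ₂ / 2 * (dist x y ^ 2 / (d * t)) := by gcongr
        refine le_trans ?_ this
        rw [hd]
        have : 0 < κ₂ * K ^ 2 := by positivity
        nlinarith
      push_cast
      rw [hδi, ← hd]
      calc _ ≤ Real.exp (κ₂ / 2 * (dist x y ^ 2 / (d * t))) *
            (κ₁ * δ⁻¹ * Real.exp (-κ₂ * (dist x y ^ 2 / (d * t)))) := by gcongr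
        _ = κ₁ * δ⁻¹ * (Real.exp (κ₂ / 2 * (dist x y ^ 2 / (d * t))) *
            Real.exp (-κ₂ * (dist x y ^ 2 / (d * t)))) := by ring
        _ = _ := by rw [← Real.exp_add]; ring_nf
  have hsq : ∫⁻ y, ENNReal.ofReal (Ξ.chebKernel m t x y ^ 2) ∂Ξ.μ ≤ ENNReal.ofReal (κ * δ⁻¹) := by
    obtain ⟨hs, hb⟩ := hdiag x t ht ht1
    set c : ℕ → ℝ := fun k => Real.exp (-(Ξ.eig k) ^ 2 * t) *
      (Polynomial.Chebyshev.T ℝ (m : ℤ)).eval (2 * Real.exp (-(Ξ.eig k) ^ 2 * t) - 1) * Ξ.φ k x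
      with hc
    have hck : ∀ k, c k ^ 2 ≤ Real.exp (-(Ξ.eig k) ^ 2 * t) * Ξ.φ k x ^ 2 := fun k => by
      simp only [hc, mul_pow]
      refine mul_le_mul_of_nonneg_right ?_ (sq_nonneg _)
      have h3 := Ξ.exp_eig_le_one k ht
      have h4 := Real.exp_pos (-(Ξ.eig k) ^ 2 * t)
      have h5 := (sq_le_one_iff_abs_le_one _).2 (Ξ.abs_chebyshev_le m k ht)
      calc _ ≤ Real.exp (-(Ξ.eig k) ^ 2 * t) ^ 2 * 1 := by gcongr
        _ ≤ _ := by nlinarith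
    have hcs : Summable fun k => c k ^ 2 := hs.of_nonneg_of_le (fun _ => sq_nonneg _) hck
    have e : ∀ y, Ξ.chebKernel m t x y = ∑' k, c k * Ξ.φ k y := fun y => by
      simp only [chebKernel, hc, mul_assoc]
    simp_rw [e]
    refine (Ξ.lintegral_sq_tsum_le c hcs fun y => ?_).trans (ENNReal.ofReal_le_ofReal ?_)
    · simpa only [hc, mul_assoc] using Ξ.summable_chebKernel m ht x y
    · exact (hcs.tsum_le_tsum hck hs).trans (hδi ▸ hb)
  have hmeas : Measurable fun y => ENNReal.ofReal (Ξ.chebKernel m t x y ^ 2) :=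
    ENNReal.measurable_ofReal.comp ((Ξ.measurable_chebKernel m ht x).pow_const 2)
  calc _ ≤ _ := lintegral_mono hpt
    _ ≤ ENNReal.ofReal δ * ENNReal.ofReal (κ * δ⁻¹) +
          ENNReal.ofReal δ⁻¹ * ENNReal.ofReal (κb * R ^ Ξ.q) +
          ENNReal.ofReal (κ₁ * δ⁻¹) * ENNReal.ofReal (Cg * (d * t) ^ (Ξ.q / 2)) := by
        have hg : Measurable fun y => ENNReal.ofReal (κ₁ * δ⁻¹) *
            ENNReal.ofReal (Real.exp (-(κ₂ / 2) * (dist x y ^ 2 / (d * t)))) :=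
          (ENNReal.measurable_ofReal.comp
            (Continuous.measurable (by fun_prop))).const_mul _
        rw [lintegral_add_right _ hg, lintegral_add_right _
            (measurable_const.indicator Metric.isClosed_closedBall.measurableSet),
          lintegral_const_mul _ hmeas,
          lintegral_indicator Metric.isClosed_closedBall.measurableSet, setLIntegral_const,
          lintegral_const_mul' _ _ ENNReal.ofReal_ne_top]
        gcongr
        · exact (hball x R hR0).2
        · exact hgauss x (d * t) (by positivity)
    _ = ENNReal.ofReal (κ + κb * K ^ Ξ.q * d ^ Ξ.q + κ₁ * Cg * d ^ (Ξ.q / 2)) := by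
        have e2 : R ^ Ξ.q = K ^ Ξ.q * d ^ Ξ.q * δ := by
          rw [hR, Real.mul_rpow (by positivity) hst.le, Real.mul_rpow hK0.le hd0.le, hδ,
            Real.sqrt_eq_rpow, ← Real.rpow_mul ht.le]
          ring_nf
        rw [e2, Real.mul_rpow hd0.le ht.le, ← hδ, ← ENNReal.ofReal_mul (by positivity),
          ← ENNReal.ofReal_mul (by positivity), ← ENNReal.ofReal_mul (by positivity),
          ← ENNReal.ofReal_add (by positivity) (by positivity),
          ← ENNReal.ofReal_add (by positivity) (by positivity)]
        congr 1
        field_simp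
    _ ≤ _ := by
        refine ENNReal.ofReal_le_ofReal ?_
        rw [add_mul, add_mul]
        gcongr
        exact le_mul_of_one_le_right hκ.le hdN1

/-- The indices of the frequencies below `2 ^ j`. -/
noncomputable def freq (j : ℕ) : Finset ℕ := (Ξ.finite_eig_lt (2 ^ j)).toFinset

lemma mem_freq {j k : ℕ} : k ∈ Ξ.freq j ↔ Ξ.eig k < 2 ^ j := by simp [freq]

/-- A low-pass filter whose kernels are uniformly bounded in `L¹`. -/
lemma exists_filter : ∃ (ψ : ℕ → ℕ → ℝ) (C : ℝ), 0 < C ∧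
    (∀ j k, 2 ^ j ≤ Ξ.eig k → ψ j k = 0) ∧ (∀ j k, 2 * Ξ.eig k ≤ 2 ^ j → ψ j k = 1) ∧
    ∀ j x, ∫⁻ y, ENNReal.ofReal |∑ k ∈ Ξ.freq j, ψ j k * (Ξ.φ k x * Ξ.φ k y)| ∂Ξ.μ ≤
      ENNReal.ofReal C := by
  obtain ⟨N, hN⟩ := exists_nat_ge Ξ.q
  obtain ⟨H, a, hH1, hH0, ha, hHs⟩ := exists_chebyshev_expansion N
  obtain ⟨C, hC, hL⟩ := Ξ.exists_lintegral_chebKernel_le N hN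
  set t : ℕ → ℝ := fun j => ((2 : ℝ) ^ j)⁻¹ ^ 2 with ht
  have ht0 : ∀ j, 0 < t j := fun j => by positivity
  have ht1 : ∀ j, t j ≤ 1 := fun j => pow_le_one₀ (by positivity)
    (inv_le_one_of_one_le₀ (one_le_pow₀ (by norm_num)))
  have hexp : ∀ j k, -(Ξ.eig k) ^ 2 * t j = -(Ξ.eig k / 2 ^ j) ^ 2 := fun j k => by
    simp only [ht]; rw [div_eq_mul_inv, mul_pow]; ring
  set u : ℕ → ℕ → ℝ := fun j k => Real.exp (-(Ξ.eig k) ^ 2 * t j) with hu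
  have hzero : ∀ j k, 2 ^ j ≤ Ξ.eig k → u j k * H (u j k) = 0 := fun j k h => by
    rw [hH0, mul_zero]
    simp only [hu, hexp]
    refine Real.exp_le_exp.2 (neg_le_neg ?_)
    exact one_le_pow₀ ((one_le_div (by positivity)).2 h)
  set S := ∑' n, |a n| * ((n.natAbs : ℝ) + 1) ^ N with hS
  have hS0 : 0 ≤ S := tsum_nonneg fun n => by positivity
  -- The factor `u` outside `H` gives every Chebyshev term a heat factor, without which its kernel
  -- series need not converge. The added 1 only secures positivity.
  refine ⟨fun j k => u j k * H (u j k), C * S + 1, by positivity, hzero, fun j k h => ?_,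
    fun j x => ?_⟩
  · refine hH1 _ ?_
    simp only [hu, hexp]
    refine Real.exp_le_exp.2 (neg_le_neg ?_)
    have h3 : Ξ.eig k / 2 ^ j ≤ 1 / 2 := by rw [div_le_iff₀ (by positivity)]; linarith
    have h4 : 0 ≤ Ξ.eig k / 2 ^ j := div_nonneg (Ξ.eig_nonneg k) (by positivity)
    nlinarith
  · have ha0 : Summable fun n => |a n| := ha.of_nonneg_of_le (fun _ => abs_nonneg _) fun n =>
      le_mul_of_one_le_right (abs_nonneg _) (one_le_pow₀ (by
        linarith [(Nat.cast_nonneg (α := ℝ) n.natAbs)]))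
    have key : ∀ y, ∑ k ∈ Ξ.freq j, u j k * H (u j k) * (Ξ.φ k x * Ξ.φ k y) =
        ∑' n : ℤ, a n * Ξ.chebKernel n.natAbs (t j) x y := fun y => by
      rw [(Ξ.hasSum_chebKernel ha0 hHs (ht0 j) x y).tsum_eq]
      refine (tsum_eq_sum fun k hk => ?_).symm
      rw [mem_freq, not_lt] at hk
      exact mul_eq_zero_of_left (hzero j k hk) _
    calc _ ≤ ∫⁻ y, ∑' n : ℤ, ENNReal.ofReal |a n| *
          ENNReal.ofReal |Ξ.chebKernel n.natAbs (t j) x y| ∂Ξ.μ := by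
          refine lintegral_mono fun y => ?_
          simp only
          rw [key]
          have := (Ξ.hasSum_chebKernel ha0 hHs (ht0 j) x y).summable.abs
          have h5 := norm_tsum_le_tsum_norm
            (f := fun n : ℤ => a n * Ξ.chebKernel n.natAbs (t j) x y) this
          simp only [Real.norm_eq_abs] at h5
          calc _ ≤ ENNReal.ofReal (∑' n : ℤ, |a n * Ξ.chebKernel n.natAbs (t j) x y|) :=
                ENNReal.ofReal_le_ofReal h5
            _ = _ := by
                rw [ENNReal.ofReal_tsum_of_nonneg (fun _ => abs_nonneg _) this]
                simp_rw [abs_mul, ENNReal.ofReal_mul (abs_nonneg _)]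
      _ = ∑' n : ℤ, ENNReal.ofReal |a n| *
          ∫⁻ y, ENNReal.ofReal |Ξ.chebKernel n.natAbs (t j) x y| ∂Ξ.μ := by
          have hm : ∀ n : ℤ, AEMeasurable (fun y => ENNReal.ofReal |a n| *
              ENNReal.ofReal |Ξ.chebKernel n.natAbs (t j) x y|) Ξ.μ := fun n =>
            ((ENNReal.measurable_ofReal.comp (continuous_abs.measurable.comp
              (Ξ.measurable_chebKernel n.natAbs (ht0 j) x))).const_mul _).aemeasurable
          rw [lintegral_tsum hm]
          congr 1; ext n
          rw [lintegral_const_mul' _ _ ENNReal.ofReal_ne_top]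
      _ ≤ ∑' n : ℤ, ENNReal.ofReal (C * (|a n| * ((n.natAbs : ℝ) + 1) ^ N)) := by
          refine ENNReal.tsum_le_tsum fun n => ?_
          refine (mul_le_mul_right (hL n.natAbs (t j) (ht0 j) (ht1 j) x) _).trans_eq ?_
          rw [← ENNReal.ofReal_mul (abs_nonneg _)]
          congr 1; ring
      _ = ENNReal.ofReal (C * S) := by
          have h0 : ∀ n : ℤ, 0 ≤ C * (|a n| * ((n.natAbs : ℝ) + 1) ^ N) := fun n =>
            mul_nonneg hC.le (mul_nonneg (abs_nonneg _) (pow_nonneg (by positivity) _))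
          rw [← ENNReal.ofReal_tsum_of_nonneg h0 (ha.mul_left C), tsum_mul_left]
      _ ≤ _ := ENNReal.ofReal_le_ofReal (by linarith)

end Filter

end DataSpace

/-- Schur's test. -/
lemma eLpNorm_integral_kernel_le {Ω : Type*} [MeasurableSpace Ω] (μ : Measure Ω)
    [IsProbabilityMeasure μ] (K : Ω → Ω → ℝ) (hK : Measurable (Function.uncurry K)) {C : ℝ≥0∞}
    (h1 : ∀ x, ∫⁻ y, ‖K x y‖ₑ ∂μ ≤ C) (h2 : ∀ y, ∫⁻ x, ‖K x y‖ₑ ∂μ ≤ C)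
    {p : ℝ≥0∞} (hp : 1 ≤ p) {f : Ω → ℝ} (hf : AEStronglyMeasurable f μ) :
    eLpNorm (fun x => ∫ y, K x y * f y ∂μ) p μ ≤ C * eLpNorm f p μ := by
  have hKx : ∀ x, Measurable (K x) := fun x => hK.of_uncurry_left
  have hle : ∀ x, ‖∫ y, K x y * f y ∂μ‖ₑ ≤ ∫⁻ y, ‖K x y‖ₑ * ‖f y‖ₑ ∂μ := fun x => by
    refine (enorm_integral_le_lintegral_enorm _).trans_eq ?_
    simp_rw [enorm_mul]
  rcases eq_or_ne p ∞ with rfl | hpt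
  · rw [eLpNorm_exponent_top, eLpNorm_exponent_top]
    refine eLpNormEssSup_le_of_ae_enorm_bound (ae_of_all _ fun x => (hle x).trans ?_)
    calc _ ≤ ∫⁻ y, ‖K x y‖ₑ * eLpNormEssSup f μ ∂μ := by
          refine lintegral_mono_ae ?_
          filter_upwards [ae_le_eLpNormEssSup (f := f) (μ := μ)] with y hy
          gcongr
      _ = (∫⁻ y, ‖K x y‖ₑ ∂μ) * eLpNormEssSup f μ :=
          lintegral_mul_const _ (hKx x).enorm
      _ ≤ _ := by gcongr; exact h1 x
  · have hp0 : p ≠ 0 := (zero_lt_one.trans_le hp).ne'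
    set r := p.toReal with hr
    have hr1 : 1 ≤ r := by
      have := ENNReal.toReal_mono hpt hp; simpa using this
    have hr0 : 0 < r := by linarith
    have hpow : ∀ x, (∫⁻ y, ‖K x y‖ₑ * ‖f y‖ₑ ∂μ) ^ r ≤
        C ^ (r - 1) * ∫⁻ y, ‖K x y‖ₑ * ‖f y‖ₑ ^ r ∂μ := fun x => by
      -- Hölder for the measure `|K(x,·)| μ`, of mass at most `C`, costs `C^(r-1)`; the missing
      -- factor `C` comes from the other marginal after Tonelli.
      set ρ := μ.withDensity fun y => ‖K x y‖ₑ with hρ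
      have hfρ : AEStronglyMeasurable f ρ := hf.mono_ac (withDensity_absolutelyContinuous _ _)
      have hu : ρ Set.univ ≤ C := by
        rw [hρ, withDensity_apply _ MeasurableSet.univ, Measure.restrict_univ]; exact h1 x
      have h3 := eLpNorm_le_eLpNorm_mul_rpow_measure_univ hp hfρ
      rw [eLpNorm_one_eq_lintegral_enorm, eLpNorm_eq_lintegral_rpow_enorm_toReal hp0 hpt,
        ← hr, hρ, lintegral_withDensity_eq_lintegral_mul₀ (hKx x).enorm.aemeasurable hf.enorm,
        lintegral_withDensity_eq_lintegral_mul₀ (hKx x).enorm.aemeasurable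
          (hf.enorm.pow_const r), ← hρ] at h3
      simp only [Pi.mul_apply] at h3
      calc _ ≤ ((∫⁻ y, ‖K x y‖ₑ * ‖f y‖ₑ ^ r ∂μ) ^ (1 / r) *
            ρ Set.univ ^ (1 / (1 : ℝ≥0∞).toReal - 1 / r)) ^ r := by gcongr
        _ = (∫⁻ y, ‖K x y‖ₑ * ‖f y‖ₑ ^ r ∂μ) * ρ Set.univ ^ (r - 1) := by
            rw [ENNReal.mul_rpow_of_nonneg _ _ hr0.le, ← ENNReal.rpow_mul, ← ENNReal.rpow_mul,
              one_div_mul_cancel hr0.ne', ENNReal.rpow_one]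
            congr 2
            rw [ENNReal.toReal_one]
            field_simp
        _ ≤ _ := by
            rw [mul_comm]
            gcongr
    have hKm : Measurable fun z : Ω × Ω => ‖K z.1 z.2‖ₑ := hK.enorm
    have hswap : ∫⁻ x, ∫⁻ y, ‖K x y‖ₑ * ‖f y‖ₑ ^ r ∂μ ∂μ ≤ C * ∫⁻ y, ‖f y‖ₑ ^ r ∂μ := by
      rw [lintegral_lintegral_swap]
      · calc _ = ∫⁻ y, (∫⁻ x, ‖K x y‖ₑ ∂μ) * ‖f y‖ₑ ^ r ∂μ := by
              congr 1; ext y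
              rw [lintegral_mul_const _ (hK.of_uncurry_right).enorm]
          _ ≤ ∫⁻ y, C * ‖f y‖ₑ ^ r ∂μ := by
              refine lintegral_mono fun y => ?_
              gcongr
              exact h2 y
          _ = _ := lintegral_const_mul'' _ (hf.enorm.pow_const r)
      · exact hKm.aemeasurable.mul
          ((hf.enorm.pow_const r).comp_quasiMeasurePreserving Measure.quasiMeasurePreserving_snd)
    rw [eLpNorm_eq_lintegral_rpow_enorm_toReal hp0 hpt,
      eLpNorm_eq_lintegral_rpow_enorm_toReal hp0 hpt, ← hr, one_div,
      ENNReal.rpow_inv_le_iff hr0, ENNReal.mul_rpow_of_nonneg _ _ hr0.le,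
      ENNReal.rpow_inv_rpow hr0.ne']
    have hmeas : AEMeasurable (fun x => ∫⁻ y, ‖K x y‖ₑ * ‖f y‖ₑ ^ r ∂μ) μ := by
      refine AEMeasurable.lintegral_prod_right' (f := fun z : Ω × Ω => ‖K z.1 z.2‖ₑ * ‖f z.2‖ₑ ^ r) ?_
      exact hKm.aemeasurable.mul
        ((hf.enorm.pow_const r).comp_quasiMeasurePreserving Measure.quasiMeasurePreserving_snd)
    calc ∫⁻ x, ‖∫ y, K x y * f y ∂μ‖ₑ ^ r ∂μ
        ≤ ∫⁻ x, C ^ (r - 1) * ∫⁻ y, ‖K x y‖ₑ * ‖f y‖ₑ ^ r ∂μ ∂μ :=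
          lintegral_mono fun x => (by gcongr; exact hle x : _ ≤ _).trans (hpow x)
      _ = C ^ (r - 1) * ∫⁻ x, ∫⁻ y, ‖K x y‖ₑ * ‖f y‖ₑ ^ r ∂μ ∂μ :=
          lintegral_const_mul'' _ hmeas
      _ ≤ C ^ (r - 1) * (C * ∫⁻ y, ‖f y‖ₑ ^ r ∂μ) := by gcongr
      _ = _ := by
          rw [← mul_assoc]
          congr 1
          nth_rw 2 [← ENNReal.rpow_one C]
          rw [← ENNReal.rpow_add_of_nonneg _ _ (by linarith) zero_le_one, sub_add_cancel]

namespace DataSpace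

/-! ### Filtered partial sums, dyadic blocks and their norms. -/

section LowPass

variable {X : Type*} [MetricSpace X] [CompactSpace X] [MeasurableSpace X] [BorelSpace X]
  (Ξ : DataSpace X)

/-- A low-pass filter with kernels uniformly bounded in `L¹`. -/
structure IsLowPass (ψ : ℕ → ℕ → ℝ) (C : ℝ) : Prop where
  pos : 0 < C
  eq_zero : ∀ j k, 2 ^ j ≤ Ξ.eig k → ψ j k = 0
  eq_one : ∀ j k, 2 * Ξ.eig k ≤ 2 ^ j → ψ j k = 1
  bound : ∀ j x, ∫⁻ y, ENNReal.ofReal |∑ k ∈ Ξ.freq j, ψ j k * (Ξ.φ k x * Ξ.φ k y)| ∂Ξ.μ ≤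
      ENNReal.ofReal C

lemma exists_isLowPass : ∃ ψ C, Ξ.IsLowPass ψ C := by
  obtain ⟨ψ, C, h1, h2, h3, h4⟩ := Ξ.exists_filter
  exact ⟨ψ, C, h1, h2, h3, h4⟩

/-- The Fourier coefficients of `f`. -/
noncomputable def coef (f : X → ℝ) (k : ℕ) : ℝ := ∫ y, f y * Ξ.φ k y ∂Ξ.μ

/-- The filtered partial sums of the Fourier series of `f`. -/
noncomputable def lowPass (ψ : ℕ → ℕ → ℝ) (j : ℕ) (f : X → ℝ) (x : X) : ℝ :=
  ∑ k ∈ Ξ.freq j, ψ j k * Ξ.coef f k * Ξ.φ k x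

lemma integrable_mul_phi {f : X → ℝ} (hf : Integrable f Ξ.μ) (k : ℕ) :
    Integrable (fun y => f y * Ξ.φ k y) Ξ.μ := by
  obtain ⟨C, -, hC⟩ := Ξ.exists_abs_phi_le k
  exact hf.mul_bdd (Ξ.φ_continuous k).aestronglyMeasurable (ae_of_all _ hC)

lemma coef_sub {f g : X → ℝ} (hf : Integrable f Ξ.μ) (hg : Integrable g Ξ.μ) (k : ℕ) :
    Ξ.coef (fun x => f x - g x) k = Ξ.coef f k - Ξ.coef g k := by
  simp only [coef, sub_mul]
  exact integral_sub (Ξ.integrable_mul_phi hf k) (Ξ.integrable_mul_phi hg k)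

lemma memLp_of_mem_poly {n : ℝ} {P : X → ℝ} (hP : P ∈ Ξ.poly n) (p : ℝ≥0∞) : MemLp P p Ξ.μ := by
  induction hP using Submodule.span_induction with
  | mem x h => obtain ⟨k, -, rfl⟩ := h; exact Ξ.memLp_phi k p
  | zero => exact MemLp.zero
  | add x y _ _ hx hy => exact hx.add hy
  | smul a x _ hx => exact hx.const_smul a

variable {Ξ} {ψ : ℕ → ℕ → ℝ} {C : ℝ}

lemma lowPass_sub {f g : X → ℝ} (hf : Integrable f Ξ.μ) (hg : Integrable g Ξ.μ) (j : ℕ) (x : X) :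
    Ξ.lowPass ψ j (fun x => f x - g x) x = Ξ.lowPass ψ j f x - Ξ.lowPass ψ j g x := by
  simp only [lowPass, Ξ.coef_sub hf hg, ← Finset.sum_sub_distrib]
  exact Finset.sum_congr rfl fun k _ => by ring

/-- The multiplier of level `j + 1` is one only up to frequency `2^j`; hence the shift of level here
and below. -/
lemma IsLowPass.lowPass_phi (h : Ξ.IsLowPass ψ C) {j k : ℕ} (hk : Ξ.eig k < 2 ^ j) :
    Ξ.lowPass ψ (j + 1) (Ξ.φ k) = Ξ.φ k := by
  ext x
  have hk' : k ∈ Ξ.freq (j + 1) := by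
    rw [mem_freq, pow_succ]; linarith [pow_pos (two_pos (α := ℝ)) j]
  simp only [lowPass, coef, Ξ.φ_orthonormal, mul_ite, ite_mul, mul_one, mul_zero, zero_mul]
  rw [Finset.sum_ite_eq, if_pos hk', h.eq_one, one_mul]
  rw [pow_succ]; linarith

lemma IsLowPass.lowPass_poly (h : Ξ.IsLowPass ψ C) {j : ℕ} {P : X → ℝ} (hP : P ∈ Ξ.poly (2 ^ j)) :
    Ξ.lowPass ψ (j + 1) P = P := by
  induction hP using Submodule.span_induction with
  | mem x hx => obtain ⟨k, hk, rfl⟩ := hx; exact h.lowPass_phi hk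
  | zero => ext x; simp [lowPass, coef]
  | add f g hfm hgm hf hg =>
    have hfi := (Ξ.memLp_of_mem_poly hfm 1).integrable le_rfl
    have hgi := (Ξ.memLp_of_mem_poly hgm 1).integrable le_rfl
    have : ∀ k, Ξ.coef (f + g) k = Ξ.coef f k + Ξ.coef g k := fun k => by
      simp only [coef, Pi.add_apply, add_mul]
      exact integral_add (Ξ.integrable_mul_phi hfi k) (Ξ.integrable_mul_phi hgi k)
    ext x
    have e : Ξ.lowPass ψ (j + 1) (f + g) x =
        Ξ.lowPass ψ (j + 1) f x + Ξ.lowPass ψ (j + 1) g x := by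
      simp only [lowPass, this, ← Finset.sum_add_distrib]
      exact Finset.sum_congr rfl fun k _ => by ring
    rw [e, hf, hg, Pi.add_apply]
  | smul a f _ hf =>
    have : ∀ k, Ξ.coef (a • f) k = a * Ξ.coef f k := fun k => by
      simp only [coef, Pi.smul_apply, smul_eq_mul, mul_assoc, integral_const_mul]
    ext x
    have e : Ξ.lowPass ψ (j + 1) (a • f) x = a * Ξ.lowPass ψ (j + 1) f x := by
      simp only [lowPass, this, Finset.mul_sum]
      exact Finset.sum_congr rfl fun k _ => by ring
    rw [e, hf, Pi.smul_apply, smul_eq_mul]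

lemma lowPass_memLp (f : X → ℝ) (j : ℕ) (p : ℝ≥0∞) : MemLp (Ξ.lowPass ψ j f) p Ξ.μ :=
  memLp_finsetSum _ fun k _ => (Ξ.memLp_phi k p).const_mul _

lemma IsLowPass.eLpNorm_lowPass_le (h : Ξ.IsLowPass ψ C) {p : ℝ≥0∞} (hp : 1 ≤ p) {f : X → ℝ}
    (hf : MemLp f p Ξ.μ) (j : ℕ) :
    eLpNorm (Ξ.lowPass ψ j f) p Ξ.μ ≤ ENNReal.ofReal C * eLpNorm f p Ξ.μ := by
  have hfi : Integrable f Ξ.μ := hf.integrable hp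
  set K : X → X → ℝ := fun x y => ∑ k ∈ Ξ.freq j, ψ j k * (Ξ.φ k x * Ξ.φ k y) with hK
  have e : Ξ.lowPass ψ j f = fun x => ∫ y, K x y * f y ∂Ξ.μ := by
    ext x
    simp only [hK, Finset.sum_mul]
    rw [integral_finsetSum]
    · refine Finset.sum_congr rfl fun k _ => ?_
      rw [coef, mul_right_comm, ← integral_const_mul]
      congr 1; ext y; ring
    · intro k _
      refine ((Ξ.integrable_mul_phi hfi k).const_mul (ψ j k * Ξ.φ k x)).congr (ae_of_all _ fun y => ?_)
      simp only; ring
  have hb : ∀ x, ∫⁻ y, ‖K x y‖ₑ ∂Ξ.μ ≤ ENNReal.ofReal C := fun x => by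
    simpa only [Real.enorm_eq_ofReal_abs] using h.bound j x
  have hsymm : ∀ x y, K x y = K y x := fun x y => by
    simp only [hK, mul_comm (Ξ.φ _ x)]
  rw [e]
  refine eLpNorm_integral_kernel_le Ξ.μ K ?_ hb (fun y => ?_) hp hf.1
  · refine Finset.measurable_fun_sum _ fun k _ => ?_
    exact (((Ξ.φ_continuous k).measurable.comp measurable_fst).mul
      ((Ξ.φ_continuous k).measurable.comp measurable_snd)).const_mul _
  · simp_rw [hsymm _ y]; exact hb y

/-- Since the filter reproduces `P`, the error for `f` is the error for `f - P`, and stability in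
L^p bounds the latter by `(1 + C)‖f - P‖`. -/
lemma IsLowPass.eLpNorm_sub_lowPass_le_degApprox (h : Ξ.IsLowPass ψ C) {p : ℝ≥0∞} (hp : 1 ≤ p)
    {f : X → ℝ} (hf : MemLp f p Ξ.μ) (j : ℕ) :
    eLpNorm (fun x => f x - Ξ.lowPass ψ (j + 1) f x) p Ξ.μ ≤
      ENNReal.ofReal (1 + C) * Ξ.degApprox p (2 ^ j) f := by
  have hC := h.pos
  have h0 : ENNReal.ofReal (1 + C) ≠ 0 := by
    rw [Ne, ENNReal.ofReal_eq_zero]; linarith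
  rw [mul_comm, ← ENNReal.div_le_iff h0 ENNReal.ofReal_ne_top]
  refine le_iInf₂ fun P hP => ?_
  rw [ENNReal.div_le_iff h0 ENNReal.ofReal_ne_top, mul_comm]
  have hPp := Ξ.memLp_of_mem_poly hP p
  have hg : MemLp (fun x => f x - P x) p Ξ.μ := hf.sub hPp
  have e : (fun x => f x - Ξ.lowPass ψ (j + 1) f x) =
      fun x => (f x - P x) - Ξ.lowPass ψ (j + 1) (fun x => f x - P x) x := by
    ext x
    rw [lowPass_sub (hf.integrable hp) (hPp.integrable hp), h.lowPass_poly hP]; ring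
  rw [e]
  refine (eLpNorm_sub_le hg.1 (lowPass_memLp _ _ p).1 hp).trans ?_
  rw [ENNReal.ofReal_add zero_le_one hC.le, add_mul, ENNReal.ofReal_one, one_mul]
  gcongr
  exact h.eLpNorm_lowPass_le hp hg _

lemma eLpNorm_le_sobolevNorm (p : ℝ≥0∞) (γ : ℝ) (f : X → ℝ) :
    eLpNorm f p Ξ.μ ≤ Ξ.sobolevNorm p γ f := le_self_add

lemma degApprox_le_sobolevNorm (p : ℝ≥0∞) (γ : ℝ) (f : X → ℝ) (j : ℕ) :
    Ξ.degApprox p (2 ^ j) f ≤ ENNReal.ofReal ((2 : ℝ) ^ (-((j : ℝ) * γ))) * Ξ.sobolevNorm p γ f := by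
  have h1 : ENNReal.ofReal ((2 : ℝ) ^ ((j : ℝ) * γ)) * Ξ.degApprox p (2 ^ j) f ≤
      Ξ.sobolevNorm p γ f :=
    (le_iSup (fun j : ℕ => ENNReal.ofReal ((2 : ℝ) ^ ((j : ℝ) * γ)) * Ξ.degApprox p (2 ^ j) f) j).trans
      le_add_self
  calc _ = ENNReal.ofReal ((2 : ℝ) ^ (-((j : ℝ) * γ))) *
        (ENNReal.ofReal ((2 : ℝ) ^ ((j : ℝ) * γ)) * Ξ.degApprox p (2 ^ j) f) := by
        rw [← mul_assoc, ← ENNReal.ofReal_mul (by positivity), ← Real.rpow_add two_pos]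
        simp
    _ ≤ _ := by gcongr

/-- The factor `2^γ` pays for the shift of level. Level 0 has no predecessor and is covered by the
summand `‖f‖_p` of the Sobolev norm. -/
lemma IsLowPass.eLpNorm_sub_lowPass_le (h : Ξ.IsLowPass ψ C) {p : ℝ≥0∞} (hp : 1 ≤ p)
    {γ : ℝ} (hγ : 0 < γ) {f : X → ℝ} (hf : MemLp f p Ξ.μ) (j : ℕ) :
    eLpNorm (fun x => f x - Ξ.lowPass ψ j f x) p Ξ.μ ≤
      ENNReal.ofReal ((1 + C) * 2 ^ γ * (2 : ℝ) ^ (-((j : ℝ) * γ))) * Ξ.sobolevNorm p γ f := by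
  have hC := h.pos
  cases j with
  | zero =>
    refine (eLpNorm_sub_le hf.1 (lowPass_memLp _ _ p).1 hp).trans ?_
    calc _ ≤ eLpNorm f p Ξ.μ + ENNReal.ofReal C * eLpNorm f p Ξ.μ := by
          gcongr; exact h.eLpNorm_lowPass_le hp hf _
      _ = ENNReal.ofReal (1 + C) * eLpNorm f p Ξ.μ := by
          rw [ENNReal.ofReal_add zero_le_one hC.le, add_mul, ENNReal.ofReal_one, one_mul]
      _ ≤ _ := by
          gcongr
          · simp only [Nat.cast_zero, zero_mul, neg_zero, Real.rpow_zero, mul_one]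
            exact le_mul_of_one_le_right (by linarith) (Real.one_le_rpow one_le_two hγ.le)
          · exact eLpNorm_le_sobolevNorm p γ f
  | succ j =>
    refine (h.eLpNorm_sub_lowPass_le_degApprox hp hf j).trans ?_
    calc _ ≤ ENNReal.ofReal (1 + C) *
          (ENNReal.ofReal ((2 : ℝ) ^ (-((j : ℝ) * γ))) * Ξ.sobolevNorm p γ f) := by
          gcongr; exact degApprox_le_sobolevNorm p γ f j
      _ = _ := by
          rw [← mul_assoc, ← ENNReal.ofReal_mul (by positivity), mul_assoc (1 + C),
            ← Real.rpow_add two_pos]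
          congr 4; push_cast; ring

/-- The multiplier of the `j`-th dyadic block. -/
def bandMult (ψ : ℕ → ℕ → ℝ) : ℕ → ℕ → ℝ
  | 0, k => ψ 0 k
  | j + 1, k => ψ (j + 1) k - ψ j k

/-- The `j`-th dyadic block of `f`. -/
noncomputable def block (Ξ : DataSpace X) (ψ : ℕ → ℕ → ℝ) (j : ℕ) (f : X → ℝ) (x : X) : ℝ :=
  ∑ k ∈ Ξ.freq j, bandMult ψ j k * Ξ.coef f k * Ξ.φ k x

/-- At a positive level `j` the two multipliers being subtracted are both one below `2^(j-2)` and
both zero from `2^j` on; this is why the bands have this overlapping form. -/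
lemma IsLowPass.bandMult_eq_zero (h : Ξ.IsLowPass ψ C) {j k : ℕ} (hk : k ∉ Ξ.band j) :
    bandMult ψ j k = 0 := by
  cases j with
  | zero =>
    refine h.eq_zero 0 k ?_
    by_contra hlt
    exact hk ⟨Or.inl rfl, not_le.1 hlt⟩
  | succ j =>
    have h2 : (2 : ℝ) ^ (j + 1) = 2 * 2 ^ j := by ring
    have h2j : (0 : ℝ) < 2 ^ j := by positivity
    rcases le_or_gt ((2 : ℝ) ^ (j + 1)) (Ξ.eig k) with hge | hlt
    · simp only [bandMult]
      rw [h.eq_zero _ k hge, h.eq_zero j k (by linarith), sub_zero]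
    · have hlt' : Ξ.eig k < (2 : ℝ) ^ (((j + 1 : ℕ) : ℝ) - 2) := by
        by_contra hge
        exact hk ⟨Or.inr (not_lt.1 hge), hlt⟩
      have h3 : 2 * (2 : ℝ) ^ (((j + 1 : ℕ) : ℝ) - 2) = 2 ^ j := by
        nth_rw 1 [← Real.rpow_one 2]
        rw [← Real.rpow_add two_pos, ← Real.rpow_natCast]
        congr 1; push_cast; ring
      simp only [bandMult]
      rw [h.eq_one _ k (by linarith), h.eq_one j k (by linarith), sub_self]

lemma IsLowPass.block_mem (h : Ξ.IsLowPass ψ C) (j : ℕ) (f : X → ℝ) :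
    Ξ.block ψ j f ∈ Ξ.bandPoly j := by
  have e : Ξ.block ψ j f = ∑ k ∈ Ξ.freq j, (bandMult ψ j k * Ξ.coef f k) • Ξ.φ k := by
    ext x; simp [block]
  rw [e]
  refine Submodule.sum_mem _ fun k _ => ?_
  by_cases hk : k ∈ Ξ.band j
  · exact Submodule.smul_mem _ _ (Submodule.subset_span ⟨k, hk, rfl⟩)
  · rw [h.bandMult_eq_zero hk, zero_mul, zero_smul]
    exact Submodule.zero_mem _

lemma IsLowPass.block_succ (h : Ξ.IsLowPass ψ C) (j : ℕ) (f : X → ℝ) (x : X) :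
    Ξ.block ψ (j + 1) f x = Ξ.lowPass ψ (j + 1) f x - Ξ.lowPass ψ j f x := by
  have e : Ξ.lowPass ψ j f x = ∑ k ∈ Ξ.freq (j + 1), ψ j k * Ξ.coef f k * Ξ.φ k x := by
    refine Finset.sum_subset (fun k hk => ?_) fun k _ hk => ?_
    · rw [mem_freq] at hk ⊢
      exact hk.trans_le (pow_le_pow_right₀ one_le_two (Nat.le_succ j))
    · rw [mem_freq, not_lt] at hk
      rw [h.eq_zero j k hk, zero_mul, zero_mul]
  rw [e, lowPass, ← Finset.sum_sub_distrib]
  exact Finset.sum_congr rfl fun k _ => by simp only [bandMult]; ring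

lemma block_memLp (f : X → ℝ) (j : ℕ) (p : ℝ≥0∞) : MemLp (Ξ.block ψ j f) p Ξ.μ :=
  memLp_finsetSum _ fun k _ => (Ξ.memLp_phi k p).const_mul _

lemma IsLowPass.eLpNorm_block_le (h : Ξ.IsLowPass ψ C) {p : ℝ≥0∞} (hp : 1 ≤ p)
    {γ : ℝ} (hγ : 0 < γ) {f : X → ℝ} (hf : MemLp f p Ξ.μ) (j : ℕ) :
    eLpNorm (Ξ.block ψ j f) p Ξ.μ ≤
      ENNReal.ofReal ((1 + C) * 2 ^ γ * (1 + 2 ^ γ) * (2 : ℝ) ^ (-((j : ℝ) * γ))) *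
        Ξ.sobolevNorm p γ f := by
  have hC := h.pos
  have h1 : (1 : ℝ) ≤ 2 ^ γ := Real.one_le_rpow one_le_two hγ.le
  cases j with
  | zero =>
    have e : Ξ.block ψ 0 f = Ξ.lowPass ψ 0 f := by ext x; simp [block, lowPass, bandMult]
    rw [e]
    refine (h.eLpNorm_lowPass_le hp hf 0).trans ?_
    gcongr
    · simp only [Nat.cast_zero, zero_mul, neg_zero, Real.rpow_zero, mul_one]
      have : 1 ≤ (2 : ℝ) ^ γ * (1 + 2 ^ γ) := by nlinarith
      nlinarith
    · exact eLpNorm_le_sobolevNorm p γ f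
  | succ j =>
    have e : Ξ.block ψ (j + 1) f = fun x => (f x - Ξ.lowPass ψ j f x) -
        (f x - Ξ.lowPass ψ (j + 1) f x) := by
      ext x; rw [h.block_succ]; ring
    rw [e]
    refine (eLpNorm_sub_le (hf.sub (lowPass_memLp _ _ p)).1
      (hf.sub (lowPass_memLp _ _ p)).1 hp).trans ?_
    refine (add_le_add (h.eLpNorm_sub_lowPass_le hp hγ hf j)
      (h.eLpNorm_sub_lowPass_le hp hγ hf (j + 1))).trans_eq ?_
    rw [← add_mul, ← ENNReal.ofReal_add (by positivity) (by positivity)]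
    congr 2
    have : (2 : ℝ) ^ (-((j : ℝ) * γ)) = 2 ^ γ * (2 : ℝ) ^ (-(((j + 1 : ℕ) : ℝ) * γ)) := by
      rw [← Real.rpow_add two_pos]; congr 1; push_cast; ring
    rw [this]; ring

end LowPass

end DataSpace

namespace DataSpace

/-! ### Operators on the Sobolev class, and the mass of the representing measure. -/

section Operators

variable {X : Type*} [MetricSpace X] [CompactSpace X] [MeasurableSpace X] [BorelSpace X]
  {Ξ : DataSpace X} {ψ : ℕ → ℕ → ℝ} {C : ℝ}

/-- The Bernstein inequality costs `2^(ja)` and the block contributes `2^(-jγ)`. Only an L^p norm is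
needed here; the exponent `max p 2` serves the coefficient estimates, where L² enters. -/
lemma IsDerivativeLike.exists_block_bound (h : Ξ.IsLowPass ψ C) {p : ℝ≥0∞} [Fact (1 ≤ p)]
    {U : Lp ℝ p Ξ.μ →ₗ.[ℝ] Lp ℝ p Ξ.μ} {a γ : ℝ} (hU : Ξ.IsDerivativeLike p U a)
    (hγ : 0 < γ) : ∃ C' : ℝ, 0 < C' ∧ ∀ f : X → ℝ, MemLp f (max p 2) Ξ.μ →
      Ξ.sobolevNorm (max p 2) γ f < ∞ → ∀ (j : ℕ) (B : U.domain),
        ((B : Lp ℝ p Ξ.μ) : X → ℝ) =ᵐ[Ξ.μ] Ξ.block ψ j f →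
          ‖U B‖ ≤ C' * (Ξ.sobolevNorm (max p 2) γ f).toReal * ((2 : ℝ) ^ (a - γ)) ^ j := by
  have hp : 1 ≤ p := Fact.out
  have hC := h.pos
  obtain ⟨C₀, hC₀⟩ := hU.bernstein
  set E : ℝ := (1 + C) * 2 ^ γ * (1 + 2 ^ γ) with hE
  have hE0 : 0 < E := by positivity
  refine ⟨(|C₀| + 1) * E, by positivity, fun f hf hS j B hB => ?_⟩
  have h1 := hC₀ j _ (h.block_mem j f) B hB
  have h2 : eLpNorm (Ξ.block ψ j f) p Ξ.μ ≤ eLpNorm (Ξ.block ψ j f) (max p 2) Ξ.μ :=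
    eLpNorm_le_eLpNorm_of_exponent_le (le_max_left _ _) (block_memLp f j p).1
  have h3 := h.eLpNorm_block_le (hp.trans (le_max_left _ _)) hγ hf j
  have h4 : eLpNorm (U B) p Ξ.μ ≤ ENNReal.ofReal ((|C₀| + 1) * E *
      (Ξ.sobolevNorm (max p 2) γ f).toReal * ((2 : ℝ) ^ (a - γ)) ^ j) := by
    calc _ ≤ _ := h1
      _ ≤ ENNReal.ofReal ((|C₀| + 1) * (2 : ℝ) ^ ((j : ℝ) * a)) *
          (ENNReal.ofReal (E * (2 : ℝ) ^ (-((j : ℝ) * γ))) *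
            ENNReal.ofReal (Ξ.sobolevNorm (max p 2) γ f).toReal) := by
          rw [ENNReal.ofReal_toReal hS.ne]
          gcongr
          · linarith [le_abs_self C₀]
          · exact h2.trans h3
      _ = _ := by
          rw [← ENNReal.ofReal_mul (by positivity), ← ENNReal.ofReal_mul (by positivity)]
          congr 1
          have : ((2 : ℝ) ^ (a - γ)) ^ j = (2 : ℝ) ^ ((j : ℝ) * a) * (2 : ℝ) ^ (-((j : ℝ) * γ)) := by
            rw [← Real.rpow_natCast, ← Real.rpow_mul zero_le_two, ← Real.rpow_add two_pos]
            congr 1; ring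
          rw [this]; ring
  rw [Lp.norm_def]
  exact ENNReal.toReal_le_of_le_ofReal (by positivity) h4

lemma lowPass_mem_poly (n : ℕ) (f : X → ℝ) : Ξ.lowPass ψ n f ∈ Ξ.poly ((2 ^ n : ℕ) : ℝ) := by
  have e : Ξ.lowPass ψ n f = ∑ k ∈ Ξ.freq n, (ψ n k * Ξ.coef f k) • Ξ.φ k := by
    ext x; simp [lowPass]
  rw [e]
  refine Submodule.sum_mem _ fun k hk => Submodule.smul_mem _ _ (Submodule.subset_span ⟨k, ?_, rfl⟩)
  simpa using (Ξ.mem_freq).1 hk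

/-- Functions of the Sobolev class lie in the domain of a derivative-like operator, which may be
computed on the filtered partial sums up to a geometric error. -/
lemma IsDerivativeLike.exists_approx (h : Ξ.IsLowPass ψ C) {p : ℝ≥0∞} [Fact (1 ≤ p)]
    {U : Lp ℝ p Ξ.μ →ₗ.[ℝ] Lp ℝ p Ξ.μ} {a γ : ℝ} (hU : Ξ.IsDerivativeLike p U a)
    (hγ : 0 < γ) (haγ : a < γ) : ∃ C' : ℝ, 0 < C' ∧ ∀ f : X → ℝ, MemLp f (max p 2) Ξ.μ →
      Ξ.sobolevNorm (max p 2) γ f < ∞ → ∃ F : U.domain, ((F : Lp ℝ p Ξ.μ) : X → ℝ) =ᵐ[Ξ.μ] f ∧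
        ∀ (n : ℕ) (B : U.domain), ((B : Lp ℝ p Ξ.μ) : X → ℝ) =ᵐ[Ξ.μ] Ξ.lowPass ψ n f →
          ‖U F - U B‖ ≤ C' * (Ξ.sobolevNorm (max p 2) γ f).toReal *
            (2 : ℝ) ^ ((n : ℝ) * (a - γ)) := by
  have hp : 1 ≤ p := Fact.out
  have hC := h.pos
  obtain ⟨C₁, hC₁, hb⟩ := hU.exists_block_bound h hγ
  set r : ℝ := 2 ^ (a - γ) with hr
  have hr0 : 0 < r := by positivity
  have hr1 : r < 1 := Real.rpow_lt_one_of_one_lt_of_neg one_lt_two (by linarith)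
  refine ⟨C₁ / (1 - r), div_pos hC₁ (by linarith), fun f hf hS => ?_⟩
  set S := (Ξ.sobolevNorm (max p 2) γ f).toReal with hSdef
  have hfp : MemLp f p Ξ.μ := hf.mono_exponent (le_max_left _ _)
  choose B hB using fun n => hU.poly_mem _ _ (lowPass_mem_poly (Ξ := Ξ) (ψ := ψ) n f)
  -- Consecutive partial sums differ by one block, so their images form a Cauchy sequence of
  -- geometric rate; its tail sum gives the constant `C₁ / (1 - r)`.
  have hstep : ∀ n, dist (U (B n)) (U (B (n + 1))) ≤ (C₁ * S * r) * r ^ n := fun n => by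
    have hd := hb f hf hS (n + 1) (B (n + 1) - B n) (by
      have e1 : ((B (n + 1) - B n : U.domain) : Lp ℝ p Ξ.μ) =
        (B (n + 1) : Lp ℝ p Ξ.μ) - (B n : Lp ℝ p Ξ.μ) := rfl
      rw [e1]
      filter_upwards [Lp.coeFn_sub (B (n + 1) : Lp ℝ p Ξ.μ) (B n : Lp ℝ p Ξ.μ), hB n, hB (n + 1)]
        with x hx h1 h2
      rw [hx, Pi.sub_apply, h1, h2, h.block_succ])
    rw [dist_comm, dist_eq_norm, ← LinearPMap.map_sub]
    refine hd.trans_eq ?_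
    rw [pow_succ]; ring
  obtain ⟨V, hV⟩ := cauchySeq_tendsto_of_complete (cauchySeq_of_le_geometric r _ hr1 hstep)
  have hF : Tendsto (fun n => (B n : Lp ℝ p Ξ.μ)) atTop (𝓝 (hfp.toLp f)) := by
    rw [tendsto_iff_norm_sub_tendsto_zero]
    set E : ℝ := (1 + C) * 2 ^ γ with hE
    have hle : ∀ n, ‖(B n : Lp ℝ p Ξ.μ) - hfp.toLp f‖ ≤ E * S * ((2 : ℝ) ^ (-γ)) ^ n := fun n => by
      rw [norm_sub_rev, Lp.norm_def]
      refine ENNReal.toReal_le_of_le_ofReal (by positivity) ?_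
      have e1 : eLpNorm (hfp.toLp f - (B n : Lp ℝ p Ξ.μ) : Lp ℝ p Ξ.μ) p Ξ.μ =
          eLpNorm (fun x => f x - Ξ.lowPass ψ n f x) p Ξ.μ := by
        refine eLpNorm_congr_ae ?_
        filter_upwards [Lp.coeFn_sub (hfp.toLp f) (B n : Lp ℝ p Ξ.μ), hB n, hfp.coeFn_toLp]
          with x hx h1 h2
        rw [hx, Pi.sub_apply, h1, h2]
      rw [e1]
      refine (eLpNorm_le_eLpNorm_of_exponent_le (le_max_left p 2)
        (hf.sub (lowPass_memLp f n _)).1).trans ?_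
      refine (h.eLpNorm_sub_lowPass_le (hp.trans (le_max_left _ _)) hγ hf n).trans_eq ?_
      rw [← ENNReal.ofReal_toReal hS.ne, ← ENNReal.ofReal_mul (by positivity)]
      congr 1
      have : ((2 : ℝ) ^ (-γ)) ^ n = (2 : ℝ) ^ (-((n : ℝ) * γ)) := by
        rw [← Real.rpow_natCast, ← Real.rpow_mul zero_le_two]; congr 1; ring
      rw [this]; ring
    refine squeeze_zero (fun _ => norm_nonneg _) hle ?_
    have := tendsto_pow_atTop_nhds_zero_of_lt_one (r := (2 : ℝ) ^ (-γ)) (by positivity)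
      (Real.rpow_lt_one_of_one_lt_of_neg one_lt_two (by linarith))
    simpa using this.const_mul (E * S)
  -- Closedness enters only here: the partial sums converge to `f` and their images to `V`, so `f`
  -- lies in the domain with image `V`.
  have hgraph : (hfp.toLp f, V) ∈ U.graph := by
    refine (hU.closed : IsClosed (U.graph : Set (Lp ℝ p Ξ.μ × Lp ℝ p Ξ.μ))).mem_of_tendsto
      (hF.prodMk_nhds hV) (Eventually.of_forall fun n => U.mem_graph (B n))
  obtain ⟨F, hF1, hF2⟩ := U.mem_graph_iff.1 hgraph
  refine ⟨F, by rw [hF1]; exact hfp.coeFn_toLp, fun n B' hB' => ?_⟩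
  have hBB : B' = B n := Subtype.ext (Lp.ext (hB'.trans (hB n).symm))
  rw [hBB, hF2]
  have := dist_le_of_le_geometric_of_tendsto r _ hr1 hstep hV n
  rw [dist_comm, dist_eq_norm] at this
  refine this.trans ?_
  have e : (2 : ℝ) ^ ((n : ℝ) * (a - γ)) = r ^ n := by
    rw [hr, ← Real.rpow_natCast, ← Real.rpow_mul zero_le_two]; congr 1; ring
  rw [e, div_mul_eq_mul_div, div_mul_eq_mul_div]
  have hS0 : 0 ≤ S := ENNReal.toReal_nonneg
  have h1r : 0 < 1 - r := by linarith
  refine div_le_div_of_nonneg_right ?_ h1r.le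
  exact mul_le_mul_of_nonneg_right (mul_le_of_le_one_right (by positivity) hr1.le) (by positivity)

variable {Y : Type*} [MeasurableSpace Y] {ν : Measure Y}

/-- By linearity the image of a filtered partial sum is an integral of `UG` against a signed measure
on finitely many copies of `Y`, which is the object to be sampled. -/
lemma IsCompatible.exists_lowPass {p : ℝ≥0∞} [Fact (1 ≤ p)] {G : ℕ → X → Y → ℝ}
    {D : ℕ → Y → ℝ} {U : Lp ℝ p Ξ.μ →ₗ.[ℝ] Lp ℝ p Ξ.μ} {UG : ℕ → X → Y → ℝ}
    (hUG : Ξ.IsCompatible ν p G D U UG) (n : ℕ) (f : X → ℝ) :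
    ∃ B : U.domain, ((B : Lp ℝ p Ξ.μ) : X → ℝ) =ᵐ[Ξ.μ] Ξ.lowPass ψ n f ∧
      (U B : X → ℝ) =ᵐ[Ξ.μ] fun x => ∑ k ∈ Ξ.freq n, ψ n k * Ξ.coef f k *
        ∫ y, UG k x y * D k y ∂ν := by
  choose Φ hΦ1 hΦ2 using hUG.apply_φ
  have key : ∀ (s : Finset ℕ) (c : ℕ → ℝ),
      (((∑ k ∈ s, c k • Φ k : U.domain) : Lp ℝ p Ξ.μ) : X → ℝ) =ᵐ[Ξ.μ]
        (fun x => ∑ k ∈ s, c k * Ξ.φ k x) ∧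
      (U (∑ k ∈ s, c k • Φ k) : X → ℝ) =ᵐ[Ξ.μ]
        fun x => ∑ k ∈ s, c k * ∫ y, UG k x y * D k y ∂ν := by
    intro s c
    induction s using Finset.induction_on with
    | empty =>
      simp only [Finset.sum_empty, LinearPMap.map_zero]
      exact ⟨Lp.coeFn_zero ℝ p Ξ.μ, Lp.coeFn_zero ℝ p Ξ.μ⟩
    | insert k s hk ih =>
      simp only [Finset.sum_insert hk, LinearPMap.map_add, LinearPMap.map_smul]
      constructor
      · filter_upwards [Lp.coeFn_add ((c k • Φ k : U.domain) : Lp ℝ p Ξ.μ)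
          ((∑ k ∈ s, c k • Φ k : U.domain) : Lp ℝ p Ξ.μ), Lp.coeFn_smul (c k) (Φ k : Lp ℝ p Ξ.μ),
          hΦ1 k, ih.1] with x h1 h2 h3 h4
        rw [Submodule.coe_add, h1, Pi.add_apply, h4, Submodule.coe_smul, h2, Pi.smul_apply, h3,
          smul_eq_mul]
      · filter_upwards [Lp.coeFn_add (c k • U (Φ k)) (U (∑ k ∈ s, c k • Φ k)),
          Lp.coeFn_smul (c k) (U (Φ k)), hΦ2 k, ih.2] with x h1 h2 h3 h4
        rw [h1, Pi.add_apply, h4, h2, Pi.smul_apply, h3, smul_eq_mul]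
  exact ⟨_, key (Ξ.freq n) fun k => ψ n k * Ξ.coef f k⟩

variable {α β : ℝ} {G : ℕ → X → Y → ℝ} {D : ℕ → Y → ℝ}

lemma exists_mem_band (ℓ : ℕ) : ∃ j, ℓ ∈ Ξ.band j := by
  have hex : ∃ n : ℕ, Ξ.eig ℓ < 2 ^ n := pow_unbounded_of_one_lt _ one_lt_two
  classical
  refine ⟨Nat.find hex, ?_, Nat.find_spec hex⟩
  rcases Nat.eq_zero_or_pos (Nat.find hex) with h0 | h0
  · exact Or.inl h0
  · right
    have := not_lt.1 (Nat.find_min hex (Nat.sub_lt h0 one_pos))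
    refine le_trans ?_ this
    rw [← Real.rpow_natCast]
    refine Real.rpow_le_rpow_of_exponent_le one_le_two ?_
    have h1 : ((Nat.find hex : ℕ) : ℝ) ≤ ((Nat.find hex - 1 : ℕ) : ℝ) + 1 := by
      exact_mod_cast Nat.le_add_of_sub_le le_rfl
    linarith

/-- Cauchy-Schwarz on a probability space, in the form `|D| ≤ δ|D|² + 1/δ` with `δ = 2^(-jβ)`
balancing the two terms. -/
lemma IsEignetKernel.exists_integral_abs_le [IsProbabilityMeasure ν]
    (hG : Ξ.IsEignetKernel ν α β G D) :
    ∃ C' : ℝ, 0 < C' ∧ ∀ (j : ℕ), ∀ ℓ ∈ Ξ.band j, Integrable (D ℓ) ν ∧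
      ∫ y, |D ℓ y| ∂ν ≤ C' * (2 : ℝ) ^ ((j : ℝ) * β) := by
  obtain ⟨C₀, hC₀⟩ := hG.connection_bound
  refine ⟨|C₀| + 1, by positivity, fun j ℓ hℓ => ?_⟩
  set δ : ℝ := (2 : ℝ) ^ (-((j : ℝ) * β)) with hδ
  have hδ0 : 0 < δ := by positivity
  have hδi : δ⁻¹ = (2 : ℝ) ^ ((j : ℝ) * β) := by rw [hδ, ← Real.rpow_neg zero_le_two, neg_neg]
  have hpt : ∀ y, ‖D ℓ y‖ₑ ≤ ENNReal.ofReal δ * ENNReal.ofReal (|D ℓ y| ^ 2) +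
      ENNReal.ofReal δ⁻¹ := fun y => by
    rw [Real.enorm_eq_ofReal_abs, ← ENNReal.ofReal_mul hδ0.le,
      ← ENNReal.ofReal_add (by positivity) (by positivity)]
    refine ENNReal.ofReal_le_ofReal ?_
    have h4 : 0 ≤ δ⁻¹ * (δ * |D ℓ y| - 1) ^ 2 := by positivity
    have h5 : δ⁻¹ * (δ * |D ℓ y| - 1) ^ 2 = δ * |D ℓ y| ^ 2 + δ⁻¹ - |D ℓ y| * 2 := by
      field_simp; ring
    linarith [abs_nonneg (D ℓ y)]
  have hbound : ∫⁻ y, ‖D ℓ y‖ₑ ∂ν ≤ ENNReal.ofReal ((|C₀| + 1) * (2 : ℝ) ^ ((j : ℝ) * β)) := by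
    calc _ ≤ _ := lintegral_mono hpt
      _ = ENNReal.ofReal δ * ∫⁻ y, ENNReal.ofReal (|D ℓ y| ^ 2) ∂ν + ENNReal.ofReal δ⁻¹ := by
          rw [lintegral_add_right _ measurable_const,
            lintegral_const_mul' _ _ ENNReal.ofReal_ne_top]
          simp
      _ ≤ ENNReal.ofReal δ * ENNReal.ofReal (|C₀| * (2 : ℝ) ^ (2 * (j : ℝ) * β)) +
          ENNReal.ofReal δ⁻¹ := by
          gcongr
          refine (hC₀ j ℓ hℓ).trans (ENNReal.ofReal_le_ofReal ?_)
          gcongr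
          exact le_abs_self _
      _ = _ := by
          rw [← ENNReal.ofReal_mul hδ0.le, ← ENNReal.ofReal_add (by positivity) (by positivity)]
          congr 1
          have : (2 : ℝ) ^ (2 * (j : ℝ) * β) = δ⁻¹ * δ⁻¹ := by
            rw [hδi, ← Real.rpow_add two_pos]; ring_nf
          rw [this, ← hδi]
          field_simp
  have hint : Integrable (D ℓ) ν := ⟨hG.aesm_D ℓ, hbound.trans_lt ENNReal.ofReal_lt_top⟩
  refine ⟨hint, ?_⟩
  have := integral_norm_eq_lintegral_enorm (hG.aesm_D ℓ)
  simp only [Real.norm_eq_abs] at this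
  rw [this]
  exact ENNReal.toReal_le_of_le_ofReal (by positivity) hbound

/-- The three regimes of a geometric sum: dominated by its last term, constant terms, convergent.
Level 0 is excluded because in the critical case the scale there is zero while the sum is one. -/
lemma exists_sum_le_eignetScale (q β γ : ℝ) : ∃ C : ℝ, 0 < C ∧ ∀ n : ℕ, 1 ≤ n →
    ∑ j ∈ Finset.range (n + 1), (2 : ℝ) ^ ((j : ℝ) * (q / 2 + β - γ)) ≤
      C * eignetScale q β γ n := by
  set κ := q / 2 + β - γ with hκ
  have hpow : ∀ j : ℕ, (2 : ℝ) ^ ((j : ℝ) * κ) = ((2 : ℝ) ^ κ) ^ j := fun j => by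
    rw [← Real.rpow_natCast, ← Real.rpow_mul zero_le_two]; congr 1; ring
  rcases lt_trichotomy γ (q / 2 + β) with h | h | h
  · have hr1 : 1 < (2 : ℝ) ^ κ := Real.one_lt_rpow one_lt_two (by linarith)
    refine ⟨2 ^ κ / (2 ^ κ - 1), div_pos (by positivity) (by linarith), fun n _ => ?_⟩
    simp only [eignetScale, if_pos h, hpow, ← hκ]
    rw [geom_sum_eq hr1.ne', div_mul_eq_mul_div]
    have : 0 < (2 : ℝ) ^ κ - 1 := by linarith
    gcongr
    rw [pow_succ]; linarith
  · have hk0 : κ = 0 := by linarith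
    refine ⟨2, two_pos, fun n hn => ?_⟩
    simp only [eignetScale, h, lt_irrefl, if_false, if_true, hk0, mul_zero, Real.rpow_zero,
      Finset.sum_const, Finset.card_range, nsmul_eq_mul, mul_one]
    have : (1 : ℝ) ≤ n := by exact_mod_cast hn
    push_cast; linarith
  · have hr1 : (2 : ℝ) ^ κ < 1 := Real.rpow_lt_one_of_one_lt_of_neg one_lt_two (by linarith)
    have hr0 : 0 < (2 : ℝ) ^ κ := by positivity
    refine ⟨(1 - 2 ^ κ)⁻¹, inv_pos.2 (by linarith), fun n _ => ?_⟩
    simp only [eignetScale, h.not_gt, if_false, h.ne', hpow, mul_one]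
    rw [← tsum_geometric_of_lt_one hr0.le hr1]
    exact (summable_geometric_of_lt_one hr0.le hr1).sum_le_tsum _ fun _ _ => by positivity

/-- The total mass of the measure that represents the filtered partial sums. -/
lemma IsEignetKernel.exists_mass_le [IsProbabilityMeasure ν] (hG : Ξ.IsEignetKernel ν α β G D)
    (h : Ξ.IsLowPass ψ C) {γ : ℝ} (hγ : 0 < γ) : ∃ C' : ℝ, 0 < C' ∧ ∀ (p : ℝ≥0∞), 2 ≤ p →
      ∀ f : X → ℝ, MemLp f p Ξ.μ → Ξ.sobolevNorm p γ f < ∞ → ∀ n : ℕ, 1 ≤ n →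
        ∑ ℓ ∈ Ξ.freq n, |ψ n ℓ * Ξ.coef f ℓ| * ∫ y, |D ℓ y| ∂ν ≤
          C' * (Ξ.sobolevNorm p γ f).toReal * eignetScale Ξ.q β γ n := by
  obtain ⟨Cd, hCd, hD⟩ := hG.exists_integral_abs_le
  obtain ⟨Cc, hCc, hcard⟩ := Ξ.exists_card_le
  obtain ⟨Cs, hCs, hsum⟩ := exists_sum_le_eignetScale Ξ.q β γ
  have hC := h.pos
  set E : ℝ := (1 + C) * 2 ^ γ * (1 + 2 ^ γ) with hE
  have hE0 : 0 < E := by positivity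
  refine ⟨Cd * Real.sqrt Cc * E * Cs, by positivity, fun p hp f hf hS n hn => ?_⟩
  set S := (Ξ.sobolevNorm p γ f).toReal with hSdef
  have hS0 : 0 ≤ S := ENNReal.toReal_nonneg
  -- The multiplier telescopes into blocks, so that each coefficient is estimated at the scale of
  -- its own band rather than at level `n`.
  have hψ : ∀ m ℓ, ψ m ℓ = ∑ j ∈ Finset.range (m + 1), bandMult ψ j ℓ := fun m ℓ => by
    induction m with
    | zero => simp [bandMult]
    | succ m ih => rw [Finset.sum_range_succ, ← ih]; simp [bandMult]
  -- Cauchy-Schwarz over the at most `Cc 2^(jq)` frequencies below `2^j`; the sum of squares is the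
  -- squared L² norm of the block.
  have hblock : ∀ j, ∑ ℓ ∈ Ξ.freq j, |bandMult ψ j ℓ * Ξ.coef f ℓ| ≤
      Real.sqrt Cc * E * S * (2 : ℝ) ^ ((j : ℝ) * (Ξ.q / 2 - γ)) := fun j => by
    set d : ℕ → ℝ := fun ℓ => bandMult ψ j ℓ * Ξ.coef f ℓ with hd
    have h1 : ∑ ℓ ∈ Ξ.freq j, d ℓ ^ 2 ≤ (E * S * (2 : ℝ) ^ (-((j : ℝ) * γ))) ^ 2 := by
      have h2 := Ξ.lintegral_sq_sum_phi d (Ξ.freq j)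
      have h3 : eLpNorm (Ξ.block ψ j f) 2 Ξ.μ ≤
          ENNReal.ofReal (E * S * (2 : ℝ) ^ (-((j : ℝ) * γ))) := by
        refine (eLpNorm_le_eLpNorm_of_exponent_le hp (block_memLp f j 2).1).trans ?_
        refine (h.eLpNorm_block_le (one_le_two.trans hp) hγ hf j).trans_eq ?_
        rw [← ENNReal.ofReal_toReal hS.ne, ← ENNReal.ofReal_mul (by positivity)]
        congr 1; ring
      have h4 : eLpNorm (Ξ.block ψ j f) 2 Ξ.μ ^ 2 = ENNReal.ofReal (∑ ℓ ∈ Ξ.freq j, d ℓ ^ 2) := by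
        rw [← h2]
        have := eLpNorm_nnreal_pow_eq_lintegral (f := Ξ.block ψ j f) (μ := Ξ.μ)
          (p := 2) two_ne_zero
        simp only [NNReal.coe_ofNat, ENNReal.rpow_ofNat, ENNReal.coe_ofNat] at this
        rw [this]
        congr 1; ext y
        rw [Real.enorm_eq_ofReal_abs, ← ENNReal.ofReal_pow (abs_nonneg _), sq_abs]
        rfl
      have h5 : ENNReal.ofReal (∑ ℓ ∈ Ξ.freq j, d ℓ ^ 2) ≤
          ENNReal.ofReal ((E * S * (2 : ℝ) ^ (-((j : ℝ) * γ))) ^ 2) := by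
        rw [← h4, ENNReal.ofReal_pow (by positivity)]
        gcongr
      exact (ENNReal.ofReal_le_ofReal_iff (by positivity)).1 h5
    refine abs_le_of_sq_le_sq' ?_ (by positivity) |>.2
    have h6 := sq_sum_le_card_mul_sum_sq (s := Ξ.freq j) (f := fun ℓ => |d ℓ|)
    simp only [sq_abs] at h6
    refine h6.trans ?_
    calc _ ≤ (Cc * (2 : ℝ) ^ ((j : ℝ) * Ξ.q)) * (E * S * (2 : ℝ) ^ (-((j : ℝ) * γ))) ^ 2 := by
          gcongr
          exact hcard j _ fun k hk => (Ξ.mem_freq).1 hk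
      _ = _ := by
          have e1 : (2 : ℝ) ^ ((j : ℝ) * Ξ.q) = ((2 : ℝ) ^ ((j : ℝ) * (Ξ.q / 2))) ^ 2 := by
            rw [pow_two, ← Real.rpow_add two_pos]; ring_nf
          have e2 : (2 : ℝ) ^ ((j : ℝ) * (Ξ.q / 2 - γ)) =
              (2 : ℝ) ^ ((j : ℝ) * (Ξ.q / 2)) * (2 : ℝ) ^ (-((j : ℝ) * γ)) := by
            rw [← Real.rpow_add two_pos]; ring_nf
          rw [e1, e2]
          nth_rw 1 [← Real.sq_sqrt hCc.le]
          ring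
  have hI : ∀ ℓ, 0 ≤ ∫ y, |D ℓ y| ∂ν := fun ℓ => integral_nonneg fun _ => abs_nonneg _
  calc _ ≤ ∑ ℓ ∈ Ξ.freq n, ∑ j ∈ Finset.range (n + 1),
        |bandMult ψ j ℓ * Ξ.coef f ℓ| * ∫ y, |D ℓ y| ∂ν := by
        refine Finset.sum_le_sum fun ℓ _ => ?_
        rw [hψ n ℓ, ← Finset.sum_mul, Finset.sum_mul (f := fun j => bandMult ψ j ℓ)]
        exact mul_le_mul_of_nonneg_right (Finset.abs_sum_le_sum_abs _ _) (hI ℓ)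
    _ = ∑ j ∈ Finset.range (n + 1), ∑ ℓ ∈ Ξ.freq n,
        |bandMult ψ j ℓ * Ξ.coef f ℓ| * ∫ y, |D ℓ y| ∂ν := Finset.sum_comm
    _ ≤ ∑ j ∈ Finset.range (n + 1), (Real.sqrt Cc * E * S *
          (2 : ℝ) ^ ((j : ℝ) * (Ξ.q / 2 - γ))) * (Cd * (2 : ℝ) ^ ((j : ℝ) * β)) := by
        refine Finset.sum_le_sum fun j hj => ?_
        refine le_trans ?_ (mul_le_mul_of_nonneg_right (hblock j) (by positivity))
        rw [Finset.sum_mul]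
        have hsub : Ξ.freq j ⊆ Ξ.freq n := fun k hk => by
          rw [mem_freq] at hk ⊢
          exact hk.trans_le (pow_le_pow_right₀ one_le_two (Nat.lt_succ_iff.1 (Finset.mem_range.1 hj)))
        rw [← Finset.sum_subset hsub fun ℓ _ hℓ => ?_]
        · refine Finset.sum_le_sum fun ℓ _ => ?_
          by_cases hb : ℓ ∈ Ξ.band j
          · exact mul_le_mul_of_nonneg_left (hD j ℓ hb).2 (abs_nonneg _)
          · rw [h.bandMult_eq_zero hb]; simp
        · have hb : ℓ ∉ Ξ.band j := fun hb => hℓ ((Ξ.mem_freq).2 hb.2)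
          rw [h.bandMult_eq_zero hb]; simp
    _ = Cd * Real.sqrt Cc * E * S *
          ∑ j ∈ Finset.range (n + 1), (2 : ℝ) ^ ((j : ℝ) * (Ξ.q / 2 + β - γ)) := by
        rw [Finset.mul_sum]
        refine Finset.sum_congr rfl fun j _ => ?_
        have e : (2 : ℝ) ^ ((j : ℝ) * (Ξ.q / 2 + β - γ)) =
            (2 : ℝ) ^ ((j : ℝ) * (Ξ.q / 2 - γ)) * (2 : ℝ) ^ ((j : ℝ) * β) := by
          rw [← Real.rpow_add two_pos]; ring_nf
        rw [e]; ring
    _ ≤ Cd * Real.sqrt Cc * E * S * (Cs * eignetScale Ξ.q β γ n) := by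
        gcongr
        exact hsum n hn
    _ = _ := by ring

end Operators

end DataSpace

namespace DataSpace

/-! ### Lower volume bounds and nets of polynomial size. -/

section Covering

variable {X : Type*} [MetricSpace X] [CompactSpace X] [MeasurableSpace X] [BorelSpace X]
  (Ξ : DataSpace X)

/-- Supplies the absolute convergence that allows the heat kernel to be integrated termwise. -/
lemma exists_sum_integral_heat_le : ∃ κ : ℝ, 0 < κ ∧ ∀ (x : X) (t : ℝ), 0 < t → t ≤ 1 →
    ∀ F : Finset ℕ, ∑ i ∈ F, ∫ y, Real.exp (-(Ξ.eig i) ^ 2 * t) * (|Ξ.φ i x| * |Ξ.φ i y|) ∂Ξ.μ ≤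
      κ * t ^ (-Ξ.q / 2) := by
  obtain ⟨κ, hκ, hd⟩ := Ξ.exists_diag_bound
  refine ⟨κ, hκ, fun x t ht ht1 F => ?_⟩
  have hint : ∀ i, Integrable (fun y => Real.exp (-(Ξ.eig i) ^ 2 * t) *
      (|Ξ.φ i x| * |Ξ.φ i y|)) Ξ.μ := fun i =>
    ((((Ξ.memLp_phi i 1).integrable le_rfl).abs).const_mul _).const_mul _
  rw [← integral_finsetSum _ fun i _ => hint i]
  have hpt : ∀ y, ∑ i ∈ F, Real.exp (-(Ξ.eig i) ^ 2 * t) * (|Ξ.φ i x| * |Ξ.φ i y|) ≤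
      κ * t ^ (-Ξ.q / 2) := fun y => by
    have hx := hd x t ht ht1
    have hy := hd y t ht ht1
    calc _ ≤ ∑ i ∈ F, (2⁻¹ * (Real.exp (-(Ξ.eig i) ^ 2 * t) * Ξ.φ i x ^ 2) +
            2⁻¹ * (Real.exp (-(Ξ.eig i) ^ 2 * t) * Ξ.φ i y ^ 2)) := by
          refine Finset.sum_le_sum fun i _ => ?_
          have h6 : |Ξ.φ i x| * |Ξ.φ i y| ≤ 2⁻¹ * Ξ.φ i x ^ 2 + 2⁻¹ * Ξ.φ i y ^ 2 := by
            nlinarith [sq_abs (Ξ.φ i x), sq_abs (Ξ.φ i y), sq_nonneg (|Ξ.φ i x| - |Ξ.φ i y|)]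
          calc _ ≤ Real.exp (-(Ξ.eig i) ^ 2 * t) * (2⁻¹ * Ξ.φ i x ^ 2 + 2⁻¹ * Ξ.φ i y ^ 2) := by
                gcongr
            _ = _ := by ring
      _ ≤ 2⁻¹ * (κ * t ^ (-Ξ.q / 2)) + 2⁻¹ * (κ * t ^ (-Ξ.q / 2)) := by
          rw [Finset.sum_add_distrib, ← Finset.mul_sum, ← Finset.mul_sum]
          gcongr
          · exact (hx.1.sum_le_tsum F fun _ _ => by positivity).trans hx.2
          · exact (hy.1.sum_le_tsum F fun _ _ => by positivity).trans hy.2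
      _ = _ := by ring
  refine (integral_mono (integrable_finsetSum _ fun i _ => hint i) (integrable_const _) hpt).trans ?_
  simp

/-- The heat operator acts diagonally. -/
lemma integral_heat_mul_phi (x : X) {t : ℝ} (ht : 0 < t) (ht1 : t ≤ 1) (k : ℕ) :
    ∫ y, Ξ.heat t x y * Ξ.φ k y ∂Ξ.μ = Real.exp (-(Ξ.eig k) ^ 2 * t) * Ξ.φ k x := by
  obtain ⟨C, hC0, hC⟩ := Ξ.exists_abs_phi_le k
  obtain ⟨κ, hκ, hs⟩ := Ξ.exists_sum_integral_heat_le
  set F : ℕ → X → ℝ := fun i y =>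
    Real.exp (-(Ξ.eig i) ^ 2 * t) * (Ξ.φ i x * Ξ.φ i y) * Ξ.φ k y with hF
  have hFint : ∀ i, Integrable (F i) Ξ.μ := fun i =>
    (Ξ.integrable_mul_phi ((Ξ.memLp_phi i 1).integrable le_rfl) k).const_mul
      (Real.exp (-(Ξ.eig i) ^ 2 * t) * Ξ.φ i x) |>.congr (ae_of_all _ fun y => by
        simp only [hF]; ring)
  have hFle : ∀ i, ∫ y, ‖F i y‖ ∂Ξ.μ ≤
      C * ∫ y, Real.exp (-(Ξ.eig i) ^ 2 * t) * (|Ξ.φ i x| * |Ξ.φ i y|) ∂Ξ.μ := fun i => by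
    rw [← integral_const_mul]
    refine integral_mono (hFint i).norm
      ((((((Ξ.memLp_phi i 1).integrable le_rfl).abs).const_mul _).const_mul _).const_mul _)
      fun y => ?_
    simp only [hF]
    rw [norm_mul, norm_mul, norm_mul, Real.norm_of_nonneg (Real.exp_pos _).le, mul_comm]
    exact mul_le_mul_of_nonneg_right (hC y) (by positivity)
  have hFs : Summable fun i => ∫ y, ‖F i y‖ ∂Ξ.μ := by
    refine summable_of_sum_le (c := C * (κ * t ^ (-Ξ.q / 2)))
      (fun i => integral_nonneg fun _ => norm_nonneg _) fun u => ?_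
    refine (Finset.sum_le_sum fun i _ => hFle i).trans ?_
    rw [← Finset.mul_sum]
    exact mul_le_mul_of_nonneg_left (hs x t ht ht1 u) hC0
  have key := integral_tsum_of_summable_integral_norm hFint hFs
  have e1 : ∀ y, Ξ.heat t x y * Ξ.φ k y = ∑' i, F i y := fun y => by
    simp only [hF, heat, tsum_mul_right]
  simp_rw [e1]
  rw [← key]
  have e2 : ∀ i, ∫ y, F i y ∂Ξ.μ =
      if i = k then Real.exp (-(Ξ.eig k) ^ 2 * t) * Ξ.φ k x else 0 := fun i => by
    have : ∀ y, F i y = Real.exp (-(Ξ.eig i) ^ 2 * t) * Ξ.φ i x * (Ξ.φ i y * Ξ.φ k y) :=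
      fun y => by simp only [hF]; ring
    simp_rw [this]
    rw [integral_const_mul, Ξ.φ_orthonormal]
    split_ifs with h
    · rw [h, mul_one]
    · rw [mul_zero]
  simp_rw [e2]
  rw [tsum_ite_eq]

/-- Each `φ_k` is `exp(λ_k²t)` times its image under the heat operator, so its value at `x` is
controlled by the L¹ mass of the heat kernel at `x`. As `t ≤ 1`, the constant does not depend on
`t`. -/
lemma exists_abs_poly_le {n : ℝ} {P : X → ℝ} (hP : P ∈ Ξ.poly n) : ∃ S : ℝ, 0 ≤ S ∧
    ∀ (t : ℝ), 0 < t → t ≤ 1 → ∀ x, ENNReal.ofReal |P x| ≤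
      ENNReal.ofReal S * ∫⁻ y, ‖Ξ.heat t x y‖ₑ ∂Ξ.μ := by
  induction hP using Submodule.span_induction with
  | mem f hf =>
    obtain ⟨k, -, rfl⟩ := hf
    obtain ⟨C, hC0, hC⟩ := Ξ.exists_abs_phi_le k
    refine ⟨Real.exp ((Ξ.eig k) ^ 2) * C, by positivity, fun t ht ht1 x => ?_⟩
    have h1 := Ξ.integral_heat_mul_phi x ht ht1 k
    have h2 : |Ξ.φ k x| ≤ Real.exp ((Ξ.eig k) ^ 2) * |∫ y, Ξ.heat t x y * Ξ.φ k y ∂Ξ.μ| := by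
      rw [h1, abs_mul, abs_of_pos (Real.exp_pos _), ← mul_assoc, ← Real.exp_add]
      refine le_mul_of_one_le_left (abs_nonneg _) (Real.one_le_exp ?_)
      nlinarith [sq_nonneg (Ξ.eig k)]
    refine (ENNReal.ofReal_le_ofReal h2).trans ?_
    rw [ENNReal.ofReal_mul (Real.exp_pos _).le, ENNReal.ofReal_mul (Real.exp_pos _).le, mul_assoc]
    gcongr
    rw [← Real.enorm_eq_ofReal_abs, ← lintegral_const_mul' _ _ ENNReal.ofReal_ne_top]
    refine (enorm_integral_le_lintegral_enorm _).trans (lintegral_mono fun y => ?_)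
    simp only
    rw [enorm_mul, mul_comm]
    gcongr
    rw [Real.enorm_eq_ofReal_abs]
    exact ENNReal.ofReal_le_ofReal (hC y)
  | zero => exact ⟨0, le_rfl, fun t _ _ x => by simp⟩
  | add f g _ _ hf hg =>
    obtain ⟨S, hS0, hS⟩ := hf
    obtain ⟨T, hT0, hT⟩ := hg
    refine ⟨S + T, by positivity, fun t ht ht1 x => ?_⟩
    rw [ENNReal.ofReal_add hS0 hT0, add_mul]
    refine le_trans ?_ (add_le_add (hS t ht ht1 x) (hT t ht ht1 x))
    rw [← ENNReal.ofReal_add (abs_nonneg _) (abs_nonneg _)]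
    exact ENNReal.ofReal_le_ofReal (abs_add_le _ _)
  | smul a f _ hf =>
    obtain ⟨S, hS0, hS⟩ := hf
    refine ⟨|a| * S, by positivity, fun t ht ht1 x => ?_⟩
    rw [Pi.smul_apply, smul_eq_mul, abs_mul, ENNReal.ofReal_mul (abs_nonneg _),
      ENNReal.ofReal_mul (abs_nonneg _), mul_assoc]
    gcongr
    exact hS t ht ht1 x

/-- Splitting at distance `r`: near `x` the Gaussian is at most one and the volume of the ball
appears, far away it is at most its value at distance `r`. -/
lemma exists_lintegral_heat_le : ∃ κ₁ κ₂ : ℝ, 0 < κ₁ ∧ 0 < κ₂ ∧ ∀ (t : ℝ), 0 < t → t ≤ 1 →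
    ∀ (x : X) (r : ℝ), 0 < r → ∫⁻ y, ‖Ξ.heat t x y‖ₑ ∂Ξ.μ ≤ ENNReal.ofReal (κ₁ * t ^ (-Ξ.q / 2)) *
      (Ξ.μ (Metric.closedBall x r) + ENNReal.ofReal (Real.exp (-κ₂ * (r ^ 2 / t)))) := by
  obtain ⟨κ₁, κ₂, h1, h2, hk⟩ := Ξ.exists_heat_bound
  refine ⟨κ₁, κ₂, h1, h2, fun t ht ht1 x r hr => ?_⟩
  have hpt : ∀ y, ‖Ξ.heat t x y‖ₑ ≤ ENNReal.ofReal (κ₁ * t ^ (-Ξ.q / 2)) *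
      ((Metric.closedBall x r).indicator 1 y + ENNReal.ofReal (Real.exp (-κ₂ * (r ^ 2 / t)))) :=
    fun y => by
      have hb := hk x y t ht ht1 1 le_rfl
      rw [Nat.cast_one, one_mul] at hb
      rw [Real.enorm_eq_ofReal_abs]
      refine (ENNReal.ofReal_le_ofReal hb).trans ?_
      rw [ENNReal.ofReal_mul (by positivity)]
      gcongr
      by_cases hy : y ∈ Metric.closedBall x r
      · rw [Set.indicator_of_mem hy, Pi.one_apply]
        refine le_trans ?_ le_self_add
        rw [← ENNReal.ofReal_one]
        refine ENNReal.ofReal_le_ofReal (Real.exp_le_one_iff.2 ?_)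
        have : 0 ≤ dist x y ^ 2 / t := by positivity
        nlinarith
      · refine le_trans (ENNReal.ofReal_le_ofReal (Real.exp_le_exp.2 ?_)) le_add_self
        have hdist : r ≤ dist x y := by
          rw [Metric.mem_closedBall, not_le, dist_comm] at hy; exact hy.le
        have : r ^ 2 / t ≤ dist x y ^ 2 / t := by gcongr
        nlinarith
  refine (lintegral_mono hpt).trans_eq ?_
  rw [lintegral_const_mul' _ _ ENNReal.ofReal_ne_top, lintegral_add_right _ measurable_const,
    lintegral_indicator_one Metric.isClosed_closedBall.measurableSet]
  simp

/-- If constants can be approximated by diffusion polynomials, balls have a polynomial lower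
volume bound around almost every point. -/
lemma exists_measure_ball_ge (hone : Ξ.MemX ∞ (fun _ => 1)) : ∃ c s r₀ : ℝ, 0 < c ∧ 0 < s ∧
    0 < r₀ ∧ ∀ᵐ x ∂Ξ.μ, ∀ r, 0 < r → r ≤ r₀ →
      ENNReal.ofReal (c * r ^ s) ≤ Ξ.μ (Metric.closedBall x r) := by
  have hq := Ξ.q_pos
  -- A polynomial within 1/2 of the constant 1 has modulus at least 1/2 almost everywhere, which
  -- keeps the L¹ mass of the heat kernel away from zero.
  have h2 : ∃ n : ℕ, ∃ P ∈ Ξ.poly n, eLpNorm (fun x => 1 - P x) ∞ Ξ.μ < ENNReal.ofReal 2⁻¹ := by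
    have hpos : (0 : ℝ≥0∞) < ENNReal.ofReal 2⁻¹ := ENNReal.ofReal_pos.2 (by norm_num)
    obtain ⟨n, hn⟩ := (hone.2.eventually_lt_const hpos).exists
    obtain ⟨P, hP⟩ := iInf_lt_iff.1 hn
    obtain ⟨hP1, hP2⟩ := iInf_lt_iff.1 hP
    exact ⟨n, P, hP1, hP2⟩
  obtain ⟨n, P, hP, hPn⟩ := h2
  obtain ⟨S, hS0, hS⟩ := Ξ.exists_abs_poly_le hP
  obtain ⟨κ₁, κ₂, hκ1, hκ2, hheat⟩ := Ξ.exists_lintegral_heat_le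
  set s : ℝ := 3 * Ξ.q / 2 with hs
  set E : ℝ := (S + 1) * κ₁ with hE
  have hE0 : 0 < E := by positivity
  have hlim := tendsto_rpow_mul_exp_neg_mul_atTop_nhds_zero s κ₂ hκ2
  have hsmall : ∀ᶠ v : ℝ in atTop, v ^ s * Real.exp (-κ₂ * v) < (4 * E)⁻¹ :=
    hlim.eventually_lt_const (by positivity)
  obtain ⟨v₀, hv₀⟩ := hsmall.exists_forall_of_atTop
  set v₁ := max v₀ 1 with hv1
  have hv1pos : 1 ≤ v₁ := le_max_right _ _
  refine ⟨(4 * E)⁻¹, s, v₁⁻¹, by positivity, by positivity, by positivity, ?_⟩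
  filter_upwards [ae_le_eLpNormEssSup (f := fun x => 1 - P x) (μ := Ξ.μ)] with x hx r hr hr1
  have hPx : 2⁻¹ ≤ |P x| := by
    rw [← eLpNorm_exponent_top] at hx
    have h3 := hx.trans hPn.le
    rw [Real.enorm_eq_ofReal_abs, ENNReal.ofReal_le_ofReal_iff (by norm_num)] at h3
    have := abs_sub_abs_le_abs_sub 1 (P x)
    rw [abs_one] at this
    linarith
  have hr1' : r ≤ 1 := hr1.trans (inv_le_one_of_one_le₀ hv1pos)
  -- Now `r²/t = 1/r`, so the tail `exp(-κ₂/r)` beats the prefactor `t^(-q/2) = r^(-s)`, `s = 3q/2`,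
  -- and the ball must carry the mass. Any power above 2 would serve, with another `s`.
  set t : ℝ := r ^ 3 with ht
  have ht0 : 0 < t := by positivity
  have ht1 : t ≤ 1 := pow_le_one₀ hr.le hr1'
  have htq : t ^ (-Ξ.q / 2) = (r⁻¹) ^ s := by
    rw [ht, hs, Real.inv_rpow hr.le, ← Real.rpow_neg hr.le, ← Real.rpow_natCast,
      ← Real.rpow_mul hr.le]
    congr 1; push_cast; ring
  have hrt : r ^ 2 / t = r⁻¹ := by rw [ht]; field_simp
  have hmain : ENNReal.ofReal 2⁻¹ ≤ ENNReal.ofReal (E * (r⁻¹) ^ s) *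
      (Ξ.μ (Metric.closedBall x r) + ENNReal.ofReal (Real.exp (-κ₂ * r⁻¹))) := by
    calc _ ≤ ENNReal.ofReal |P x| := ENNReal.ofReal_le_ofReal hPx
      _ ≤ _ := hS t ht0 ht1 x
      _ ≤ ENNReal.ofReal (S + 1) * (ENNReal.ofReal (κ₁ * t ^ (-Ξ.q / 2)) *
          (Ξ.μ (Metric.closedBall x r) + ENNReal.ofReal (Real.exp (-κ₂ * (r ^ 2 / t))))) := by
          gcongr
          · linarith
          · exact hheat t ht0 ht1 x r hr
      _ = _ := by
          rw [htq, hrt, ← mul_assoc, ← ENNReal.ofReal_mul (by positivity), hE, mul_assoc]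
  set m := (Ξ.μ (Metric.closedBall x r)).toReal with hm
  have hmm : Ξ.μ (Metric.closedBall x r) = ENNReal.ofReal m :=
    (ENNReal.ofReal_toReal (measure_ne_top _ _)).symm
  have hm0 : 0 ≤ m := ENNReal.toReal_nonneg
  rw [hmm, ← ENNReal.ofReal_add hm0 (Real.exp_pos _).le, ← ENNReal.ofReal_mul (by positivity),
    ENNReal.ofReal_le_ofReal_iff (by positivity)] at hmain
  have hvr : v₀ ≤ r⁻¹ := (le_max_left _ _).trans ((le_inv_comm₀ hr (by positivity)).1 hr1)
  have hfar := hv₀ _ hvr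
  rw [hmm]
  refine ENNReal.ofReal_le_ofReal ?_
  have hrs : 0 < r⁻¹ ^ s := by positivity
  have h4 : E * (r⁻¹ ^ s * Real.exp (-κ₂ * r⁻¹)) ≤ 4⁻¹ := by
    calc _ ≤ E * (4 * E)⁻¹ := by gcongr
      _ = 4⁻¹ := by field_simp
  have h5 : 4⁻¹ ≤ E * r⁻¹ ^ s * m := by nlinarith
  have h6 : r⁻¹ ^ s = (r ^ s)⁻¹ := Real.inv_rpow hr.le s
  rw [h6] at h5
  have hrs' : 0 < r ^ s := by positivity
  have h7 : E * (r ^ s)⁻¹ * m = E * m / r ^ s := by field_simp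
  rw [h7, le_div_iff₀ hrs'] at h5
  rw [mul_inv, mul_assoc, mul_comm E⁻¹, ← mul_assoc, ← div_eq_mul_inv, div_le_iff₀ hE0]
  linarith

/-- A violation at a support point would persist on an open neighbourhood, which has positive
measure. -/
lemma abs_le_of_mem_support {g : X → ℝ} (hg : Continuous g) {c : ℝ} (h : ∀ᵐ x ∂Ξ.μ, |g x| ≤ c)
    {x : X} (hx : x ∈ Ξ.μ.support) : |g x| ≤ c := by
  by_contra hlt
  have hopen : IsOpen {y | c < |g y|} := isOpen_lt continuous_const hg.abs
  have h0 := (Measure.mem_support_iff_forall x).1 hx _ (hopen.mem_nhds (not_le.1 hlt))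
  refine h0.ne' ?_
  simpa [ae_iff] using h

/-- A conull subset of the support has `ε`-nets of polynomial size. -/
lemma exists_nets (hone : Ξ.MemX ∞ (fun _ => 1)) : ∃ (Z : Set X) (c s r₀ : ℝ), 0 < c ∧ 0 < s ∧
    0 < r₀ ∧ Z ⊆ Ξ.μ.support ∧ (∀ᵐ x ∂Ξ.μ, x ∈ Z) ∧ ∀ ε, 0 < ε → ε ≤ r₀ →
      ∃ N : Finset X, (N : Set X) ⊆ Z ∧ (N.card : ℝ) ≤ c * (ε⁻¹) ^ s ∧
        ∀ x ∈ Z, ∃ z ∈ N, dist x z ≤ ε := by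
  obtain ⟨c, s, r₀, hc, hs, hr₀, hball⟩ := Ξ.exists_measure_ball_ge hone
  set Z : Set X := {x | ∀ r, 0 < r → r ≤ r₀ →
      ENNReal.ofReal (c * r ^ s) ≤ Ξ.μ (Metric.closedBall x r)} ∩ Ξ.μ.support with hZ
  refine ⟨Z, c⁻¹ * 2 ^ s, s, r₀, by positivity, hs, hr₀, Set.inter_subset_right, ?_, fun ε hε hε1 => ?_⟩
  · filter_upwards [hball, Measure.support_mem_ae (μ := Ξ.μ)] with x h1 h2 using ⟨h1, h2⟩
  -- Balls of radius `ε/2` around separated points are disjoint and each has mass at least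
  -- `c(ε/2)^s`, which bounds their number. A separated set of maximal cardinality is then a net.
  · set Sep : Finset X → Prop := fun N => (N : Set X) ⊆ Z ∧
      ∀ x ∈ N, ∀ y ∈ N, x ≠ y → ε < dist x y with hSep
    have hcard : ∀ N, Sep N → (N.card : ℝ) ≤ c⁻¹ * 2 ^ s * (ε⁻¹) ^ s := fun N hN => by
      have hdisj : (N : Set X).PairwiseDisjoint fun x => Metric.closedBall x (ε / 2) :=
        fun x hx y hy hxy => Metric.closedBall_disjoint_closedBall (by
          have := hN.2 x hx y hy hxy; linarith)
      have h1 := measure_biUnion_finset (μ := Ξ.μ) hdisj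
        fun x _ => Metric.isClosed_closedBall.measurableSet
      have h2 : ∑ _x ∈ N, ENNReal.ofReal (c * (ε / 2) ^ s) ≤ 1 := by
        calc _ ≤ ∑ x ∈ N, Ξ.μ (Metric.closedBall x (ε / 2)) :=
              Finset.sum_le_sum fun x hx => (hN.1 hx).1 _ (by positivity) (by linarith)
          _ ≤ 1 := h1 ▸ prob_le_one
      rw [Finset.sum_const, nsmul_eq_mul, ← ENNReal.ofReal_natCast,
        ← ENNReal.ofReal_mul (Nat.cast_nonneg _), ENNReal.ofReal_le_one] at h2
      have h3 : c⁻¹ * 2 ^ s * (ε⁻¹) ^ s = (c * (ε / 2) ^ s)⁻¹ := by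
        rw [mul_inv, ← Real.inv_rpow (by positivity), inv_div, div_eq_mul_inv,
          Real.mul_rpow zero_le_two (by positivity), mul_assoc]
      rw [h3, ← one_div, le_div_iff₀ (by positivity)]
      exact h2
    obtain ⟨m, hm⟩ := exists_nat_ge (c⁻¹ * 2 ^ s * (ε⁻¹) ^ s)
    set T : Set ℕ := {k | ∃ N, Sep N ∧ N.card = k} with hT
    have hTne : T.Nonempty := ⟨0, ∅, ⟨by simp, by simp⟩, rfl⟩
    have hTb : BddAbove T := ⟨m, by
      rintro k ⟨N, hN, rfl⟩
      exact_mod_cast (hcard N hN).trans hm⟩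
    obtain ⟨N, hN, hNc⟩ := Nat.sSup_mem hTne hTb
    refine ⟨N, hN.1, hcard N hN, fun x hx => ?_⟩
    by_contra! hfar
    classical
    have hxN : x ∉ N := fun h => by
      have := hfar x h
      rw [dist_self] at this; linarith
    have hins : Sep (insert x N) := by
      refine ⟨?_, ?_⟩
      · rw [Finset.coe_insert]
        exact Set.insert_subset hx hN.1
      · intro y hy z hz hyz
        rw [Finset.mem_insert] at hy hz
        rcases hy with rfl | hy <;> rcases hz with rfl | hz
        · exact absurd rfl hyz
        · exact hfar z hz
        · rw [dist_comm]; exact hfar y hy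
        · exact hN.2 y hy z hz hyz
    have := le_csSup hTb ⟨_, hins, rfl⟩
    rw [Finset.card_insert_of_notMem hxN, ← hNc] at this
    omega

end Covering

end DataSpace

/-! ### Hoeffding sampling of a signed measure. -/

section Sampling

open ProbabilityTheory

/-- Greedy choice of samples that keeps an exponential potential under control. -/
lemma exists_samples_exp_le {Ω ι : Type*} [MeasurableSpace Ω] [Fintype ι] (P : Measure Ω)
    [IsProbabilityMeasure P] (Z : ι → Ω → ℝ) (hZ : ∀ i, AEMeasurable (Z i) P) {b : ℝ}
    (hb : 0 ≤ b) (hZb : ∀ i ω, |Z i ω| ≤ b) (θ : ℝ) (M : ℕ) :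
    ∃ ω : Fin M → Ω, ∑ i, Real.exp (θ * ∑ j, (Z i (ω j) - ∫ x, Z i x ∂P)) ≤
      Fintype.card ι * Real.exp (M * (b ^ 2 * θ ^ 2 / 2)) := by
  -- Hoeffding's lemma on `[-b, b]`; the variance proxy is `b²`.
  have hsub : ∀ i, HasSubgaussianMGF (fun ω => Z i ω - ∫ x, Z i x ∂P)
      ((‖b - -b‖₊ / 2) ^ 2) P := fun i =>
    hasSubgaussianMGF_of_mem_Icc (hZ i) (ae_of_all _ fun ω => abs_le.1 (hZb i ω))
  have hc : (((‖b - -b‖₊ / 2) ^ 2 : NNReal) : ℝ) = b ^ 2 := by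
    push_cast
    rw [Real.norm_of_nonneg (by linarith)]; ring
  induction M with
  | zero => exact ⟨Fin.elim0, by simp⟩
  | succ M ih =>
    obtain ⟨ω, hω⟩ := ih
    set S : ι → ℝ := fun i => ∑ j, (Z i (ω j) - ∫ x, Z i x ∂P) with hS
    have hint : ∀ i, Integrable (fun x => Real.exp (θ * S i) *
        Real.exp (θ * (Z i x - ∫ x, Z i x ∂P))) P := fun i =>
      ((hsub i).integrable_exp_mul θ).const_mul _
    -- Some point does at least as well as the average. Choosing the samples one at a time makes
    -- product measures and independence unnecessary.
    obtain ⟨x, hx⟩ := exists_le_integral (integrable_finsetSum Finset.univ fun i _ => hint i)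
    refine ⟨Fin.snoc ω x, ?_⟩
    have e : ∀ i, Real.exp (θ * ∑ j, (Z i ((Fin.snoc ω x : Fin (M + 1) → Ω) j) -
        ∫ x, Z i x ∂P)) = Real.exp (θ * S i) * Real.exp (θ * (Z i x - ∫ x, Z i x ∂P)) := fun i => by
      rw [Fin.sum_univ_castSucc, mul_add, Real.exp_add]
      simp [hS]
    simp_rw [e]
    refine hx.trans ?_
    rw [integral_finsetSum _ fun i _ => hint i]
    calc _ ≤ ∑ i, Real.exp (θ * S i) * Real.exp (b ^ 2 * θ ^ 2 / 2) := by
          refine Finset.sum_le_sum fun i _ => ?_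
          rw [integral_const_mul]
          refine mul_le_mul_of_nonneg_left ?_ (Real.exp_pos _).le
          have := (hsub i).mgf_le θ
          rwa [hc] at this
      _ = (∑ i, Real.exp (θ * S i)) * Real.exp (b ^ 2 * θ ^ 2 / 2) := by rw [Finset.sum_mul]
      _ ≤ (Fintype.card ι * Real.exp (M * (b ^ 2 * θ ^ 2 / 2))) *
          Real.exp (b ^ 2 * θ ^ 2 / 2) := by gcongr
      _ = _ := by
          rw [mul_assoc, ← Real.exp_add]
          congr 2; push_cast; ring

/-- Simultaneous approximation of finitely many means by sample means. -/
lemma exists_samples {Ω ι : Type*} [MeasurableSpace Ω] [Fintype ι] (P : Measure Ω)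
    [IsProbabilityMeasure P] (Z : ι → Ω → ℝ) (hZ : ∀ i, AEMeasurable (Z i) P) {b Λ : ℝ}
    (hb : 0 < b) (hZb : ∀ i ω, |Z i ω| ≤ b) (hΛ : 0 < Λ)
    (hcard : 2 * (Fintype.card ι : ℝ) ≤ Real.exp Λ) {M : ℕ} (hM : 0 < M) :
    ∃ ω : Fin M → Ω, ∀ i, |∫ x, Z i x ∂P - (∑ j, Z i (ω j)) / M| ≤ b * Real.sqrt (2 * Λ / M) := by
  have hM0 : (0 : ℝ) < M := by exact_mod_cast hM
  -- With this `θ` the moment factor is `exp Λ`, as large as the bound for the number of signed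
  -- constraints; the potential is at most `exp(2Λ)`, and `2Λ/θ = M b √(2Λ/M)`.
  set θ : ℝ := Real.sqrt (2 * Λ / M) / b with hθ
  have hsq : 0 < Real.sqrt (2 * Λ / M) := Real.sqrt_pos.2 (by positivity)
  have hθ0 : 0 < θ := by positivity
  let σ : Bool → ℝ := fun s => if s then 1 else -1
  -- Each constraint enters with both signs, so that one-sided exponential bounds control absolute
  -- values.
  obtain ⟨ω, hω⟩ := exists_samples_exp_le P (fun (is : ι × Bool) ω => σ is.2 * Z is.1 ω)
    (fun is => (hZ is.1).const_mul _) hb.le (fun is ω => by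
      rw [abs_mul]
      have : |σ is.2| = 1 := by cases is.2 <;> simp [σ]
      rw [this, one_mul]; exact hZb _ _) θ M
  have hbθ : b ^ 2 * θ ^ 2 = 2 * Λ / M := by
    rw [hθ, div_pow, Real.sq_sqrt (by positivity)]; field_simp
  have hexp : (Fintype.card (ι × Bool) : ℝ) * Real.exp (M * (b ^ 2 * θ ^ 2 / 2)) ≤
      Real.exp (2 * Λ) := by
    have : (M : ℝ) * (b ^ 2 * θ ^ 2 / 2) = Λ := by rw [hbθ]; field_simp
    rw [this, two_mul Λ, Real.exp_add]
    refine mul_le_mul_of_nonneg_right ?_ (Real.exp_pos _).le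
    simp only [Fintype.card_prod, Fintype.card_bool]
    push_cast; linarith
  have hone : ∀ i s, σ s * ((∑ j, Z i (ω j)) - M * ∫ x, Z i x ∂P) ≤ 2 * Λ / θ := fun i s => by
    have h1 := (Finset.single_le_sum (f := fun is : ι × Bool =>
      Real.exp (θ * ∑ j, (σ is.2 * Z is.1 (ω j) - ∫ x, σ is.2 * Z is.1 x ∂P)))
      (fun _ _ => (Real.exp_pos _).le) (Finset.mem_univ (i, s))).trans (hω.trans hexp)
    have h2 := Real.exp_le_exp.1 h1
    simp only [integral_const_mul] at h2
    rw [le_div_iff₀ hθ0, mul_comm]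
    refine le_trans (le_of_eq ?_) h2
    congr 1
    rw [Finset.sum_sub_distrib, ← Finset.mul_sum]
    simp only [Finset.sum_const, Finset.card_univ, Fintype.card_fin, nsmul_eq_mul]
    ring
  refine ⟨ω, fun i => ?_⟩
  have hfin : 2 * Λ / θ = M * (b * Real.sqrt (2 * Λ / M)) := by
    have h1 : Real.sqrt (2 * Λ / M) * Real.sqrt (2 * Λ / M) = 2 * Λ / M :=
      Real.mul_self_sqrt (by positivity)
    have h2 : 2 * Λ = M * (2 * Λ / M) := by field_simp
    rw [hθ, div_div_eq_mul_div, div_eq_iff hsq.ne']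
    calc 2 * Λ * b = M * (2 * Λ / M) * b := by rw [← h2]
      _ = M * (Real.sqrt (2 * Λ / M) * Real.sqrt (2 * Λ / M)) * b := by rw [h1]
      _ = _ := by ring
  have h1 := hone i true
  have h2 := hone i false
  simp only [σ, if_true, Bool.false_eq_true, if_false, one_mul, hfin] at h1 h2
  have e : ∫ x, Z i x ∂P - (∑ j, Z i (ω j)) / M =
      (M * ∫ x, Z i x ∂P - ∑ j, Z i (ω j)) / M := by field_simp
  rw [e, abs_div, abs_of_pos hM0, div_le_iff₀ hM0, abs_le]
  constructor <;> linarith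

/-- The probability measure on finitely many copies of `Y` with given densities. -/
lemma exists_measure_of_densities {Y τ : Type*} [MeasurableSpace Y] [Fintype τ]
    [MeasurableSpace τ] [MeasurableSingletonClass τ] (ν : Measure Y) (d : τ → Y → ℝ)
    (hd0 : ∀ t y, 0 ≤ d t y) (hdint : ∀ t, Integrable (d t) ν) (hsum : ∑ t, ∫ y, d t y ∂ν = 1) :
    ∃ P : Measure (τ × Y), IsProbabilityMeasure P ∧ ∀ (Z : τ × Y → ℝ) (b : ℝ),
      (∀ t, AEMeasurable (fun y => Z (t, y)) ν) → (∀ z, |Z z| ≤ b) →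
      AEMeasurable Z P ∧ ∫ z, Z z ∂P = ∑ t, ∫ y, d t y * Z (t, y) ∂ν := by
  let Q : τ → Measure Y := fun t => ν.withDensity fun y => ENNReal.ofReal (d t y)
  have hQfin : ∀ t, IsFiniteMeasure (Q t) := fun t => isFiniteMeasure_withDensity_ofReal (hdint t).2
  have hQint : ∀ t (h : Y → ℝ), ∫ y, h y ∂(Q t) = ∫ y, d t y * h y ∂ν := fun t h => by
    have h1 := integral_withDensity_eq_integral_toReal_smul₀ (μ := ν)
      (f := fun y => ENNReal.ofReal (d t y)) (hdint t).aemeasurable.ennreal_ofReal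
      (ae_of_all _ fun _ => ENNReal.ofReal_lt_top) h
    refine h1.trans (integral_congr_ae (ae_of_all _ fun y => ?_))
    simp only [ENNReal.toReal_ofReal (hd0 t y), smul_eq_mul]
  have hemb : ∀ t : τ, MeasurableEmbedding (Prod.mk t : Y → τ × Y) := fun t =>
    measurableEmbedding_prodMk_left t
  refine ⟨∑ t, (Q t).map (Prod.mk t), ⟨?_⟩, fun Z b hZ hZb => ?_⟩
  · simp only [Measure.coe_finsetSum, Finset.sum_apply]
    have e : ∀ t, (Q t).map (Prod.mk t) Set.univ = ENNReal.ofReal (∫ y, d t y ∂ν) := fun t => by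
      rw [(hemb t).map_apply, Set.preimage_univ, withDensity_apply _ MeasurableSet.univ,
        Measure.restrict_univ,
        ofReal_integral_eq_lintegral_ofReal (hdint t) (ae_of_all _ (hd0 t))]
    simp_rw [e]
    rw [← ENNReal.ofReal_sum_of_nonneg fun t _ => integral_nonneg (hd0 t), hsum,
      ENNReal.ofReal_one]
  · have hZQ : ∀ t, AEMeasurable (fun y => Z (t, y)) (Q t) := fun t =>
      (hZ t).mono_ac (withDensity_absolutelyContinuous _ _)
    constructor
    · rw [← Measure.sum_fintype]
      exact AEMeasurable.sum_measure fun t => (hemb t).aemeasurable_map_iff.2 (hZQ t)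
    · rw [integral_finsetSum_measure]
      · exact Finset.sum_congr rfl fun t _ => by rw [(hemb t).integral_map, hQint]
      · intro t _
        rw [(hemb t).integrable_map_iff]
        exact Integrable.of_bound (hZQ t).aestronglyMeasurable b (ae_of_all _ fun y => hZb (t, y))

/-- Approximation of the integrals against a signed measure of mass at most `W` on a finite union
of copies of a probability space by sums of `M` signed samples. -/
lemma exists_signed_samples {Y ι : Type*} [MeasurableSpace Y] [Fintype ι] (ν : Measure Y)
    [IsProbabilityMeasure ν] (L : Finset ℕ) (hL : L.Nonempty) (g : ℕ → Y → ℝ)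
    (hg : ∀ ℓ, Integrable (g ℓ) ν) {W : ℝ} (hW : 0 ≤ W)
    (hgW : ∑ ℓ ∈ L, ∫ y, |g ℓ y| ∂ν ≤ W) (V : ι → ℕ → Y → ℝ)
    (hV : ∀ i ℓ, AEMeasurable (V i ℓ) ν) {b Λ : ℝ} (hb : 0 < b)
    (hVb : ∀ i, ∀ ℓ ∈ L, ∀ y, |V i ℓ y| ≤ b) (hΛ : 0 < Λ)
    (hcard : 2 * (Fintype.card ι : ℝ) ≤ Real.exp Λ) {M : ℕ} (hM : 0 < M) :
    ∃ (ℓ : Fin M → ℕ) (y : Fin M → Y) (w : Fin M → ℝ), (∀ j, ℓ j ∈ L) ∧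
      (∀ j, w j = 1 ∨ w j = -1) ∧
      ∀ i, |∑ k ∈ L, ∫ y, V i k y * g k y ∂ν - W / M * ∑ j, w j * V i (ℓ j) (y j)| ≤
        W * (b * Real.sqrt (2 * Λ / M)) := by
  obtain ⟨ℓ₀, hℓ₀⟩ := hL
  have hYne : Nonempty Y := nonempty_of_isProbabilityMeasure ν
  rcases hW.eq_or_lt with rfl | hW0
  · have hzero : ∀ k ∈ L, g k =ᵐ[ν] 0 := fun k hk => by
      have h1 : ∫ y, |g k y| ∂ν ≤ 0 := (Finset.single_le_sum
        (f := fun k => ∫ y, |g k y| ∂ν) (fun k _ => integral_nonneg fun _ => abs_nonneg _) hk).trans hgW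
      have h2 := (integral_eq_zero_iff_of_nonneg (fun _ => abs_nonneg _) (hg k).abs).1
        (le_antisymm h1 (integral_nonneg fun _ => abs_nonneg _))
      filter_upwards [h2] with y hy
      simpa using hy
    refine ⟨fun _ => ℓ₀, fun _ => Classical.arbitrary Y, fun _ => 1, fun _ => hℓ₀,
      fun _ => Or.inl rfl, fun i => ?_⟩
    have : ∑ k ∈ L, ∫ y, V i k y * g k y ∂ν = 0 := Finset.sum_eq_zero fun k hk => by
      rw [integral_congr_ae (g := fun _ => 0)]
      · simp
      · filter_upwards [hzero k hk] with y hy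
        rw [hy]; simp
    rw [this]; simp
  set m := ∑ ℓ ∈ L, ∫ y, |g ℓ y| ∂ν with hm
  have hLc : (0 : ℝ) < L.card := by exact_mod_cast Finset.card_pos.2 ⟨ℓ₀, hℓ₀⟩
  -- The normalisation must be exactly `W`, though the mass `m` may be smaller. The excess is spread
  -- evenly over the positive and negative copies, where it cancels in every mean.
  set σ : ℝ := (W - m) / (2 * L.card) with hσ
  have hσ0 : 0 ≤ σ := div_nonneg (by linarith) (by positivity)
  let sg : Bool → ℝ := fun s => if s then 1 else -1
  have hsg : ∀ s, |sg s| = 1 := fun s => by cases s <;> simp [sg]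
  let τ := L × Bool
  -- Positive and negative parts of `g`, one on each signed copy, plus the padding.
  let d : τ → Y → ℝ := fun t y => ((|g t.1 y| + sg t.2 * g t.1 y) / 2 + σ) / W
  have hd0 : ∀ t y, 0 ≤ d t y := fun t y => by
    have : |sg t.2 * g t.1 y| = |g t.1 y| := by rw [abs_mul, hsg, one_mul]
    have := neg_abs_le (sg t.2 * g t.1 y)
    refine div_nonneg (add_nonneg (by linarith) hσ0) hW0.le
  have hdint : ∀ t, Integrable (d t) ν := fun t =>
    (((((hg t.1).abs.add ((hg t.1).const_mul _)).div_const 2).add (integrable_const σ)).div_const W)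
  have hsumd : ∑ t : τ, ∫ y, d t y ∂ν = 1 := by
    have e1 : ∀ t : τ, ∫ y, d t y ∂ν =
        ((∫ y, |g t.1 y| ∂ν + sg t.2 * ∫ y, g t.1 y ∂ν) / 2 + σ) / W := fun t => by
      have h1 : ∫ y, (|g t.1 y| + sg t.2 * g t.1 y) ∂ν =
          ∫ y, |g t.1 y| ∂ν + sg t.2 * ∫ y, g t.1 y ∂ν := by
        rw [integral_add (hg t.1).abs ((hg t.1).const_mul _), integral_const_mul]
      have h2 : ∫ y, ((|g t.1 y| + sg t.2 * g t.1 y) / 2 + σ) ∂ν =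
          (∫ y, (|g t.1 y| + sg t.2 * g t.1 y) ∂ν) / 2 + σ := by
        have h3 : Integrable (fun y => (|g t.1 y| + sg t.2 * g t.1 y) / 2) ν :=
          ((hg t.1).abs.add ((hg t.1).const_mul _)).div_const 2
        rw [integral_add h3 (integrable_const σ), integral_div]
        simp
      simp only [d]
      rw [integral_div, h2, h1]
    simp_rw [e1]
    rw [Fintype.sum_prod_type]
    simp only [Fintype.sum_bool, sg, if_true, Bool.false_eq_true, if_false]
    have e2 : ∀ k : L, ((∫ y, |g k y| ∂ν + 1 * ∫ y, g k y ∂ν) / 2 + σ) / W +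
        ((∫ y, |g k y| ∂ν + -1 * ∫ y, g k y ∂ν) / 2 + σ) / W =
        (∫ y, |g k y| ∂ν) / W + 2 * σ / W := fun k => by ring
    simp_rw [e2]
    rw [Finset.sum_add_distrib, Finset.sum_const, ← Finset.sum_div,
      Finset.sum_coe_sort L (fun k => ∫ y, |g k y| ∂ν), ← hm]
    simp only [Finset.card_univ, Fintype.card_coe, nsmul_eq_mul]
    rw [hσ]
    field_simp
    ring
  obtain ⟨P, hPprob, hP⟩ := exists_measure_of_densities ν d hd0 hdint hsumd
  let Z : ι → τ × Y → ℝ := fun i z => sg z.1.2 * V i z.1.1 z.2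
  have hZm : ∀ i t, AEMeasurable (fun y => Z i (t, y)) ν := fun i t =>
    (hV i t.1).const_mul (sg t.2)
  have hZb : ∀ i z, |Z i z| ≤ b := fun i z => by
    simp only [Z]
    rw [abs_mul, hsg, one_mul]
    exact hVb i _ z.1.1.2 _
  have hmean : ∀ i, W * ∫ z, Z i z ∂P = ∑ k ∈ L, ∫ y, V i k y * g k y ∂ν := fun i => by
    rw [(hP _ b (hZm i) (hZb i)).2]
    have hVi : ∀ (k : L) (h : Y → ℝ), Integrable h ν → Integrable (fun y => h y * V i k y) ν :=
      fun k h hh => hh.mul_bdd (c := b) (hV i k).aestronglyMeasurable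
        (ae_of_all _ fun y => hVb i k k.2 y)
    rw [Fintype.sum_prod_type, Finset.mul_sum, ← Finset.sum_coe_sort L]
    refine Finset.sum_congr rfl fun k _ => ?_
    have h1 : ∀ s, ∫ y, d (k, s) y * Z i ((k, s), y) ∂ν = sg s * ∫ y, d (k, s) y * V i k y ∂ν :=
      fun s => by
        rw [← integral_const_mul]
        congr 1; ext y
        simp only [Z]; ring
    rw [Fintype.sum_bool, h1, h1]
    simp only [sg, if_true, Bool.false_eq_true, if_false]
    rw [one_mul, neg_one_mul, ← sub_eq_add_neg, ← integral_sub (hVi k _ (hdint (k, true)))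
      (hVi k _ (hdint (k, false))), ← integral_const_mul]
    congr 1; ext y
    simp only [d, sg, if_true, Bool.false_eq_true, if_false]
    field_simp
    ring
  obtain ⟨ω, hω⟩ := exists_samples P Z (fun i => (hP _ b (hZm i) (hZb i)).1) hb hZb hΛ hcard hM
  refine ⟨fun j => (ω j).1.1, fun j => (ω j).2, fun j => sg (ω j).1.2, fun j => (ω j).1.1.2,
    fun j => ?_, fun i => ?_⟩
  · have hs : ∀ s, sg s = 1 ∨ sg s = -1 := fun s => by cases s <;> simp [sg]
    exact hs _
  · have h1 := mul_le_mul_of_nonneg_left (hω i) hW0.le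
    rw [← hmean i]
    refine le_trans (le_of_eq ?_) h1
    rw [← abs_of_pos hW0, ← abs_mul, abs_of_pos hW0]
    congr 1
    simp only [Z]; ring

end Sampling

/-! ### Choice of the truncation level and of the mesh. -/

section Scale

/-- Rounding upwards by `⌊·⌋ + 1` keeps `n ≥ 1`, as the mass bound requires, at the price of a
factor 2. -/
lemma exists_level (v d : ℝ) (hv : 0 < v) : ∃ n : ℕ, 1 ≤ n ∧
    v ^ (-1 / d) ≤ (2 : ℝ) ^ n ∧ (2 : ℝ) ^ n ≤ 2 * max 1 (v ^ (-1 / d)) := by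
  set x := v ^ (-1 / d) with hx
  have hx0 : 0 < x := by positivity
  have hlog : (2 : ℝ) ^ Real.logb 2 x = x := Real.rpow_logb two_pos (by norm_num) hx0
  refine ⟨⌊Real.logb 2 x⌋₊ + 1, by omega, ?_, ?_⟩
  · nth_rw 1 [← hlog]
    rw [← Real.rpow_natCast]
    refine Real.rpow_le_rpow_of_exponent_le one_le_two ?_
    push_cast
    exact (Nat.lt_floor_add_one _).le
  · rw [pow_succ, mul_comm]
    refine mul_le_mul_of_nonneg_left ?_ zero_le_two
    rcases le_total 0 (Real.logb 2 x) with h | h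
    · refine le_max_of_le_right ?_
      nth_rw 2 [← hlog]
      rw [← Real.rpow_natCast]
      exact Real.rpow_le_rpow_of_exponent_le one_le_two (Nat.floor_le h)
    · rw [Nat.floor_of_nonpos h, pow_zero]
      exact le_max_left _ _

/-- With `x = v^(-1/d)` and `d = 2(E + gs)` one has `√v = x^(-(E+gs))`, so at `2^n ≈ x` the sampling
error `x^E √v` equals `x^(-gs)`. Here `gs` belongs to the smallest exponent of an operator; for `x ≥
1` the others only have a larger truncation error `x^(-g)`. -/
lemma level_rate {v d E gs : ℝ} (hv : 0 < v) (hv27 : v ≤ 27) (hE : 0 ≤ E) (hgs : 0 < gs)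
    (hd : d = 2 * (E + gs)) {n : ℕ} (h1 : v ^ (-1 / d) ≤ (2 : ℝ) ^ n)
    (h2 : (2 : ℝ) ^ n ≤ 2 * max 1 (v ^ (-1 / d))) {g : ℝ} (hg : 0 < g) (hgg : g ≤ gs) :
    ((2 : ℝ) ^ n) ^ (-g) ≤ v ^ (g / d) ∧
      ((2 : ℝ) ^ n) ^ E * Real.sqrt v ≤ 2 ^ E * 6 * v ^ (g / d) := by
  have hd0 : 0 < d := by rw [hd]; positivity
  set x := v ^ (-1 / d) with hx
  have hx0 : 0 < x := by positivity
  have e1 : v ^ (g / d) = x ^ (-g) := by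
    rw [hx, ← Real.rpow_mul hv.le]; congr 1; ring
  have e2 : Real.sqrt v = x ^ (-(E + gs)) := by
    rw [hx, ← Real.rpow_mul hv.le, Real.sqrt_eq_rpow]
    congr 1
    rw [hd]; field_simp
  rw [e1]
  refine ⟨Real.rpow_le_rpow_of_nonpos hx0 h1 (by linarith), ?_⟩
  rcases le_total 1 x with hx1 | hx1
  · rw [max_eq_right hx1] at h2
    calc _ ≤ (2 * x) ^ E * Real.sqrt v := by gcongr
      _ = 2 ^ E * (x ^ E * x ^ (-(E + gs))) := by
          rw [Real.mul_rpow zero_le_two hx0.le, e2, mul_assoc]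
      _ = 2 ^ E * x ^ (-gs) := by
          rw [← Real.rpow_add hx0]; congr 2; ring
      _ ≤ 2 ^ E * (6 * x ^ (-g)) := by
          gcongr
          refine (Real.rpow_le_rpow_of_exponent_le hx1 (neg_le_neg hgg)).trans ?_
          have : 0 < x ^ (-g) := by positivity
          linarith
      _ = _ := by ring
  -- For `x ≤ 1` the level is bounded, the target `x^(-g)` is at least one, and `√27 ≤ 6`.
  · rw [max_eq_left hx1, mul_one] at h2
    have h3 : 1 ≤ x ^ (-g) := Real.one_le_rpow_of_pos_of_le_one_of_nonpos hx0 hx1 (by linarith)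
    have h4 : Real.sqrt v ≤ 6 := by
      rw [Real.sqrt_le_left (by norm_num)]; linarith
    calc _ ≤ (2 : ℝ) ^ E * 6 := by gcongr
      _ ≤ _ := le_mul_of_one_le_right (by positivity) h3

lemma half_le_log_of_two_le {M : ℕ} (hM : 2 ≤ M) : 1 / 2 ≤ Real.log M := by
  have h1 : Real.log 2 ≤ Real.log M :=
    Real.log_le_log two_pos (by exact_mod_cast hM)
  linarith [Real.log_two_gt_d9]

lemma log_pow_three_div_le {M : ℕ} (hM : 2 ≤ M) : Real.log M ^ 3 / M ≤ 27 := by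
  have hM0 : (0 : ℝ) < M := by exact_mod_cast (by omega : 0 < M)
  have hl := half_le_log_of_two_le hM
  have h1 : Real.log M ≤ 3 * (M : ℝ) ^ (1 / 3 : ℝ) := by
    have h2 := Real.log_le_self (x := (M : ℝ) ^ (1 / 3 : ℝ)) (by positivity)
    rw [Real.log_rpow hM0] at h2
    linarith
  rw [div_le_iff₀ hM0]
  calc Real.log M ^ 3 ≤ (3 * (M : ℝ) ^ (1 / 3 : ℝ)) ^ 3 := by gcongr
    _ = 27 * (M : ℝ) := by
        rw [mul_pow, ← Real.rpow_natCast, ← Real.rpow_natCast, ← Real.rpow_mul hM0.le]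
        norm_num

/-- The choice of the truncation level. -/
lemma exists_scale {q β γ A aMin : ℝ} (hA : 0 ≤ A) (ha : aMin < γ) :
    ∃ C σ : ℝ, 0 < C ∧ 0 < σ ∧ ∀ M : ℕ, 2 ≤ M → ∃ n : ℕ, 1 ≤ n ∧ (2 : ℝ) ^ n ≤ C * (M : ℝ) ^ σ ∧
      ∀ a, aMin ≤ a → a < γ →
        (2 : ℝ) ^ ((n : ℝ) * (a - γ)) ≤ eignetRate q β γ A aMin a M ∧
        eignetScale q β γ n * (2 : ℝ) ^ ((n : ℝ) * A) * Real.sqrt (Real.log M / M) ≤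
          C * eignetRate q β γ A aMin a M := by
  -- The lower bound `1/(8M)` fits both `log M / M` and `(log M)³ / M`, since `log M ≥ 1/2`. It
  -- yields `2^n ≲ M^(1/d)`.
  have hbase : ∀ (d : ℝ), 0 < d → ∀ (M : ℕ), 2 ≤ M → ∀ v : ℝ, 0 < v → 1 / (8 * M) ≤ v →
      2 * max 1 (v ^ (-1 / d)) ≤ 2 * (8 : ℝ) ^ (1 / d) * (M : ℝ) ^ (1 / d) := by
    intro d hd M hM v hv hvM
    have hM1 : (1 : ℝ) ≤ M := by exact_mod_cast (by omega : 1 ≤ M)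
    have e : (2 : ℝ) * 8 ^ (1 / d) * (M : ℝ) ^ (1 / d) = 2 * (8 * M) ^ (1 / d) := by
      rw [Real.mul_rpow (by norm_num) (by linarith), mul_assoc]
    rw [e]
    refine mul_le_mul_of_nonneg_left (max_le ?_ ?_) zero_le_two
    · exact Real.one_le_rpow (by linarith) (by positivity)
    · rw [neg_div, Real.rpow_neg hv.le, ← Real.inv_rpow hv.le]
      refine Real.rpow_le_rpow (by positivity) ?_ (by positivity)
      rw [inv_le_comm₀ hv (by positivity), ← one_div]
      exact hvM
  have hpow : ∀ (n : ℕ) (z : ℝ), (2 : ℝ) ^ ((n : ℝ) * z) = ((2 : ℝ) ^ n) ^ z := fun n z => by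
    rw [Real.rpow_mul zero_le_two, Real.rpow_natCast]
  have hv1 : ∀ M : ℕ, 2 ≤ M → 0 < Real.log M / M ∧ Real.log M / M ≤ 27 ∧
      1 / (8 * M) ≤ Real.log M / M := fun M hM => by
    have hM0 : (0 : ℝ) < M := by exact_mod_cast (by omega : 0 < M)
    have hl := half_le_log_of_two_le hM
    refine ⟨by positivity, ?_, ?_⟩
    · rw [div_le_iff₀ hM0]
      linarith [Real.log_le_self hM0.le]
    · rw [one_div, mul_inv, div_eq_mul_inv]
      gcongr
      linarith
  rcases lt_trichotomy γ (q / 2 + β) with h | h | h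
  · set d := q + 2 * β + 2 * A - 2 * aMin with hd
    set E := (q / 2 + β - γ) + A with hE
    have hd0 : 0 < d := by linarith
    refine ⟨max (2 * (8 : ℝ) ^ (1 / d)) (2 ^ E * 6), 1 / d, by positivity, by positivity,
      fun M hM => ?_⟩
    obtain ⟨hv0, hv27, hv8⟩ := hv1 M hM
    obtain ⟨n, hn1, hn2, hn3⟩ := exists_level (Real.log M / M) d hv0
    refine ⟨n, hn1, (hn3.trans (hbase d hd0 M hM _ hv0 hv8)).trans ?_, fun a haa haγ => ?_⟩
    · gcongr; exact le_max_left _ _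
    · obtain ⟨r1, r2⟩ := level_rate hv0 hv27 (E := E) (gs := γ - aMin) (by linarith) (by linarith)
        (by rw [hd, hE]; ring) hn2 hn3 (g := γ - a) (by linarith) (by linarith)
      simp only [eignetRate, eignetScale, if_pos h]
      refine ⟨by rw [hpow, ← neg_sub γ a]; exact r1, ?_⟩
      rw [hpow, hpow, ← Real.rpow_add (by positivity), ← hE]
      refine r2.trans ?_
      gcongr; exact le_max_right _ _
  · set d := 2 * A + 2 * γ - 2 * aMin with hd
    have hd0 : 0 < d := by linarith
    -- Logarithms of the bound for `2^n`, with `1 ≤ 2 log M` absorbing the constant, give `n ≤ K log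
    -- M`. This is the extra `log M` of `T_n = n`, whose square makes the cube in the critical rate.
    set K := (Real.log (2 * (8 : ℝ) ^ (1 / d)) * 2 + 1 / d) / Real.log 2 with hK
    have h8 : (1 : ℝ) ≤ 2 * (8 : ℝ) ^ (1 / d) := by
      have : (1 : ℝ) ≤ (8 : ℝ) ^ (1 / d) := Real.one_le_rpow (by norm_num) (by positivity)
      linarith
    have hl8 : 0 ≤ Real.log (2 * (8 : ℝ) ^ (1 / d)) := Real.log_nonneg h8
    have hl2 : 0 < Real.log 2 := Real.log_pos one_lt_two
    have hK0 : 0 < K := by positivity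
    refine ⟨max (2 * (8 : ℝ) ^ (1 / d)) (K * (2 ^ A * 6)), 1 / d, by positivity, by positivity,
      fun M hM => ?_⟩
    have hM0 : (0 : ℝ) < M := by exact_mod_cast (by omega : 0 < M)
    have hl := half_le_log_of_two_le hM
    have hl0 : 0 < Real.log M := by linarith
    have hv0 : 0 < Real.log M ^ 3 / M := by positivity
    have hv27 := log_pow_three_div_le hM
    have hv8 : 1 / (8 * M) ≤ Real.log M ^ 3 / M := by
      rw [one_div, mul_inv, div_eq_mul_inv]
      gcongr
      calc (8 : ℝ)⁻¹ = (1 / 2) ^ 3 := by norm_num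
        _ ≤ _ := by gcongr
    obtain ⟨n, hn1, hn2, hn3⟩ := exists_level (Real.log M ^ 3 / M) d hv0
    have hnM := hn3.trans (hbase d hd0 M hM _ hv0 hv8)
    have hnlog : (n : ℝ) ≤ K * Real.log M := by
      have h3 := Real.log_le_log (by positivity) hnM
      rw [Real.log_pow, Real.log_mul (by positivity) (by positivity), Real.log_rpow hM0] at h3
      rw [hK, div_mul_eq_mul_div, le_div_iff₀ hl2]
      nlinarith
    refine ⟨n, hn1, hnM.trans ?_, fun a haa haγ => ?_⟩
    · gcongr; exact le_max_left _ _
    · obtain ⟨r1, r2⟩ := level_rate hv0 hv27 (E := A) (gs := γ - aMin) hA (by linarith)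
        (by rw [hd]; ring) hn2 hn3 (g := γ - a) (by linarith) (by linarith)
      have hlt : ¬ γ < q / 2 + β := by linarith
      simp only [eignetRate, eignetScale, if_neg hlt, if_pos h]
      refine ⟨by rw [hpow, ← neg_sub γ a]; exact r1, ?_⟩
      have e : Real.sqrt (Real.log M ^ 3 / M) = Real.log M * Real.sqrt (Real.log M / M) := by
        rw [show Real.log M ^ 3 / M = Real.log M ^ 2 * (Real.log M / M) by ring,
          Real.sqrt_mul (sq_nonneg _), Real.sqrt_sq hl0.le]
      calc _ ≤ K * Real.log M * (2 : ℝ) ^ ((n : ℝ) * A) * Real.sqrt (Real.log M / M) := by gcongr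
        _ = K * (((2 : ℝ) ^ n) ^ A * Real.sqrt (Real.log M ^ 3 / M)) := by rw [e, hpow]; ring
        _ ≤ K * (2 ^ A * 6 * (Real.log M ^ 3 / M) ^ ((γ - a) / d)) := by gcongr
        _ = K * (2 ^ A * 6) * (Real.log M ^ 3 / M) ^ ((γ - a) / d) := by ring
        _ ≤ _ := by gcongr; exact le_max_right _ _
  · set d := 2 * A + 2 * γ - 2 * aMin with hd
    have hd0 : 0 < d := by linarith
    refine ⟨max (2 * (8 : ℝ) ^ (1 / d)) (2 ^ A * 6), 1 / d, by positivity, by positivity,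
      fun M hM => ?_⟩
    obtain ⟨hv0, hv27, hv8⟩ := hv1 M hM
    obtain ⟨n, hn1, hn2, hn3⟩ := exists_level (Real.log M / M) d hv0
    refine ⟨n, hn1, (hn3.trans (hbase d hd0 M hM _ hv0 hv8)).trans ?_, fun a haa haγ => ?_⟩
    · gcongr; exact le_max_left _ _
    · obtain ⟨r1, r2⟩ := level_rate hv0 hv27 (E := A) (gs := γ - aMin) hA (by linarith)
        (by rw [hd]; ring) hn2 hn3 (g := γ - a) (by linarith) (by linarith)
      simp only [eignetRate, eignetScale, if_neg h.not_gt, if_neg h.ne']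
      refine ⟨by rw [hpow, ← neg_sub γ a]; exact r1, ?_⟩
      rw [one_mul, hpow]
      refine r2.trans ?_
      gcongr; exact le_max_right _ _

/-- The choice of the mesh size and of the logarithm of the number of constraints. -/
lemma exists_mesh {C₀ σ c s r₀ α A B J : ℝ} (hC₀ : 0 < C₀) (hσ : 0 < σ) (hs : 0 < s)
    (hr₀ : 0 < r₀) (hα : 0 < α) (hA : 0 ≤ A) :
    ∃ K C : ℝ, 0 < K ∧ 0 < C ∧ ∀ (M n : ℕ), 2 ≤ M → (2 : ℝ) ^ n ≤ C₀ * (M : ℝ) ^ σ →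
      ∃ ε, 0 < ε ∧ ε ≤ r₀ ∧ 2 * (J * (c * ε⁻¹ ^ s)) ≤ Real.exp (K * Real.log M) ∧
        (2 : ℝ) ^ ((n : ℝ) * B) * ε ^ α ≤
          C * ((2 : ℝ) ^ ((n : ℝ) * A) * Real.sqrt (Real.log M / M)) := by
  -- For `ε = r₀ M^(-τ)` the Hölder error `2^(nB) ε^α` is of order `M^(-1/2)`, whatever the sign of
  -- `B`.
  set τ : ℝ := (σ * |B| + 1 / 2) / α with hτ
  have hτ0 : 0 < τ := by positivity
  -- The constant in the number of constraints is absorbed into a power of `M`: as `M ≥ 2`, `H ≤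
  -- M^(log H / log 2)`.
  set H : ℝ := max 1 (2 * J * c * (r₀⁻¹) ^ s) with hH
  have hH1 : 1 ≤ H := le_max_left _ _
  have hl2 : 0 < Real.log 2 := Real.log_pos one_lt_two
  refine ⟨τ * s + Real.log H / Real.log 2, 2 * (C₀ ^ |B| * r₀ ^ α),
    by have := Real.log_nonneg hH1; positivity, by positivity, fun M n hM hn => ?_⟩
  have hM0 : (0 : ℝ) < M := by exact_mod_cast (by omega : 0 < M)
  have hM1 : (1 : ℝ) ≤ M := by exact_mod_cast (by omega : 1 ≤ M)
  have hM2 : (2 : ℝ) ≤ M := by exact_mod_cast hM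
  have hl := half_le_log_of_two_le hM
  have hlM : 0 < Real.log M := by linarith
  refine ⟨r₀ * (M : ℝ) ^ (-τ), by positivity, ?_, ?_, ?_⟩
  · exact mul_le_of_le_one_right hr₀.le (Real.rpow_le_one_of_one_le_of_nonpos hM1 (by linarith))
  · have e1 : (r₀ * (M : ℝ) ^ (-τ))⁻¹ ^ s = r₀⁻¹ ^ s * (M : ℝ) ^ (τ * s) := by
      rw [mul_inv, ← Real.rpow_neg hM0.le, neg_neg, Real.mul_rpow (by positivity) (by positivity),
        ← Real.rpow_mul hM0.le]
    have e2 : Real.exp ((τ * s + Real.log H / Real.log 2) * Real.log M) =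
        Real.exp (Real.log H / Real.log 2 * Real.log M) * (M : ℝ) ^ (τ * s) := by
      rw [Real.rpow_def_of_pos hM0, ← Real.exp_add]; ring_nf
    rw [e1, e2]
    have h1 : H ≤ Real.exp (Real.log H / Real.log 2 * Real.log M) := by
      nth_rw 1 [← Real.exp_log (by linarith : 0 < H)]
      refine Real.exp_le_exp.2 ?_
      rw [div_mul_eq_mul_div, le_div_iff₀ hl2]
      exact mul_le_mul_of_nonneg_left (Real.log_le_log two_pos hM2) (Real.log_nonneg hH1)
    calc _ = 2 * J * c * r₀⁻¹ ^ s * (M : ℝ) ^ (τ * s) := by ring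
      _ ≤ _ := by
          refine mul_le_mul_of_nonneg_right ((le_max_right _ _).trans h1) (by positivity)
  · have h1 : (2 : ℝ) ^ ((n : ℝ) * B) ≤ C₀ ^ |B| * (M : ℝ) ^ (σ * |B|) := by
      calc (2 : ℝ) ^ ((n : ℝ) * B) ≤ (2 : ℝ) ^ ((n : ℝ) * |B|) :=
            Real.rpow_le_rpow_of_exponent_le one_le_two (by
              gcongr; exact le_abs_self B)
        _ = ((2 : ℝ) ^ n) ^ |B| := by rw [Real.rpow_mul zero_le_two, Real.rpow_natCast]
        _ ≤ (C₀ * (M : ℝ) ^ σ) ^ |B| := by gcongr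
        _ = _ := by
            rw [Real.mul_rpow hC₀.le (by positivity), ← Real.rpow_mul hM0.le]
    have h2 : (r₀ * (M : ℝ) ^ (-τ)) ^ α = r₀ ^ α * (M : ℝ) ^ (-(σ * |B| + 1 / 2)) := by
      rw [Real.mul_rpow hr₀.le (by positivity), ← Real.rpow_mul hM0.le]
      congr 2
      rw [hτ]; field_simp
    have h3 : (M : ℝ) ^ (σ * |B|) * (M : ℝ) ^ (-(σ * |B| + 1 / 2)) ≤
        2 * Real.sqrt (Real.log M / M) := by
      rw [← Real.rpow_add hM0, show σ * |B| + -(σ * |B| + 1 / 2) = -(1 / 2) by ring,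
        Real.rpow_neg hM0.le, ← Real.sqrt_eq_rpow, ← Real.sqrt_inv]
      rw [show (2 : ℝ) * Real.sqrt (Real.log M / M) = Real.sqrt (4 * (Real.log M / M)) by
        rw [Real.sqrt_mul (by norm_num), show (4 : ℝ) = 2 ^ 2 by norm_num,
          Real.sqrt_sq zero_le_two]]
      refine Real.sqrt_le_sqrt ?_
      rw [inv_eq_one_div, ← mul_div_assoc]
      gcongr
      linarith
    have h4 : 1 ≤ (2 : ℝ) ^ ((n : ℝ) * A) := Real.one_le_rpow one_le_two (by positivity)
    rw [h2]
    calc _ ≤ (C₀ ^ |B| * (M : ℝ) ^ (σ * |B|)) *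
          (r₀ ^ α * (M : ℝ) ^ (-(σ * |B| + 1 / 2))) := by gcongr
      _ = C₀ ^ |B| * r₀ ^ α * ((M : ℝ) ^ (σ * |B|) * (M : ℝ) ^ (-(σ * |B| + 1 / 2))) := by ring
      _ ≤ C₀ ^ |B| * r₀ ^ α * (2 * (1 * Real.sqrt (Real.log M / M))) := by
          exact mul_le_mul_of_nonneg_left (by rwa [one_mul]) (by positivity)
      _ ≤ C₀ ^ |B| * r₀ ^ α * (2 * ((2 : ℝ) ^ ((n : ℝ) * A) * Real.sqrt (Real.log M / M))) := by
          gcongr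
      _ = _ := by ring

end Scale

/-! ### From net points to a conull set. -/

/-- Approximation by signed samples, uniformly on a set with a finite net, for families of Hölder
functions. -/
lemma exists_uniform_signed_samples {X Y κ : Type*} [MetricSpace X] [MeasurableSpace Y]
    [Fintype κ] (ν : Measure Y) [IsProbabilityMeasure ν] (L : Finset ℕ) (hL : L.Nonempty)
    (g : ℕ → Y → ℝ) (hg : ∀ ℓ, Integrable (g ℓ) ν) {W : ℝ} (hW : 0 ≤ W)
    (hgW : ∑ ℓ ∈ L, ∫ y, |g ℓ y| ∂ν ≤ W) (V : κ → ℕ → X → Y → ℝ)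
    (hV : ∀ k ℓ x, AEMeasurable (V k ℓ x) ν) {Z : Set X} {b h ε α Λ : ℝ} (hb : 0 < b)
    (hh : 0 ≤ h) (hα : 0 < α)
    (hVb : ∀ k, ∀ ℓ ∈ L, ∀ x ∈ Z, ∀ y, |V k ℓ x y| ≤ b)
    (hVh : ∀ k, ∀ ℓ ∈ L, ∀ x x' y, |V k ℓ x y - V k ℓ x' y| ≤ h * dist x x' ^ α)
    (N : Finset X) (hN : (N : Set X) ⊆ Z) (hNet : ∀ x ∈ Z, ∃ z ∈ N, dist x z ≤ ε)
    (hΛ : 0 < Λ) (hcard : 2 * ((Fintype.card κ : ℝ) * N.card) ≤ Real.exp Λ)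
    {M : ℕ} (hM : 0 < M) :
    ∃ (ℓ : Fin M → ℕ) (y : Fin M → Y) (w : Fin M → ℝ), (∀ j, w j = 1 ∨ w j = -1) ∧
      ∀ k, ∀ x ∈ Z, |∑ i ∈ L, ∫ y, V k i x y * g i y ∂ν - W / M * ∑ j, w j * V k (ℓ j) x (y j)| ≤
        W * (b * Real.sqrt (2 * Λ / M)) + 2 * (W * (h * ε ^ α)) := by
  have hM0 : (0 : ℝ) < M := by exact_mod_cast hM
  -- Constraints are indexed by pairs of an operator and a net point, so one sample serves all
  -- operators. The Hölder error is paid twice, for the integral and for the sum.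
  obtain ⟨ℓ, y, w, hℓ, hw, hest⟩ := exists_signed_samples (ι := κ × N) ν L hL g hg hW hgW
    (fun i ℓ y => V i.1 ℓ i.2 y) (fun i ℓ => hV i.1 ℓ i.2) hb
    (fun i ℓ hℓ y => hVb i.1 ℓ hℓ i.2 (hN i.2.2) y) hΛ (by simpa using hcard) hM
  refine ⟨ℓ, y, w, hw, fun k x hx => ?_⟩
  obtain ⟨z, hz, hxz⟩ := hNet x hx
  have hhol : ∀ i ∈ L, ∀ y, |V k i x y - V k i z y| ≤ h * ε ^ α := fun i hi y =>
    (hVh k i hi x z y).trans (by gcongr)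
  have hc0 : 0 ≤ h * ε ^ α := (abs_nonneg _).trans
    (hhol _ hL.choose_spec (nonempty_of_isProbabilityMeasure ν).some)
  have hVi : ∀ i ∈ L, ∀ x ∈ Z, Integrable (fun y => V k i x y * g i y) ν := fun i hi x hx =>
    (hg i).bdd_mul (c := b) (hV k i x).aestronglyMeasurable (ae_of_all _ fun y => hVb k i hi x hx y)
  have h1 : |∑ i ∈ L, ∫ y, V k i x y * g i y ∂ν - ∑ i ∈ L, ∫ y, V k i z y * g i y ∂ν| ≤
      W * (h * ε ^ α) := by
    rw [← Finset.sum_sub_distrib]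
    calc _ ≤ ∑ i ∈ L, (h * ε ^ α) * ∫ y, |g i y| ∂ν := by
          refine (Finset.abs_sum_le_sum_abs _ _).trans (Finset.sum_le_sum fun i hi => ?_)
          rw [← integral_sub (hVi i hi x hx) (hVi i hi z (hN hz)), ← integral_const_mul]
          refine (abs_integral_le_integral_abs).trans (integral_mono
            ((hVi i hi x hx).sub (hVi i hi z (hN hz))).abs ((hg i).abs.const_mul _) fun y => ?_)
          simp only
          rw [← sub_mul, abs_mul]
          exact mul_le_mul_of_nonneg_right (hhol i hi y) (abs_nonneg _)
      _ ≤ _ := by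
          rw [← Finset.mul_sum, mul_comm]
          exact mul_le_mul_of_nonneg_right hgW hc0
  have h2 : |W / M * ∑ j, w j * V k (ℓ j) x (y j) - W / M * ∑ j, w j * V k (ℓ j) z (y j)| ≤
      W * (h * ε ^ α) := by
    rw [← mul_sub, ← Finset.sum_sub_distrib, abs_mul, abs_of_nonneg (by positivity)]
    have h3 : |∑ j, (w j * V k (ℓ j) x (y j) - w j * V k (ℓ j) z (y j))| ≤ M * (h * ε ^ α) := by
      refine (Finset.abs_sum_le_sum_abs _ _).trans ?_
      calc _ ≤ ∑ _j : Fin M, h * ε ^ α := by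
            refine Finset.sum_le_sum fun j _ => ?_
            rw [← mul_sub, abs_mul]
            have : |w j| = 1 := by rcases hw j with h | h <;> simp [h]
            rw [this, one_mul]
            exact hhol _ (hℓ j) _
        _ = _ := by simp
    calc _ ≤ W / M * (M * (h * ε ^ α)) := by gcongr
      _ = _ := by field_simp
  have h3 := hest (k, ⟨z, hz⟩)
  simp only at h3
  rw [abs_le] at *
  constructor <;> linarith

lemma continuous_of_holder {X : Type*} [PseudoMetricSpace X] {α : ℝ} {g : X → ℝ} {h : ℝ} (hα : 0 < α)
    (hg : ∀ x x', |g x - g x'| ≤ h * dist x x' ^ α) : Continuous g := by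
  refine continuous_iff_continuousAt.2 fun x => ?_
  rw [ContinuousAt, tendsto_iff_dist_tendsto_zero]
  refine squeeze_zero (fun _ => dist_nonneg) (fun y => (Real.dist_eq _ _).trans_le (hg y x)) ?_
  have h1 : Tendsto (fun y => dist y x) (𝓝 x) (𝓝 0) := tendsto_iff_dist_tendsto_zero.1 tendsto_id
  have h2 := (h1.rpow_const (Or.inr hα.le)).const_mul h
  rwa [Real.zero_rpow hα.ne', mul_zero] at h2

namespace DataSpace

/-! ### Pointwise consequences of the growth hypotheses. -/

section Main

variable {X : Type*} [MetricSpace X] [CompactSpace X] [MeasurableSpace X] [BorelSpace X]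
  {Ξ : DataSpace X}

lemma abs_sub_le_of_lipNorm_le {α : ℝ} {g : X → ℝ} {h : ℝ} (hh : 0 ≤ h)
    (hg : Ξ.lipNorm α g ≤ ENNReal.ofReal h) (x x' : X) :
    |g x - g x'| ≤ h * dist x x' ^ α := by
  rcases eq_or_ne x x' with rfl | hne
  · rw [sub_self, abs_zero]; positivity
  · have h1 : ENNReal.ofReal (|g x - g x'| / dist x x' ^ α) ≤ ENNReal.ofReal h := by
      refine le_trans ?_ hg
      refine le_trans ?_ le_add_self
      exact le_iSup_of_le x (le_iSup_of_le x' (le_iSup_of_le hne le_rfl))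
    rw [ENNReal.ofReal_le_ofReal_iff hh] at h1
    have := dist_pos.2 hne
    rwa [div_le_iff₀ (by positivity)] at h1

variable {Y : Type*} {J : ℕ}

lemma lipNorm_le_supL {α : ℝ} (UG : Fin J → ℕ → X → Y → ℝ) {n ℓ : ℕ} (hℓ : Ξ.eig ℓ < 2 ^ n)
    (y : Y) (k : Fin J) : Ξ.lipNorm α (fun x => UG k ℓ x y) ≤ Ξ.supL α UG n :=
  le_iSup_of_le ℓ (le_iSup_of_le hℓ (le_iSup_of_le y (le_iSup_of_le k le_rfl)))

lemma eLpNorm_le_supG (UG : Fin J → ℕ → X → Y → ℝ) {n ℓ : ℕ} (hℓ : Ξ.eig ℓ < 2 ^ n)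
    (y : Y) (k : Fin J) : eLpNorm (fun x => UG k ℓ x y) ∞ Ξ.μ ≤ Ξ.supG UG n :=
  le_iSup_of_le ℓ (le_iSup_of_le hℓ (le_iSup_of_le y (le_iSup_of_le k le_rfl)))

lemma abs_le_of_eLpNorm_top_le {g : X → ℝ} (hg : Continuous g) {b : ℝ} (hb : 0 ≤ b)
    (h : eLpNorm g ∞ Ξ.μ ≤ ENNReal.ofReal b) {x : X} (hx : x ∈ Ξ.μ.support) : |g x| ≤ b := by
  refine Ξ.abs_le_of_mem_support hg ?_ hx
  filter_upwards [ae_le_eLpNormEssSup (f := g) (μ := Ξ.μ)] with z hz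
  rw [← eLpNorm_exponent_top] at hz
  have := hz.trans h
  rwa [Real.enorm_eq_ofReal_abs, ENNReal.ofReal_le_ofReal_iff hb] at this

/-- If the kernels grow at a negative rate, they vanish. -/
lemma eq_zero_of_supG {A : ℝ} (hA0 : A < 0) (UG : Fin J → ℕ → X → Y → ℝ)
    (hA : ∃ C : ℝ, ∀ n : ℕ, Ξ.supG UG n ≤ ENNReal.ofReal (C * (2 : ℝ) ^ ((n : ℝ) * A)))
    (k : Fin J) (ℓ : ℕ) (y : Y) : eLpNorm (fun x => UG k ℓ x y) ∞ Ξ.μ = 0 := by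
  obtain ⟨C, hC⟩ := hA
  have hlim : Tendsto (fun n : ℕ => ENNReal.ofReal (C * (2 : ℝ) ^ ((n : ℝ) * A))) atTop (𝓝 0) := by
    have h1 : Tendsto (fun n : ℕ => ((2 : ℝ) ^ A) ^ n) atTop (𝓝 0) :=
      tendsto_pow_atTop_nhds_zero_of_lt_one (by positivity)
        (Real.rpow_lt_one_of_one_lt_of_neg one_lt_two hA0)
    have h2 := (ENNReal.continuous_ofReal.tendsto _).comp (h1.const_mul C)
    rw [mul_zero, ENNReal.ofReal_zero] at h2
    refine h2.congr fun n => ?_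
    simp only [Function.comp]
    rw [← Real.rpow_natCast, ← Real.rpow_mul zero_le_two, mul_comm A]
  have hle : ∀ᶠ n : ℕ in atTop, eLpNorm (fun x => UG k ℓ x y) ∞ Ξ.μ ≤
      ENNReal.ofReal (C * (2 : ℝ) ^ ((n : ℝ) * A)) := by
    have h1 : Tendsto (fun n : ℕ => (2 : ℝ) ^ n) atTop atTop :=
      tendsto_pow_atTop_atTop_of_one_lt one_lt_two
    filter_upwards [h1.eventually_gt_atTop (Ξ.eig ℓ)] with n hn
    exact (eLpNorm_le_supG UG hn y k).trans (hC n)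
  exact le_antisymm (ge_of_tendsto hlim hle) bot_le

lemma exists_holder_of_supL {α B : ℝ} {UG : Fin J → ℕ → X → Y → ℝ}
    (hB : ∃ C : ℝ, ∀ n : ℕ, Ξ.supL α UG n ≤ ENNReal.ofReal (C * (2 : ℝ) ^ ((n : ℝ) * B))) :
    ∃ C : ℝ, 0 < C ∧ ∀ (n ℓ : ℕ), Ξ.eig ℓ < 2 ^ n → ∀ k x x' y,
      |UG k ℓ x y - UG k ℓ x' y| ≤ C * (2 : ℝ) ^ ((n : ℝ) * B) * dist x x' ^ α := by
  obtain ⟨C, hC⟩ := hB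
  refine ⟨|C| + 1, by positivity, fun n ℓ hℓ k x x' y => ?_⟩
  refine abs_sub_le_of_lipNorm_le (Ξ := Ξ) (g := fun x => UG k ℓ x y) (by positivity) ?_ x x'
  refine (lipNorm_le_supL UG hℓ y k).trans ((hC n).trans (ENNReal.ofReal_le_ofReal ?_))
  gcongr
  linarith [le_abs_self C]

lemma continuous_of_supL {α B : ℝ} (hα : 0 < α) {UG : Fin J → ℕ → X → Y → ℝ}
    (hB : ∃ C : ℝ, ∀ n : ℕ, Ξ.supL α UG n ≤ ENNReal.ofReal (C * (2 : ℝ) ^ ((n : ℝ) * B)))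
    (k : Fin J) (ℓ : ℕ) (y : Y) : Continuous fun x => UG k ℓ x y := by
  obtain ⟨C, -, hC⟩ := exists_holder_of_supL hB
  obtain ⟨n, hn⟩ := pow_unbounded_of_one_lt (Ξ.eig ℓ) (one_lt_two (α := ℝ))
  exact continuous_of_holder hα fun x x' => hC n ℓ hn k x x' y

/-- Sampling evaluates kernels at individual net points for every `y`, so an essential bound is not
enough; continuity upgrades it on the support of the measure. -/
lemma exists_bound_of_supG {α A B : ℝ} (hα : 0 < α) {UG : Fin J → ℕ → X → Y → ℝ}
    (hB : ∃ C : ℝ, ∀ n : ℕ, Ξ.supL α UG n ≤ ENNReal.ofReal (C * (2 : ℝ) ^ ((n : ℝ) * B)))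
    (hA : ∃ C : ℝ, ∀ n : ℕ, Ξ.supG UG n ≤ ENNReal.ofReal (C * (2 : ℝ) ^ ((n : ℝ) * A))) :
    ∃ C : ℝ, 0 < C ∧ ∀ (n ℓ : ℕ), Ξ.eig ℓ < 2 ^ n → ∀ k, ∀ x ∈ Ξ.μ.support, ∀ y,
      |UG k ℓ x y| ≤ C * (2 : ℝ) ^ ((n : ℝ) * A) := by
  obtain ⟨C, hC⟩ := hA
  refine ⟨|C| + 1, by positivity, fun n ℓ hℓ k x hx y => ?_⟩
  refine abs_le_of_eLpNorm_top_le (continuous_of_supL hα hB k ℓ y) (by positivity) ?_ hx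
  refine (eLpNorm_le_supG UG hℓ y k).trans ((hC n).trans (ENNReal.ofReal_le_ofReal ?_))
  gcongr
  linarith [le_abs_self C]

end Main

end DataSpace

namespace DataSpace

/-! ### Sampling at a fixed level and the final assembly. -/

section Main

variable {X : Type*} [MetricSpace X] [CompactSpace X] [MeasurableSpace X] [BorelSpace X]
  {Ξ : DataSpace X} {Y : Type*} [MeasurableSpace Y] {J : ℕ}

/-- A compatible operator vanishes on the Sobolev class if its kernel vanishes. -/
lemma IsDerivativeLike.exists_apply_eq_zero {ν : Measure Y} {p : ℝ≥0∞} [Fact (1 ≤ p)]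
    {G : ℕ → X → Y → ℝ} {D : ℕ → Y → ℝ} {U : Lp ℝ p Ξ.μ →ₗ.[ℝ] Lp ℝ p Ξ.μ} {a γ : ℝ}
    (hU : Ξ.IsDerivativeLike p U a) {UG : ℕ → X → Y → ℝ} (hUG : Ξ.IsCompatible ν p G D U UG)
    (hγ : 0 < γ) (haγ : a < γ) (hzero : ∀ᵐ x ∂Ξ.μ, ∀ ℓ y, UG ℓ x y = 0) {f : X → ℝ}
    (hf : Ξ.MemSobolev (max p 2) γ f) :
    ∃ F : U.domain, ((F : Lp ℝ p Ξ.μ) : X → ℝ) =ᵐ[Ξ.μ] f ∧ U F = 0 := by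
  obtain ⟨ψ, C, hψ⟩ := Ξ.exists_isLowPass
  obtain ⟨C', -, hC'⟩ := hU.exists_approx hψ hγ haγ
  obtain ⟨F, hF, hest⟩ := hC' f hf.1.1 hf.2
  refine ⟨F, hF, ?_⟩
  set S := (Ξ.sobolevNorm (max p 2) γ f).toReal
  have hle : ∀ n : ℕ, ‖U F‖ ≤ C' * S * ((2 : ℝ) ^ (a - γ)) ^ n := fun n => by
    obtain ⟨B, hB1, hB2⟩ := hUG.exists_lowPass (ψ := ψ) n f
    have hB0 : U B = 0 := by
      refine Lp.ext ?_
      filter_upwards [hB2, hzero, Lp.coeFn_zero ℝ p Ξ.μ] with x h1 h2 h3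
      rw [h1, h3]
      simp [h2]
    have := hest n B hB1
    rw [hB0, sub_zero] at this
    refine this.trans_eq ?_
    rw [← Real.rpow_natCast, ← Real.rpow_mul zero_le_two, mul_comm (a - γ)]
  have hlim : Tendsto (fun n : ℕ => C' * S * ((2 : ℝ) ^ (a - γ)) ^ n) atTop (𝓝 0) := by
    simpa using (tendsto_pow_atTop_nhds_zero_of_lt_one (r := (2 : ℝ) ^ (a - γ)) (by positivity)
      (Real.rpow_lt_one_of_one_lt_of_neg one_lt_two (by linarith))).const_mul (C' * S)
  exact norm_le_zero_iff.1 (ge_of_tendsto' hlim hle)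

lemma freq_nonempty (n : ℕ) : (Ξ.freq n).Nonempty :=
  ⟨0, by rw [mem_freq, Ξ.eig_zero]; positivity⟩

lemma eignetScale_nonneg (q β γ : ℝ) (n : ℕ) : 0 ≤ eignetScale q β γ n := by
  unfold eignetScale
  split_ifs <;> positivity

/-- Approximation at a fixed level, uniformly on a conull set. -/
lemma exists_level_samples (hone : Ξ.MemX ∞ (fun _ => 1)) (ν : Measure Y) [IsProbabilityMeasure ν]
    {α β γ A B : ℝ} {G : ℕ → X → Y → ℝ} {D : ℕ → Y → ℝ} (hG : Ξ.IsEignetKernel ν α β G D)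
    {UG : Fin J → ℕ → X → Y → ℝ} (hm : ∀ k ℓ x, AEStronglyMeasurable (UG k ℓ x) ν)
    (hγ : 0 < γ) (hA0 : 0 ≤ A)
    (hA : ∃ C : ℝ, ∀ n : ℕ, Ξ.supG UG n ≤ ENNReal.ofReal (C * (2 : ℝ) ^ ((n : ℝ) * A)))
    (hB : ∃ C : ℝ, ∀ n : ℕ, Ξ.supL α UG n ≤ ENNReal.ofReal (C * (2 : ℝ) ^ ((n : ℝ) * B)))
    {ψ : ℕ → ℕ → ℝ} {C : ℝ} (hψ : Ξ.IsLowPass ψ C) {C₀ σ : ℝ} (hC₀ : 0 < C₀) (hσ : 0 < σ) :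
    ∃ (c E : ℝ), 0 < c ∧ 0 < E ∧ ∀ (M n : ℕ), 2 ≤ M → 1 ≤ n → (2 : ℝ) ^ n ≤ C₀ * (M : ℝ) ^ σ →
      ∀ (p : ℝ≥0∞), 2 ≤ p → ∀ f : X → ℝ, MemLp f p Ξ.μ → Ξ.sobolevNorm p γ f < ∞ →
        ∃ (ℓ : Fin M → ℕ) (y : Fin M → Y) (w : Fin M → ℝ), (∀ j, w j = 1 ∨ w j = -1) ∧
          ∀ k, ∀ᵐ x ∂Ξ.μ, |∑ i ∈ Ξ.freq n, ψ n i * Ξ.coef f i * ∫ y, UG k i x y * D i y ∂ν -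
              c * (Ξ.sobolevNorm p γ f).toReal * eignetScale Ξ.q β γ n / M *
                ∑ j, w j * UG k (ℓ j) x (y j)| ≤
            E * (Ξ.sobolevNorm p γ f).toReal *
              (eignetScale Ξ.q β γ n * (2 : ℝ) ^ ((n : ℝ) * A) * Real.sqrt (Real.log M / M)) := by
  have hα := hG.alpha_pos
  obtain ⟨Z, cZ, s, r₀, hcZ, hs, hr₀, hZs, hZae, hnet⟩ := Ξ.exists_nets hone
  obtain ⟨c, hc, hmass⟩ := hG.exists_mass_le hψ hγ
  obtain ⟨CA, hCA, hbd⟩ := exists_bound_of_supG hα hB hA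
  obtain ⟨CB, hCB, hhol⟩ := exists_holder_of_supL hB
  obtain ⟨K, Cm, hK, hCm, hmesh⟩ := exists_mesh (c := cZ) (s := s) (r₀ := r₀) (α := α) (A := A)
    (B := B) (J := (J : ℝ)) hC₀ hσ hs hr₀ hα hA0
  obtain ⟨Cd, -, hD⟩ := hG.exists_integral_abs_le
  -- The first summand is the Hoeffding error with `Λ = K log M`, the second the two Hölder errors,
  -- which the mesh makes equally small.
  refine ⟨c, c * (CA * Real.sqrt (2 * K) + 2 * (CB * Cm)), hc, by positivity,
    fun M n hM hn hnM p hp f hf hS => ?_⟩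
  set S := (Ξ.sobolevNorm p γ f).toReal with hSdef
  have hS0 : 0 ≤ S := ENNReal.toReal_nonneg
  set T := eignetScale Ξ.q β γ n with hT
  have hT0 : 0 ≤ T := eignetScale_nonneg _ _ _ _
  have hM0 : 0 < M := by omega
  have hl : 0 < Real.log M := Real.log_pos (by exact_mod_cast (by omega : 1 < M))
  obtain ⟨ε, hε, hεr, hexp, hεB⟩ := hmesh M n hM hnM
  obtain ⟨N, hNZ, hNc, hNnet⟩ := hnet ε hε hεr
  have hDint : ∀ ℓ, Integrable (D ℓ) ν := fun ℓ => by
    obtain ⟨j, hj⟩ := exists_mem_band (Ξ := Ξ) ℓ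
    exact (hD j ℓ hj).1
  have hgW : ∑ i ∈ Ξ.freq n, ∫ y, |ψ n i * Ξ.coef f i * D i y| ∂ν ≤ c * S * T := by
    refine le_trans (le_of_eq (Finset.sum_congr rfl fun i _ => ?_)) (hmass p hp f hf hS n hn)
    simp_rw [abs_mul (ψ n i * Ξ.coef f i)]
    rw [integral_const_mul]
  obtain ⟨ℓ, y, w, hw, hest⟩ := exists_uniform_signed_samples ν (Ξ.freq n) (freq_nonempty n)
    (fun i y => ψ n i * Ξ.coef f i * D i y) (fun i => (hDint i).const_mul _) (W := c * S * T)
    (by positivity) hgW UG (fun k ℓ x => (hm k ℓ x).aemeasurable) (Z := Z)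
    (b := CA * (2 : ℝ) ^ ((n : ℝ) * A)) (h := CB * (2 : ℝ) ^ ((n : ℝ) * B)) (ε := ε) (α := α)
    (Λ := K * Real.log M) (by positivity) (by positivity) hα
    (fun k ℓ hℓ x hx y => hbd n ℓ ((Ξ.mem_freq).1 hℓ) k x (hZs hx) y)
    (fun k ℓ hℓ x x' y => hhol n ℓ ((Ξ.mem_freq).1 hℓ) k x x' y) N hNZ hNnet (by positivity)
    (by
      refine le_trans ?_ hexp
      rw [Fintype.card_fin]
      gcongr) hM0
  refine ⟨ℓ, y, w, hw, fun k => ?_⟩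
  filter_upwards [hZae] with x hx
  have h1 := hest k x hx
  have e : ∀ i, ∫ y, UG k i x y * (ψ n i * Ξ.coef f i * D i y) ∂ν =
      ψ n i * Ξ.coef f i * ∫ y, UG k i x y * D i y ∂ν := fun i => by
    rw [← integral_const_mul]; congr 1; ext y; ring
  simp_rw [e] at h1
  refine h1.trans ?_
  have hsq : Real.sqrt (2 * (K * Real.log M) / M) =
      Real.sqrt (2 * K) * Real.sqrt (Real.log M / M) := by
    rw [← Real.sqrt_mul (by positivity)]; congr 1; ring
  rw [hsq]
  calc _ = c * S * T * (CA * (2 : ℝ) ^ ((n : ℝ) * A) *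
        (Real.sqrt (2 * K) * Real.sqrt (Real.log M / M))) +
        2 * (c * S * T * (CB * ((2 : ℝ) ^ ((n : ℝ) * B) * ε ^ α))) := by ring
    _ ≤ c * S * T * (CA * (2 : ℝ) ^ ((n : ℝ) * A) *
        (Real.sqrt (2 * K) * Real.sqrt (Real.log M / M))) +
        2 * (c * S * T * (CB * (Cm * ((2 : ℝ) ^ ((n : ℝ) * A) *
          Real.sqrt (Real.log M / M))))) := by gcongr
    _ = _ := by ring

end Main

end DataSpace

theorem mainTheorem2 {X : Type*} [MetricSpace X] [CompactSpace X] [MeasurableSpace X]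
    [BorelSpace X] (Ξ : DataSpace X)
    (hone : Ξ.MemX ∞ (fun _ => 1))
    {Y : Type*} [MeasurableSpace Y] (ν : Measure Y) [IsProbabilityMeasure ν]
    (α β γ A B : ℝ) (hβ : 0 < β)
    (G : ℕ → X → Y → ℝ) (D : ℕ → Y → ℝ) (hG : Ξ.IsEignetKernel ν α β G D)
    (p : ℝ≥0∞) [Fact (1 ≤ p)]
    (J : ℕ) (hJ : 0 < J)
    (U : Fin J → (Lp ℝ p Ξ.μ →ₗ.[ℝ] Lp ℝ p Ξ.μ)) (a : Fin J → ℝ)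
    (hU : ∀ k, Ξ.IsDerivativeLike p (U k) (a k))
    (UG : Fin J → ℕ → X → Y → ℝ)
    (hUG : ∀ k, Ξ.IsCompatible ν p G D (U k) (UG k))
    (hγ : 0 < γ) (hγa : ∀ k, a k < γ)
    (hA : ∃ C : ℝ, ∀ n : ℕ, Ξ.supG UG n ≤ ENNReal.ofReal (C * (2 : ℝ) ^ ((n : ℝ) * A)))
    (hB : ∃ C : ℝ, ∀ n : ℕ, Ξ.supL α UG n ≤ ENNReal.ofReal (C * (2 : ℝ) ^ ((n : ℝ) * B))) :
    ∃ c C : ℝ, 0 < c ∧ 0 < C ∧ ∀ M : ℕ, 2 ≤ M → ∃ n : ℕ,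
      ∀ f : X → ℝ, Ξ.MemSobolev (max p 2) γ f →
        ∃ (ℓ : Fin M → ℕ) (y : Fin M → Y) (w : Fin M → ℝ),
          (∀ j, w j = 1 ∨ w j = -1) ∧
          ∀ k : Fin J, ∃ F : (U k).domain,
            ((F : Lp ℝ p Ξ.μ) : X → ℝ) =ᵐ[Ξ.μ] f ∧
            eLpNorm (fun x => (U k F : X → ℝ) x -
                c * (Ξ.sobolevNorm (max p 2) γ f).toReal * eignetScale Ξ.q β γ n / M *
                  ∑ j, w j * UG k (ℓ j) x (y j)) p Ξ.μ
              ≤ ENNReal.ofReal (C * eignetRate Ξ.q β γ A (⨅ i, a i) (a k) M) *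
                  Ξ.sobolevNorm (max p 2) γ f := by
  have hα := hG.alpha_pos
  rcases lt_or_ge A 0 with hA0 | hA0
  · have hzero : ∀ k, ∀ᵐ x ∂Ξ.μ, ∀ ℓ y, UG k ℓ x y = 0 := fun k => by
      filter_upwards [Measure.support_mem_ae (μ := Ξ.μ)] with x hx ℓ y
      have h0 := DataSpace.eq_zero_of_supG hA0 UG hA k ℓ y
      exact abs_nonpos_iff.1 (DataSpace.abs_le_of_eLpNorm_top_le
        (DataSpace.continuous_of_supL hα hB k ℓ y) le_rfl (by rw [h0]; exact bot_le) hx)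
    have hY : Nonempty Y := nonempty_of_isProbabilityMeasure ν
    -- For `A < 0` both the sum and the images of `f` vanish almost everywhere, so any samples and
    -- constants will do.
    refine ⟨1, 1, one_pos, one_pos, fun M _ => ⟨0, fun f hf => ⟨fun _ => 0,
      fun _ => Classical.arbitrary Y, fun _ => 1, fun _ => Or.inl rfl, fun k => ?_⟩⟩⟩
    obtain ⟨F, hF, hF0⟩ := (hU k).exists_apply_eq_zero (hUG k) hγ (hγa k) (hzero k) hf
    refine ⟨F, hF, ?_⟩
    rw [eLpNorm_congr_ae (g := fun _ => (0 : ℝ))]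
    · simp
    · rw [hF0]
      filter_upwards [hzero k, Lp.coeFn_zero ℝ p Ξ.μ] with x h1 h2
      rw [h2]
      simp [h1]
  · have hJne : Nonempty (Fin J) := ⟨⟨0, hJ⟩⟩
    have hmin : ∀ k, ⨅ i, a i ≤ a k := fun k => ciInf_le (Set.finite_range a).bddBelow k
    have hminγ : ⨅ i, a i < γ := (hmin hJne.some).trans_lt (hγa _)
    obtain ⟨ψ, Cψ, hψ⟩ := Ξ.exists_isLowPass
    choose C₁ hC₁ happ using fun k => (hU k).exists_approx hψ hγ (hγa k)
    obtain ⟨C₀, σ, hC₀, hσ, hscale⟩ := exists_scale (q := Ξ.q) (β := β) hA0 hminγ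
    obtain ⟨c, E, hc, hE, hsamp⟩ := DataSpace.exists_level_samples hone ν hG
      (fun k ℓ x => (hUG k).aesm ℓ x) hγ hA0 hA hB hψ hC₀ hσ
    -- Summing the truncation constants makes the bound uniform in `k`. The level `n` below depends
    -- on `M` only; `f` enters through the samples.
    refine ⟨c, ∑ k, C₁ k + E * C₀, hc,
      add_pos_of_nonneg_of_pos (Finset.sum_nonneg fun k _ => (hC₁ k).le) (by positivity),
      fun M hM => ?_⟩
    obtain ⟨n, hn1, hnM, hrate⟩ := hscale M hM
    refine ⟨n, fun f hf => ?_⟩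
    obtain ⟨ℓ, y, w, hw, hest⟩ := hsamp M n hM hn1 hnM (max p 2) (le_max_right _ _) f hf.1.1 hf.2
    refine ⟨ℓ, y, w, hw, fun k => ?_⟩
    obtain ⟨F, hF, hFB⟩ := happ k f hf.1.1 hf.2
    refine ⟨F, hF, ?_⟩
    obtain ⟨b, hb1, hb2⟩ := (hUG k).exists_lowPass (ψ := ψ) n f
    set S := (Ξ.sobolevNorm (max p 2) γ f).toReal with hS
    have hS0 : 0 ≤ S := ENNReal.toReal_nonneg
    obtain ⟨hr1, hr2⟩ := hrate (a k) (hmin k) (hγa k)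
    set R := eignetRate Ξ.q β γ A (⨅ i, a i) (a k) M with hR
    have hR0 : 0 ≤ R := le_trans (by positivity) hr1
    set Q : X → ℝ := fun x => c * S * eignetScale Ξ.q β γ n / M *
      ∑ j, w j * UG k (ℓ j) x (y j) with hQ
    have hQc : Continuous Q := continuous_const.mul (continuous_finsetSum _ fun j _ =>
      continuous_const.mul (DataSpace.continuous_of_supL hα hB k (ℓ j) (y j)))
    have h1 : eLpNorm (fun x => (U k F : X → ℝ) x - (U k b : X → ℝ) x) p Ξ.μ ≤
        ENNReal.ofReal (C₁ k * S * R) := by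
      have h3 := hFB n b hb1
      rw [Lp.norm_def, eLpNorm_congr_ae (Lp.coeFn_sub (U k F) (U k b))] at h3
      refine (ENNReal.le_ofReal_iff_toReal_le ?_ ?_).2 (h3.trans ?_)
      · exact ((Lp.memLp (U k F)).sub (Lp.memLp (U k b))).2.ne
      · have := hC₁ k; positivity
      · have := hC₁ k
        gcongr
    have h2 : eLpNorm (fun x => (U k b : X → ℝ) x - Q x) p Ξ.μ ≤
        ENNReal.ofReal (E * C₀ * S * R) := by
      have h3 : ∀ᵐ x ∂Ξ.μ, ‖(U k b : X → ℝ) x - Q x‖ ≤ E * C₀ * S * R := by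
        filter_upwards [hb2, hest k] with x hx1 hx2
        rw [hx1, Real.norm_eq_abs]
        refine hx2.trans ?_
        calc _ ≤ E * S * (C₀ * R) := by gcongr
          _ = _ := by ring
      refine (eLpNorm_le_of_ae_bound h3).trans_eq ?_
      simp
    have e : (fun x => (U k F : X → ℝ) x - Q x) = fun x =>
        ((U k F : X → ℝ) x - (U k b : X → ℝ) x) + ((U k b : X → ℝ) x - Q x) := by
      ext x; ring
    change eLpNorm (fun x => (U k F : X → ℝ) x - Q x) p Ξ.μ ≤ _
    rw [e]
    refine (eLpNorm_add_le ((Lp.memLp (U k F)).sub (Lp.memLp (U k b))).1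
      ((Lp.memLp (U k b)).1.sub hQc.aestronglyMeasurable) Fact.out).trans ?_
    refine (add_le_add h1 h2).trans ?_
    have hk0 := hC₁ k
    rw [← ENNReal.ofReal_toReal hf.2.ne, ← hS, ← ENNReal.ofReal_add (by positivity) (by positivity),
      ← ENNReal.ofReal_mul (mul_nonneg (add_nonneg (Finset.sum_nonneg fun k _ => (hC₁ k).le)
        (by positivity)) hR0)]
    refine ENNReal.ofReal_le_ofReal ?_
    have hk1 : C₁ k ≤ ∑ k, C₁ k := Finset.single_le_sum (fun i _ => (hC₁ i).le) (Finset.mem_univ k)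
    calc _ = (C₁ k + E * C₀) * R * S := by ring
      _ ≤ _ := by gcongr
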